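/- Let $R=\mathbb{Z}[\sqrt{-2}]\subset\mathbb{C}$ and let $\mathrm{SL}_2(R)$ act on hyperbolic 3-space $\mathcal{H}^3=\{(z,\zeta)\in\mathbb{C}\times\mathbb{R} : \zeta>0\}$ by $$\begin{pmatrix}a&b\\c&d\end{pmatrix}\cdot(z,\zeta)=\left(\frac{\overline{(cz+d)}(az+b)+\zeta^2\bar c a}{|cz+d|^2+\zeta^2|c|^2},\ \frac{\zeta}{|cz+d|^2+\zeta^2|c|^2}\right).$$ Let $X\subset\mathcal{H}^3$ be Mendoza's $2$-dimensional $\mathrm{SL}_2(R)$-equivariant retract, that is, the $\mathrm{SL}_2(R)$-invariant set of points $(z,\zeta)$ for which the minimum of the distances $\frac{|\mu z-\lambda|^2+|\mu|^2\zeta^2}{\zeta}$ to the cusps $\lambda/\mu\in\mathbb{Q}(\sqrt{-2})\cup\{\infty\}$ ($\lambda,\mu\in R$ coprime) is attained at two or more different cusps. Let $\Gamma_0(\sqrt{-2})$ be the group of matrices $\begin{pmatrix}a&b\\c&d\end{pmatrix}\in\mathrm{SL}_2(R)$ with $c\in(\sqrt{-2})$, let $i:\Gamma_0(\sqrt{-2})\to\mathrm{SL}_2(R)$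 be the inclusion, and let $j:\Gamma_0(\sqrt{-2})\to\mathrm{SL}_2(R)$, $$j\begin{pmatrix}a&b\\c&d\end{pmatrix}=\begin{pmatrix}d&\sqrt{-2}^{\,-1}c\\ b\sqrt{-2}&a\end{pmatrix},$$ be conjugation by $\begin{pmatrix}0&1\\\sqrt{-2}&0\end{pmatrix}$. Then $i$ and $j$ induce maps $i^n, j^n:\mathrm{H}^n(\mathrm{SL}_2(R)\backslash X;\mathbb{F}_2)\to\mathrm{H}^n(\Gamma_0(\sqrt{-2})\backslash X;\mathbb{F}_2)$ on (singular) cohomology for all $n\ge 0$: the map $i^n$ is induced by the projection $\Gamma_0(\sqrt{-2})\backslash X\to\mathrm{SL}_2(R)\backslash X$, and $j^n$ is induced by the map of orbit spaces $\Gamma_0(\sqrt{-2})\backslash X\to\mathrm{SL}_2(R)\backslash X$ coming from any continuous map $J:X\to X$ with $J(\gamma x)=j(\gamma)J(x)$ for all $\gamma\in\Gamma_0(\sqrt{-2})$ and $x\in X$; such maps $J$ exist, and they all induce the same $j^n$. The map $$(i^n,j^n):\ \mathrm{H}^n(\mathrm{SL}_2(R)\backslash X;\mathbb{F}_2)\oplus\mathrm{H}^n(\mathrm{SL}_2(R)\backslash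 X;\mathbb{F}_2)\longrightarrow\mathrm{H}^n(\Gamma_0(\sqrt{-2})\backslash X;\mathbb{F}_2),\qquad (x,y)\mapsto i^n(x)+j^n(y),$$ is injective for every $n\neq 0$ and surjective for every $n\neq 2$, and moreover $\ker(i^0,j^0)\cong\mathbb{F}_2$ and $\operatorname{coker}(i^2,j^2)\cong\mathbb{F}_2$. -/

import Mathlib

open CategoryTheory

noncomputable section

/-! ### Singular cohomology with coefficients in `𝔽₂` -/

/-- The singular cochain functor with coefficients in `𝔽₂`: the complex `Hom(C_*(Y; 𝔽₂), 𝔽₂)`,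
contravariant in the space `Y`. -/
def singularCochainFunctor :
    TopCat.{0}ᵒᵖ ⥤ HomologicalComplex (ModuleCat.{0} (ZMod 2)) (ComplexShape.down ℕ).symm :=
  ((AlgebraicTopology.singularChainComplexFunctor (ModuleCat.{0} (ZMod 2))).obj
      (ModuleCat.of (ZMod 2) (ZMod 2)) ⋙
    ((linearYoneda (ZMod 2) (ModuleCat.{0} (ZMod 2))).obj
      (ModuleCat.of (ZMod 2) (ZMod 2))).rightOp.mapHomologicalComplex (ComplexShape.down ℕ)).op ⋙
  HomologicalComplex.unopFunctor (ModuleCat.{0} (ZMod 2)) (ComplexShape.down ℕ)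

/-- `Hⁿ(-; 𝔽₂)` as a contravariant functor. -/
def singularCohomologyFunctor (n : ℕ) : TopCat.{0}ᵒᵖ ⥤ ModuleCat.{0} (ZMod 2) :=
  singularCochainFunctor ⋙ HomologicalComplex.homologyFunctor _ _ n

/-- `Hⁿ(Y; 𝔽₂)`. -/
abbrev SingularCohomology (n : ℕ) (Y : Type) [TopologicalSpace Y] : ModuleCat.{0} (ZMod 2) :=
  (singularCohomologyFunctor n).obj (Opposite.op (TopCat.of Y))

/-- The pullback `f^* : Hⁿ(Z; 𝔽₂) → Hⁿ(Y; 𝔽₂)` along a continuous map `f : Y → Z`. -/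
def SingularCohomology.map (n : ℕ) {Y Z : Type} [TopologicalSpace Y] [TopologicalSpace Z]
    (f : C(Y, Z)) : SingularCohomology n Z →ₗ[ZMod 2] SingularCohomology n Y :=
  ((singularCohomologyFunctor n).map (TopCat.ofHom f).op).hom

/-! ### Maps of orbit spaces -/

/-- `f` is equivariant along the group homomorphism `φ`. -/
def EquivariantAlong {G H Y Z : Type} [Group G] [Group H] [MulAction G Y] [MulAction H Z]
    (φ : G →* H) (f : Y → Z) : Prop :=
  ∀ (g : G) (y : Y), f (g • y) = φ g • f y

/-- The map of orbit spaces `G\Y → H\Z` induced by a `φ`-equivariant continuous map `Y → Z`. -/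
def orbitSpaceMap {G H Y Z : Type} [Group G] [Group H] [MulAction G Y] [MulAction H Z]
    [TopologicalSpace Y] [TopologicalSpace Z] (φ : G →* H) (f : C(Y, Z))
    (hf : EquivariantAlong φ f) :
    C(MulAction.orbitRel.Quotient G Y, MulAction.orbitRel.Quotient H Z) where
  toFun := Quotient.map f (by
    rintro _ y ⟨g, rfl⟩
    exact ⟨φ g, (hf g y).symm⟩)
  continuous_toFun := f.continuous.quotient_map' _

/-! ### Hyperbolic 3-space -/

/-- The upper half-space model of hyperbolic 3-space. -/
def UpperHalfSpace : Type := {p : ℂ × ℝ // 0 < p.2}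

namespace UpperHalfSpace

instance : TopologicalSpace UpperHalfSpace :=
  inferInstanceAs (TopologicalSpace {p : ℂ × ℝ // 0 < p.2})

/-- The boundary coordinate. -/
def z (p : UpperHalfSpace) : ℂ := p.1.1

/-- The height. -/
def ht (p : UpperHalfSpace) : ℝ := p.1.2

lemma ht_pos (p : UpperHalfSpace) : 0 < p.ht := p.2

lemma ext' {p q : UpperHalfSpace} (hz : p.z = q.z) (ht : p.ht = q.ht) : p = q :=
  Subtype.ext (Prod.ext hz ht)

open Matrix ComplexConjugate

/-- `|cz + d|² + ζ²|c|²`. -/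
def den (g : SpecialLinearGroup (Fin 2) ℂ) (p : UpperHalfSpace) : ℝ :=
  Complex.normSq (g 1 0 * p.z + g 1 1) + p.ht ^ 2 * Complex.normSq (g 1 0)

lemma det_eq (g : SpecialLinearGroup (Fin 2) ℂ) : g 0 0 * g 1 1 - g 0 1 * g 1 0 = 1 := by
  have h := g.det_coe
  rwa [Matrix.det_fin_two] at h

lemma den_pos (g : SpecialLinearGroup (Fin 2) ℂ) (p : UpperHalfSpace) : 0 < den g p := by
  have hp := p.ht_pos
  have hd := det_eq g
  unfold den
  by_cases hc : g 1 0 = 0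
  · have h1 : g 1 1 ≠ 0 := by
      intro h
      simp [hc, h] at hd
    have := Complex.normSq_pos.2 h1
    simpa [hc] using this
  · have := Complex.normSq_pos.2 hc
    have h0 := Complex.normSq_nonneg (g 1 0 * p.z + g 1 1)
    positivity

/-- `conj (cz + d) (az + b) + ζ² (conj c) a`. -/
def num (g : SpecialLinearGroup (Fin 2) ℂ) (p : UpperHalfSpace) : ℂ :=
  conj (g 1 0 * p.z + g 1 1) * (g 0 0 * p.z + g 0 1) + (p.ht : ℂ) ^ 2 * conj (g 1 0) * g 0 0

/-- Poincaré's formulas for the action of `SL₂(ℂ)`. -/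
instance : SMul (SpecialLinearGroup (Fin 2) ℂ) UpperHalfSpace where
  smul g p := ⟨(num g p / (den g p : ℂ), p.ht / den g p), div_pos p.ht_pos (den_pos g p)⟩

lemma smul_z (g : SpecialLinearGroup (Fin 2) ℂ) (p : UpperHalfSpace) :
    (g • p).z = num g p / (den g p : ℂ) := rfl

lemma smul_ht (g : SpecialLinearGroup (Fin 2) ℂ) (p : UpperHalfSpace) :
    (g • p).ht = p.ht / den g p := rfl

lemma den_cast (g : SpecialLinearGroup (Fin 2) ℂ) (p : UpperHalfSpace) :
    (den g p : ℂ) = conj (g 1 0 * p.z + g 1 1) * (g 1 0 * p.z + g 1 1)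
      + (p.ht : ℂ) ^ 2 * (conj (g 1 0) * g 1 0) := by
  unfold den
  push_cast
  rw [Complex.normSq_eq_conj_mul_self, Complex.normSq_eq_conj_mul_self]

lemma num_mul_conj (g : SpecialLinearGroup (Fin 2) ℂ) (p : UpperHalfSpace) :
    num g p * conj (num g p) + (p.ht : ℂ) ^ 2 =
      (den g p : ℂ) * (conj (g 0 0 * p.z + g 0 1) * (g 0 0 * p.z + g 0 1)
        + (p.ht : ℂ) ^ 2 * (conj (g 0 0) * g 0 0)) := by
  have h1 := det_eq g
  have h2 := congrArg conj h1
  rw [den_cast]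
  simp only [num, map_add, map_mul, map_sub, map_one, map_pow, Complex.conj_conj,
    Complex.conj_ofReal] at *
  linear_combination (-(p.ht : ℂ) ^ 2) * (g 0 0 * g 1 1 - g 0 1 * g 1 0) * h2
    - (p.ht : ℂ) ^ 2 * h1

/-- The Hermitian form of a point and its behaviour under the action. -/
lemma form_smul (g : SpecialLinearGroup (Fin 2) ℂ) (p : UpperHalfSpace) (x y : ℂ) :
    (den g p : ℂ) * (conj (x * (g • p).z + y) * (x * (g • p).z + y)
        + ((g • p).ht : ℂ) ^ 2 * (conj x * x)) =
      conj ((x * g 0 0 + y * g 1 0) * p.z + (x * g 0 1 + y * g 1 1)) *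
          ((x * g 0 0 + y * g 1 0) * p.z + (x * g 0 1 + y * g 1 1))
        + (p.ht : ℂ) ^ 2 * (conj (x * g 0 0 + y * g 1 0) * (x * g 0 0 + y * g 1 0)) := by
  have hd : (den g p : ℂ) ≠ 0 := by exact_mod_cast (den_pos g p).ne'
  have hk := num_mul_conj g p
  have e1 : (den g p : ℂ) * (conj (x * (g • p).z + y) * (x * (g • p).z + y)
        + ((g • p).ht : ℂ) ^ 2 * (conj x * x)) =
      conj x * x * ((num g p * conj (num g p) + (p.ht : ℂ) ^ 2) / den g p)
        + conj x * y * conj (num g p) + x * conj y * num g p + conj y * y * den g p := by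
    rw [smul_z, smul_ht]
    simp only [map_add, map_mul, map_div₀, Complex.conj_ofReal, Complex.ofReal_div]
    field_simp
    ring
  rw [e1, hk, mul_div_cancel_left₀ _ hd, den_cast]
  simp only [num, map_add, map_mul, map_pow, Complex.conj_conj, Complex.conj_ofReal]
  ring

lemma mul_entry {R : Type} [CommRing R] (g h : SpecialLinearGroup (Fin 2) R) (i j : Fin 2) :
    (g * h) i j = g i 0 * h 0 j + g i 1 * h 1 j := by
  change ((g : Matrix (Fin 2) (Fin 2) R) * (h : Matrix (Fin 2) (Fin 2) R)) i j = _
  rw [Matrix.mul_apply, Fin.sum_univ_two]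

lemma den_mul (g h : SpecialLinearGroup (Fin 2) ℂ) (p : UpperHalfSpace) :
    den (g * h) p = den h p * den g (h • p) := by
  have := form_smul h p (g 1 0) (g 1 1)
  rw [← den_cast] at this
  apply Complex.ofReal_injective
  rw [Complex.ofReal_mul, this, den_cast]
  simp only [mul_entry]

lemma num_mul (g h : SpecialLinearGroup (Fin 2) ℂ) (p : UpperHalfSpace) :
    num (g * h) p = den h p * num g (h • p) := by
  have hd : (den h p : ℂ) ≠ 0 := by exact_mod_cast (den_pos h p).ne'
  have hk := num_mul_conj h p
  have e1 : (den h p : ℂ) * num g (h • p) =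
      conj (g 1 0) * g 0 0 * ((num h p * conj (num h p) + (p.ht : ℂ) ^ 2) / den h p)
        + conj (g 1 0) * g 0 1 * conj (num h p) + g 0 0 * conj (g 1 1) * num h p
        + conj (g 1 1) * g 0 1 * den h p := by
    rw [num, smul_z, smul_ht]
    simp only [map_add, map_mul, map_div₀, Complex.conj_ofReal, Complex.ofReal_div]
    field_simp
    ring
  rw [e1, hk, mul_div_cancel_left₀ _ hd, den_cast]
  simp only [num, mul_entry, map_add, map_mul, map_pow, Complex.conj_conj, Complex.conj_ofReal]
  ring

instance : MulAction (SpecialLinearGroup (Fin 2) ℂ) UpperHalfSpace where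
  one_smul p := by
    apply ext'
    · simp [smul_z, num, den]
    · simp [smul_ht, den]
  mul_smul g h p := by
    have h1 : (den h p : ℂ) ≠ 0 := by exact_mod_cast (den_pos h p).ne'
    have h1' := (den_pos h p).ne'
    apply ext'
    · rw [smul_z, smul_z, num_mul, den_mul, Complex.ofReal_mul, mul_div_mul_left _ _ h1]
    · rw [smul_ht, smul_ht, smul_ht, den_mul, div_div]

end UpperHalfSpace

/-! ### The groups -/

/-- The embedding `ℤ[√-2] → ℂ` with `√-2 ↦ √2 i`. -/
def toComplex : ℤ√(-2) →+* ℂ :=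
  Zsqrtd.lift ⟨(Real.sqrt 2 : ℂ) * Complex.I, by
    have h : (Real.sqrt 2 : ℂ) * (Real.sqrt 2 : ℂ) = 2 := by
      rw [← Complex.ofReal_mul, Real.mul_self_sqrt (by norm_num)]
      norm_num
    push_cast
    linear_combination (-1 : ℂ) * h + (Real.sqrt 2 : ℂ) * (Real.sqrt 2 : ℂ) * Complex.I_mul_I⟩

/-- The Bianchi group `SL₂(ℤ[√-2])`. -/
abbrev Bianchi : Type := Matrix.SpecialLinearGroup (Fin 2) (ℤ√(-2))

instance : MulAction Bianchi UpperHalfSpace :=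
  MulAction.compHom UpperHalfSpace (Matrix.SpecialLinearGroup.map (n := Fin 2) toComplex)

lemma bianchi_det (g : Bianchi) : g 0 0 * g 1 1 - g 0 1 * g 1 0 = 1 := by
  have h := g.det_coe
  rwa [Matrix.det_fin_two] at h

/-- `Γ₀(√-2)`: the matrices in `SL₂(ℤ[√-2])` whose lower left entry lies in the ideal `(√-2)`. -/
def Gamma0 : Subgroup Bianchi where
  carrier := {g | g 1 0 ∈ Ideal.span {(Zsqrtd.sqrtd : ℤ√(-2))}}
  one_mem' := by simp
  mul_mem' {g h} hg hh := by
    rw [Set.mem_ofPred_eq] at *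
    rw [UpperHalfSpace.mul_entry]
    exact Ideal.add_mem _ (Ideal.mul_mem_right _ _ hg) (Ideal.mul_mem_left _ _ hh)
  inv_mem' {g} hg := by
    rw [Set.mem_ofPred_eq] at *
    rw [Matrix.SpecialLinearGroup.SL2_inv_expl]
    simpa using hg

/-- The natural inclusion `i : Γ₀(√-2) → SL₂(ℤ[√-2])`. -/
abbrev iHom : Gamma0 →* Bianchi := Gamma0.subtype

/-- Division by `√-2` (exact on the ideal `(√-2)`): `(x + y√-2)/√-2 = y - (x/2)√-2`. -/
def divSqrt (c : ℤ√(-2)) : ℤ√(-2) := ⟨c.im, -(c.re / 2)⟩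

lemma sqrtd_mul_divSqrt {c : ℤ√(-2)} (hc : c ∈ Ideal.span {(Zsqrtd.sqrtd : ℤ√(-2))}) :
    Zsqrtd.sqrtd * divSqrt c = c := by
  obtain ⟨t, rfl⟩ := Ideal.mem_span_singleton'.1 hc
  ext <;> simp [divSqrt]
  omega

lemma sqrtd_cancel {x y : ℤ√(-2)} (h : Zsqrtd.sqrtd * x = Zsqrtd.sqrtd * y) : x = y := by
  have h1 := congrArg Zsqrtd.re h
  have h2 := congrArg Zsqrtd.im h
  simp at h1 h2
  ext <;> omega

/-- The injection `j : Γ₀(√-2) → SL₂(ℤ[√-2])`,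
`(a, b; c, d) ↦ (d, c/√-2; b√-2, a)`, i.e. conjugation by `(0, 1; √-2, 0)`. -/
def jHom : Gamma0 →* Bianchi where
  toFun g := ⟨!![g.1 1 1, divSqrt (g.1 1 0); g.1 0 1 * Zsqrtd.sqrtd, g.1 0 0], by
    rw [Matrix.det_fin_two_of]
    linear_combination bianchi_det g.1 - g.1 0 1 * sqrtd_mul_divSqrt g.2⟩
  map_one' := by
    apply Subtype.ext
    refine Matrix.ext fun i j => ?_
    fin_cases i <;> fin_cases j <;> simp [divSqrt] <;> rfl
  map_mul' g h := by
    have hg := sqrtd_mul_divSqrt g.2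
    have hh := sqrtd_mul_divSqrt h.2
    have hgh := sqrtd_mul_divSqrt (g * h).2
    have e : ∀ i j, (g * h).1 i j = g.1 i 0 * h.1 0 j + g.1 i 1 * h.1 1 j :=
      UpperHalfSpace.mul_entry g.1 h.1
    apply Subtype.ext
    refine Matrix.ext fun i j => ?_
    refine Eq.trans ?_ (UpperHalfSpace.mul_entry _ _ i j).symm
    simp only [e] at hgh ⊢
    fin_cases i <;> fin_cases j <;> simp
    · linear_combination -h.1 0 1 * hg
    · apply sqrtd_cancel
      linear_combination hgh - h.1 0 0 * hg - g.1 1 1 * hh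
    · ring
    · linear_combination -g.1 0 1 * hh

/-- `j` is conjugation by `(0, 1; √-2, 0)`. -/
lemma jHom_spec (g : Gamma0) :
    !![0, 1; Zsqrtd.sqrtd, 0] * (g.1 : Matrix (Fin 2) (Fin 2) (ℤ√(-2))) =
      (jHom g : Matrix (Fin 2) (Fin 2) (ℤ√(-2))) * !![0, 1; Zsqrtd.sqrtd, 0] := by
  have hg := sqrtd_mul_divSqrt g.2
  refine Matrix.ext fun i j => ?_
  have h00 : jHom g 0 0 = g.1 1 1 := rfl
  have h01 : jHom g 0 1 = divSqrt (g.1 1 0) := rfl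
  have h10 : jHom g 1 0 = g.1 0 1 * Zsqrtd.sqrtd := rfl
  have h11 : jHom g 1 1 = g.1 0 0 := rfl
  fin_cases i <;> fin_cases j <;>
    simp [Matrix.mul_apply, Fin.sum_univ_two, h00, h01, h10, h11]
  · linear_combination -hg
  · ring
  · ring

/-! ### The 2-dimensional retract -/

/-- The distance of the point `(z, ζ)` from the cusp `l/m`, where `l` and `m` are coprime:
`(|mz - l|² + |m|²ζ²)/ζ`. For the cusp `∞ = 1/0` it is the inverse of the height. -/
def cuspDist (l m : ℤ√(-2)) (p : UpperHalfSpace) : ℝ :=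
  (Complex.normSq (toComplex m * p.z - toComplex l) + Complex.normSq (toComplex m) * p.ht ^ 2) /
    p.ht

/-- `l/m` is a cusp in lowest terms that is nearest to `p` among all cusps. -/
def IsNearestCusp (l m : ℤ√(-2)) (p : UpperHalfSpace) : Prop :=
  IsCoprime l m ∧ ∀ l' m' : ℤ√(-2), IsCoprime l' m' → cuspDist l m p ≤ cuspDist l' m' p

lemma cuspDist_smul (g : Bianchi) (l m : ℤ√(-2)) (p : UpperHalfSpace) :
    cuspDist (g 0 0 * l + g 0 1 * m) (g 1 0 * l + g 1 1 * m) (g • p) = cuspDist l m p := by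
  set G := Matrix.SpecialLinearGroup.map (n := Fin 2) toComplex g with hG
  have hsm : g • p = G • p := rfl
  have hE : ∀ i j, G i j = toComplex (g i j) := fun _ _ => rfl
  have hd := UpperHalfSpace.det_eq G
  have hden := (UpperHalfSpace.den_pos G p).ne'
  have hp := p.ht_pos.ne'
  have key := UpperHalfSpace.form_smul G p (G 1 0 * toComplex l + G 1 1 * toComplex m)
    (-(G 0 0 * toComplex l + G 0 1 * toComplex m))
  have e1 : (G 1 0 * toComplex l + G 1 1 * toComplex m) * G 0 0 +
      -(G 0 0 * toComplex l + G 0 1 * toComplex m) * G 1 0 = toComplex m := by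
    linear_combination toComplex m * hd
  have e2 : (G 1 0 * toComplex l + G 1 1 * toComplex m) * G 0 1 +
      -(G 0 0 * toComplex l + G 0 1 * toComplex m) * G 1 1 = -toComplex l := by
    linear_combination -toComplex l * hd
  rw [e1, e2] at key
  simp only [← Complex.normSq_eq_conj_mul_self, ← sub_eq_add_neg] at key
  norm_cast at key
  unfold cuspDist
  rw [hsm]
  simp only [map_add, map_mul, ← hE]
  rw [UpperHalfSpace.smul_ht] at key ⊢
  rw [div_div_eq_mul_div]
  congr 1
  linear_combination key

lemma isNearestCusp_smul (g : Bianchi) {l m : ℤ√(-2)} {p : UpperHalfSpace}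
    (h : IsNearestCusp l m p) :
    IsNearestCusp (g 0 0 * l + g 0 1 * m) (g 1 0 * l + g 1 1 * m) (g • p) := by
  have hd := bianchi_det g
  refine ⟨?_, fun l' m' h' => ?_⟩
  · obtain ⟨u, v, huv⟩ := h.1
    refine ⟨u * g 1 1 - v * g 1 0, v * g 0 0 - u * g 0 1, ?_⟩
    linear_combination (u * l + v * m) * hd + huv
  · have hc : IsCoprime (g 1 1 * l' - g 0 1 * m') (g 0 0 * m' - g 1 0 * l') := by
      obtain ⟨u, v, huv⟩ := h'
      refine ⟨u * g 0 0 + v * g 1 0, u * g 0 1 + v * g 1 1, ?_⟩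
      linear_combination (u * l' + v * m') * hd + huv
    have e := cuspDist_smul g (g 1 1 * l' - g 0 1 * m') (g 0 0 * m' - g 1 0 * l') p
    have e1 : g 0 0 * (g 1 1 * l' - g 0 1 * m') + g 0 1 * (g 0 0 * m' - g 1 0 * l') = l' := by
      linear_combination l' * hd
    have e2 : g 1 0 * (g 1 1 * l' - g 0 1 * m') + g 1 1 * (g 0 0 * m' - g 1 0 * l') = m' := by
      linear_combination m' * hd
    rw [e1, e2] at e
    rw [cuspDist_smul, e]
    exact h.2 _ _ hc

/-- Mendoza's 2-dimensional `SL₂(ℤ[√-2])`-equivariant retract `X` of hyperbolic 3-space: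
the points that have at least two different nearest cusps. -/
def retractX : SubMulAction Bianchi UpperHalfSpace where
  carrier := {p | ∃ l m l' m' : ℤ√(-2),
    IsNearestCusp l m p ∧ IsNearestCusp l' m' p ∧ l * m' ≠ l' * m}
  smul_mem' g p := by
    rintro ⟨l, m, l', m', h, h', hne⟩
    refine ⟨_, _, _, _, isNearestCusp_smul g h, isNearestCusp_smul g h', fun he => hne ?_⟩
    linear_combination he - (l * m' - l' * m) * bianchi_det g

/-- The orbit space `SL₂(ℤ[√-2])\X`. -/
abbrev BianchiOrbitSpace : Type := MulAction.orbitRel.Quotient Bianchi retractX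

/-- The orbit space `Γ₀(√-2)\X`. -/
abbrev Gamma0OrbitSpace : Type := MulAction.orbitRel.Quotient Gamma0 retractX

lemma id_equivariantAlong_iHom :
    EquivariantAlong iHom (ContinuousMap.id retractX) := fun _ _ => rfl

/-- `i^n : Hⁿ(SL₂(ℤ[√-2])\X; 𝔽₂) → Hⁿ(Γ₀(√-2)\X; 𝔽₂)`, induced by the projection
`Γ₀(√-2)\X → SL₂(ℤ[√-2])\X`. -/
def iStar (n : ℕ) : SingularCohomology n BianchiOrbitSpace →ₗ[ZMod 2]
    SingularCohomology n Gamma0OrbitSpace :=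
  SingularCohomology.map n (orbitSpaceMap iHom (ContinuousMap.id retractX)
    id_equivariantAlong_iHom)

end

/-! Up to homotopy `SL₂(R)\X` is a circle, `Γ₀(√-2)\X` is a torus, and the maps given by `i` and `j`
are its two projections, one of them up to sign. The claim is then about the cohomology of the
torus.

Every point of `X` can be moved so that `∞` is a nearest cusp. It then lies on the floor of the
region of `∞`, a graph over `z = x + v√-2` that is the unit hemisphere for `|x|, |v| ≤ 1/2`
(`isTop_iff_floorSq_le`). Identifications between floor points come from the translations by `1` and
`√-2` and from `z ↦ -1/z`, which acts on that rectangle as `x ↦ -x`; any other matrix moves only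
corners, up to these (`respects_of_isTop`, `exists_corner`). So `SL₂(R)\X` is a cylinder `[0, 1/2] ×
ℝ/ℤ`, which contracts onto the circle with coordinate `v`.

For `Γ₀(√-2)` each floor point carries in addition a label, a nonzero column over `R/(√-2) = 𝔽₂`.
Translations preserve the label `(1,0)`, so that sheet becomes a torus. The shift `x ↦ x + 1`
exchanges `(0,1)` and `(1,1)`, which form one annulus bundle of period `2` in `x`. The inversion
glues the half of it with label `(0,1)`, `|x| ≤ 1/2`, onto the torus and folds the other half along
`x ↦ -x`; the folded half is a collar that retracts to its edge on the torus
(`torusToQuot_comp_quotToTorus`).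

On the torus `i` induces `(x, v) ↦ v`. For `j`, the circle coordinate lifts to a real function
`lineHeight` on the half-space, and translation by `u` raises it by the `√-2`-part of `u`. Since `j`
sends translation by `u` to a conjugate of translation by `-u√-2`, it lowers the lift by the real
part of `u`. Hence for every `J` the lift along `J` plus `x` is a doubly periodic real function and
can be contracted, so `j` induces `(x, v) ↦ -x` up to homotopy. This also gives independence of `J`.

So `(iⁿ, jⁿ)` is isomorphic to `pr₂^* + pr₁^*` (`exists_equiv_torusProj`): a map `𝔽₂² → 𝔽₂` onto in
degree 0, an isomorphism in degree 1, and `0 → 𝔽₂` in degree 2. These groups come from the long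
exact sequence of the infinite cyclic covering `ℝ × Z → ℝ/ℤ × Z`. -/

noncomputable section

/-! ### Singular cochains as functions on singular simplices -/

/-- The value of a singular cochain on a singular simplex. -/
def cochainEval {Y : TopCat.{0}} {n : ℕ}
    (φ : (singularCochainFunctor.obj (Opposite.op Y)).X n)
    (s : (TopCat.toSSet.obj Y).obj (Opposite.op (SimplexCategory.mk n))) : ZMod 2 :=
  ((TopCat.toSSet.obj Y).ιChainComplex (R := ModuleCat.of (ZMod 2) (ZMod 2)) s ≫
    (show ((TopCat.toSSet.obj Y).chainComplex (ModuleCat.of (ZMod 2) (ZMod 2))).X n ⟶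
      ModuleCat.of (ZMod 2) (ZMod 2) from φ)).hom (1 : ZMod 2)

lemma SingularCohomology.map_eq_of_homotopic (n : ℕ) {Y Z : Type} [TopologicalSpace Y]
    [TopologicalSpace Z] {f g : C(Y, Z)} (h : f.Homotopic g) :
    SingularCohomology.map n f = SingularCohomology.map n g := by
  obtain ⟨H⟩ := h
  have H1 : TopCat.Homotopy (TopCat.ofHom f) (TopCat.ofHom g) := H
  have h2 := H1.singularChainComplexFunctorObjMap (ModuleCat.of (ZMod 2) (ZMod 2))
  have h3 := (((linearYoneda (ZMod 2) (ModuleCat.{0} (ZMod 2))).obj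
      (ModuleCat.of (ZMod 2) (ZMod 2))).rightOp.mapHomotopy h2).unop
  exact congrArg ModuleCat.Hom.hom (h3.homologyMap_eq n)

lemma SingularCohomology.map_id (n : ℕ) {Y : Type} [TopologicalSpace Y] :
    SingularCohomology.map n (ContinuousMap.id Y) = LinearMap.id :=
  congrArg ModuleCat.Hom.hom ((singularCohomologyFunctor n).map_id (Opposite.op (TopCat.of Y)))

lemma SingularCohomology.map_comp (n : ℕ) {Y Z W : Type} [TopologicalSpace Y]
    [TopologicalSpace Z] [TopologicalSpace W] (f : C(Y, Z)) (g : C(Z, W)) :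
    SingularCohomology.map n (g.comp f) = SingularCohomology.map n f ∘ₗ SingularCohomology.map n g :=
  congrArg ModuleCat.Hom.hom ((singularCohomologyFunctor n).map_comp
    (TopCat.ofHom g).op (TopCat.ofHom f).op)

abbrev Simp (Y : TopCat.{0}) (n : ℕ) : Type :=
  (TopCat.toSSet.obj Y).obj (Opposite.op (SimplexCategory.mk n))

abbrev Cochain (Y : TopCat.{0}) (n : ℕ) : ModuleCat.{0} (ZMod 2) :=
  (singularCochainFunctor.obj (Opposite.op Y)).X n

lemma cochain_ext {Y : TopCat.{0}} {n : ℕ} {φ ψ : Cochain Y n}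
    (h : ∀ s : Simp Y n, cochainEval φ s = cochainEval ψ s) : φ = ψ := by
  refine SSet.chainComplex_hom_ext (X := TopCat.toSSet.obj Y)
    (R := ModuleCat.of (ZMod 2) (ZMod 2)) (T := ModuleCat.of (ZMod 2) (ZMod 2)) fun s => ?_
  apply ModuleCat.hom_ext
  apply LinearMap.ext_ring
  exact h s

/-- The chain group is a coproduct of copies of `𝔽₂` indexed by the simplices. With `cochain_ext`, a
cochain is the same as an arbitrary function on simplices. -/
lemma exists_cochain {Y : TopCat.{0}} {n : ℕ} (u : Simp Y n → ZMod 2) :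
    ∃ φ : Cochain Y n, ∀ s, cochainEval φ s = u s := by
  refine ⟨(show ((TopCat.toSSet.obj Y).chainComplex (ModuleCat.of (ZMod 2) (ZMod 2))).X n ⟶
      ModuleCat.of (ZMod 2) (ZMod 2) from Limits.Cofan.IsColimit.desc
        ((TopCat.toSSet.obj Y).isColimitChainComplexXCofan _ n)
          fun s => ModuleCat.ofHom (LinearMap.toSpanSingleton _ _ (u s))), fun s => ?_⟩
  have := Limits.Cofan.IsColimit.fac  ((TopCat.toSSet.obj Y).isColimitChainComplexXCofan (ModuleCat.of (ZMod 2) (ZMod 2)) n)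
          (fun s => ModuleCat.ofHom (Y := ModuleCat.of (ZMod 2) (ZMod 2)) (LinearMap.toSpanSingleton _ _ (u s))) s
  have h2 := congrArg (fun f => f.hom (1 : ZMod 2)) this
  refine h2.trans ?_
  simp

lemma cochainEval_map {Y Z : TopCat.{0}} {n : ℕ} (f : Y ⟶ Z) (φ : Cochain Z n) (s : Simp Y n) :
    cochainEval ((((singularCochainFunctor.map f.op).f n).hom φ : Cochain Y n)) s =
      cochainEval φ ((TopCat.toSSet.map f).app _ s) := by
  have := SSet.ι_chainComplexMap_f _ _ (TopCat.toSSet.map f) (ModuleCat.of (ZMod 2) (ZMod 2)) s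
  have h2 := congrArg (fun g => (g ≫ (show ((TopCat.toSSet.obj Z).chainComplex (ModuleCat.of (ZMod 2) (ZMod 2))).X n ⟶
      ModuleCat.of (ZMod 2) (ZMod 2) from φ)).hom (1 : ZMod 2)) this
  exact h2

lemma cochainEval_add {Y : TopCat.{0}} {n : ℕ} (φ ψ : Cochain Y n) (s : Simp Y n) :
    cochainEval (φ + ψ) s = cochainEval φ s + cochainEval ψ s := by
  rfl

lemma cochainEval_smul {Y : TopCat.{0}} {n : ℕ} (a : ZMod 2) (φ : Cochain Y n) (s : Simp Y n) :
    cochainEval (a • φ) s = a * cochainEval φ s := by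
  rfl

lemma cochainEval_d {Y : TopCat.{0}} {n : ℕ} (φ : Cochain Y n) (s : Simp Y (n + 1)) :
    cochainEval ((((singularCochainFunctor.obj (Opposite.op Y)).d n (n + 1)).hom φ :
      Cochain Y (n + 1))) s =
      ∑ i : Fin (n + 2), cochainEval φ ((TopCat.toSSet.obj Y).δ i s) := by
  have := SSet.ιChainComplex_d (R := ModuleCat.of (ZMod 2) (ZMod 2)) (TopCat.toSSet.obj Y) s
  have h2 := congrArg (fun g => (g ≫ (show ((TopCat.toSSet.obj Y).chainComplex (ModuleCat.of (ZMod 2) (ZMod 2))).X n ⟶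
      ModuleCat.of (ZMod 2) (ZMod 2) from φ)).hom (1 : ZMod 2)) this
  refine h2.trans ?_
  rw [Preadditive.sum_comp]
  rw [ModuleCat.hom_sum, LinearMap.sum_apply]
  refine Finset.sum_congr rfl fun i _ => ?_
  rw [Preadditive.zsmul_comp]
  -- The signs of the boundary disappear modulo 2.
  have h3 : ∀ x : ZMod 2, ((-1 : ℤ) ^ i.val) • x = x := by
    intro x
    rcases neg_one_pow_eq_or ℤ i.val with h | h <;> rw [h] <;> simp
  exact h3 _

/-- The singular simplex given by a continuous map. -/
def Simp.mk {Y : TopCat.{0}} {n : ℕ} (f : C(stdSimplex ℝ (Fin (n + 1)), Y)) : Simp Y n :=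
  (TopCat.toSSetObjEquiv Y (Opposite.op (SimplexCategory.mk n))).symm f

/-- The continuous map underlying a singular simplex. -/
def Simp.toMap {Y : TopCat.{0}} {n : ℕ} (s : Simp Y n) : C(stdSimplex ℝ (Fin (n + 1)), Y) :=
  TopCat.toSSetObjEquiv Y (Opposite.op (SimplexCategory.mk n)) s

lemma Simp.mk_toMap {Y : TopCat.{0}} {n : ℕ} (s : Simp Y n) : Simp.mk s.toMap = s :=
  Equiv.symm_apply_apply _ _

lemma Simp.toMap_mk {Y : TopCat.{0}} {n : ℕ} (f : C(stdSimplex ℝ (Fin (n + 1)), Y)) :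
    (Simp.mk f).toMap = f :=
  Equiv.apply_symm_apply _ _

lemma Simp.map_mk {Y Z : TopCat.{0}} {n : ℕ} (g : Y ⟶ Z) (f : C(stdSimplex ℝ (Fin (n + 1)), Y)) :
    (TopCat.toSSet.map g).app _ (Simp.mk f) = Simp.mk (g.hom.comp f) := rfl

/-! ### The exact sequence of the infinite cyclic covering of `ℝ/ℤ × Z` -/

/-- The circle `ℝ/ℤ`. -/
abbrev RModZ : Type := AddCircle (1 : ℝ)

/-- The covering `ℝ × Z → ℝ/ℤ × Z`. -/
def circleCover (Z : Type) [TopologicalSpace Z] : C(ℝ × Z, RModZ × Z) where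
  toFun p := ((p.1 : RModZ), p.2)
  continuous_toFun := ((AddCircle.continuous_mk' 1).comp continuous_fst).prodMk continuous_snd

/-- The generator of the group of deck transformations of `ℝ × Z → ℝ/ℤ × Z`. -/
def deckShift (Z : Type) [TopologicalSpace Z] : C(ℝ × Z, ℝ × Z) where
  toFun p := (p.1 + 1, p.2)
  continuous_toFun := by fun_prop

lemma circleCover_comp_deckShift (Z : Type) [TopologicalSpace Z] :
    (circleCover Z).comp (deckShift Z) = circleCover Z := by
  ext p
  · exact AddCircle.coe_add_period 1 p.1
  · rfl

/-- The short complex of cochain complexes attached to `ℝ × Z → ℝ/ℤ × Z`. -/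
def coverShortComplex (Z : Type) [TopologicalSpace Z] :
    ShortComplex (HomologicalComplex (ModuleCat.{0} (ZMod 2)) (ComplexShape.down ℕ).symm) where
  X₁ := singularCochainFunctor.obj (Opposite.op (TopCat.of (RModZ × Z)))
  X₂ := singularCochainFunctor.obj (Opposite.op (TopCat.of (ℝ × Z)))
  X₃ := singularCochainFunctor.obj (Opposite.op (TopCat.of (ℝ × Z)))
  f := singularCochainFunctor.map (TopCat.ofHom (circleCover Z)).op
  g := singularCochainFunctor.map (TopCat.ofHom (deckShift Z)).op - 𝟙 _
  zero := by
    rw [Preadditive.comp_sub, Category.comp_id, ← Functor.map_comp, ← op_comp,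
      ← TopCat.ofHom_comp, circleCover_comp_deckShift, sub_self]

instance simplyConnectedSpace_stdSimplex (n : ℕ) :
    SimplyConnectedSpace (stdSimplex ℝ (Fin (n + 1))) := by
  have : ContractibleSpace (stdSimplex ℝ (Fin (n + 1))) :=
    (convex_stdSimplex ℝ (Fin (n + 1))).contractibleSpace (Set.nonempty_coe_sort.1 inferInstance)
  infer_instance

instance locallyPathConnectedSpace_stdSimplex (n : ℕ) :
    LocallyPathConnectedSpace (stdSimplex ℝ (Fin (n + 1))) :=
  (convex_stdSimplex ℝ (Fin (n + 1))).locallyPathConnectedSpace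

/-- A continuous map from a simply connected space to the circle lifts to the line. -/
lemma exists_lift_to_line {A : Type} [TopologicalSpace A] [SimplyConnectedSpace A]
    [LocallyPathConnectedSpace A] (f : C(A, RModZ)) :
    ∃ F : C(A, ℝ), ∀ a, ((F a : ℝ) : RModZ) = f a := by
  obtain ⟨a₀⟩ : Nonempty A := inferInstance
  obtain ⟨e₀, he⟩ := QuotientAddGroup.mk_surjective (f a₀)
  obtain ⟨F, hF, -⟩ := (AddCircle.isCoveringMap_coe (1 : ℝ)).existsUnique_continuousMap_lifts
    f a₀ e₀ he
  exact ⟨F, fun a => congrFun hF.2 a⟩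

/-- Two lifts of a map to the circle differ by an integer. -/
lemma exists_int_of_lifts {A : Type} [TopologicalSpace A] [PreconnectedSpace A] [Nonempty A]
    (F G : C(A, ℝ)) (h : ∀ a, ((F a : ℝ) : RModZ) = G a) : ∃ k : ℤ, ∀ a, F a = G a + k := by
  have h1 : ∀ a, ∃ k : ℤ, F a - G a = k := fun a => by
    have := (QuotientAddGroup.eq_iff_sub_mem).1 (h a)
    obtain ⟨k, hk⟩ := AddSubgroup.mem_zmultiples_iff.1 this
    exact ⟨k, by simpa using hk.symm⟩
  choose k hk using h1
  have hc : Continuous k := by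
    have : Continuous fun a => ((k a : ℤ) : ℝ) := by
      simp only [← hk]
      fun_prop
    exact Int.isClosedEmbedding_coe_real.isEmbedding.continuous_iff.2 this
  obtain ⟨a₀⟩ : Nonempty A := inferInstance
  refine ⟨k a₀, fun a => ?_⟩
  rw [PreconnectedSpace.constant inferInstance hc (x := a₀) (y := a), ← hk a]
  ring

/-- The function `N` shows that `t` generates a free action of `ℤ` and picks the point with `N = 0`
on each orbit. Starting there, the difference equation is solved by partial sums. This gives
surjectivity of `t^* - 1` on cochains. -/
lemma exists_sub_eq_of_shift {A : Type} (t : A ≃ A) (N : A → ℤ) (hN : ∀ a, N (t a) = N a + 1)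
    (u : A → ZMod 2) : ∃ v : A → ZMod 2, ∀ a, v (t a) - v a = u a := by
  -- `w a k` is the sum of `u` over the first `k` shifts of `a`
  have key : ∀ a : A, ∃ w : ℤ → ZMod 2, ∀ k, w (k + 1) - w k = u ((t ^ k) a) := by
    intro a
    -- For negative `k` the partial sum should carry a minus sign, which is dropped because `-1 = 1`
    -- in `𝔽₂`.
    refine ⟨fun k => if 0 ≤ k then ∑ i ∈ Finset.range k.toNat, u ((t ^ (i : ℤ)) a)
      else ∑ i ∈ Finset.range (-k).toNat, u ((t ^ (-(i : ℤ) - 1)) a), fun k => ?_⟩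
    rcases lt_trichotomy k (-1) with h | h | h
    · obtain ⟨m, rfl⟩ : ∃ m : ℕ, k = -(m : ℤ) - 2 := ⟨(-k - 2).toNat, by omega⟩
      beta_reduce
      rw [if_neg (by omega), if_neg (by omega)]
      rw [show (-(-(m : ℤ) - 2)).toNat = (m + 1) + 1 by omega,
        show (-(-(m : ℤ) - 2 + 1)).toNat = m + 1 by omega, Finset.sum_range_succ _ (m + 1)]
      rw [show (-((m + 1 : ℕ) : ℤ) - 1) = -(m : ℤ) - 2 by push_cast; ring]
      generalize u _ = y
      rw [sub_add_cancel_left, ZMod.neg_eq_self_mod_two]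
    · subst h
      simp
    · obtain ⟨m, rfl⟩ : ∃ m : ℕ, k = m := ⟨k.toNat, by omega⟩
      beta_reduce
      rw [if_pos (by omega), if_pos (by omega), show ((m : ℤ) + 1).toNat = m + 1 by omega,
        Int.toNat_natCast, Finset.sum_range_succ]
      ring
  choose w hw using key
  -- The point `t ^ (-N a) a` is the same for `a` and `t a`, so `N a` only counts steps from a fixed
  -- origin of the orbit.
  refine ⟨fun a => w ((t ^ (-N a)) a) (N a), fun a => ?_⟩
  have e1 : (t ^ (-N (t a))) (t a) = (t ^ (-N a)) a := by
    rw [hN]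
    change ((t ^ (-(N a + 1))) * t) a = _
    rw [← zpow_add_one]
    congr 2
    ring
  beta_reduce
  rw [e1, hN, hw]
  congr 1
  rw [← Equiv.Perm.mul_apply, ← zpow_add]
  simp

/-- The inverse of `deckShift`. -/
def deckUnshift (Z : Type) [TopologicalSpace Z] : C(ℝ × Z, ℝ × Z) where
  toFun p := (p.1 - 1, p.2)
  continuous_toFun := by fun_prop

/-- The action of the deck shift on singular simplices. -/
def simpShift (Z : Type) [TopologicalSpace Z] (n : ℕ) :
    Simp (TopCat.of (ℝ × Z)) n ≃ Simp (TopCat.of (ℝ × Z)) n where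
  toFun s := Simp.mk ((deckShift Z).comp s.toMap)
  invFun s := Simp.mk ((deckUnshift Z).comp s.toMap)
  left_inv s := by
    conv_rhs => rw [← s.mk_toMap]
    beta_reduce
    rw [Simp.toMap_mk]
    congr 1
    ext p
    · exact add_sub_cancel_right _ _
    · rfl
  right_inv s := by
    conv_rhs => rw [← s.mk_toMap]
    beta_reduce
    rw [Simp.toMap_mk]
    congr 1
    ext p
    · exact sub_add_cancel _ _
    · rfl

lemma simpShift_eq (Z : Type) [TopologicalSpace Z] (n : ℕ) (s : Simp (TopCat.of (ℝ × Z)) n) :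
    (TopCat.toSSet.map (TopCat.ofHom (deckShift Z))).app _ s = simpShift Z n s := by
  conv_lhs => rw [← s.mk_toMap]
  rfl

lemma simpShift_zpow (Z : Type) [TopologicalSpace Z] (n : ℕ) (k : ℤ)
    (s : Simp (TopCat.of (ℝ × Z)) n) (x : stdSimplex ℝ (Fin (n + 1))) :
    Simp.toMap ((simpShift Z n ^ k) s) x = ((s.toMap x).1 + k, (s.toMap x).2) := by
  induction k with
  | zero => simp
  | succ k ih =>
    rw [add_comm (k : ℤ), zpow_add, Equiv.Perm.mul_apply, zpow_one]
    change deckShift Z (Simp.toMap ((simpShift Z n ^ (k : ℤ)) s) x) = _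
    rw [ih]
    simp [deckShift]
    ring
  | pred k ih =>
    rw [sub_eq_neg_add, zpow_add, Equiv.Perm.mul_apply, zpow_neg_one]
    change deckUnshift Z (Simp.toMap ((simpShift Z n ^ (-(k : ℤ))) s) x) = _
    rw [ih]
    simp [deckUnshift]
    ring

lemma exists_simp_lift {Z : Type} [TopologicalSpace Z] {n : ℕ}
    (s : Simp (TopCat.of (RModZ × Z)) n) :
    ∃ s' : Simp (TopCat.of (ℝ × Z)) n,
      (TopCat.toSSet.map (TopCat.ofHom (circleCover Z))).app _ s' = s := by
  obtain ⟨F, hF⟩ := exists_lift_to_line (ContinuousMap.fst.comp s.toMap)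
  refine ⟨Simp.mk (F.prodMk (ContinuousMap.snd.comp s.toMap)), ?_⟩
  conv_rhs => rw [← s.mk_toMap]
  rw [Simp.map_mk]
  congr 1
  ext x
  · exact hF x
  · rfl

lemma exists_zpow_of_simp_lifts {Z : Type} [TopologicalSpace Z] {n : ℕ}
    (s s' : Simp (TopCat.of (ℝ × Z)) n)
    (h : (TopCat.toSSet.map (TopCat.ofHom (circleCover Z))).app _ s =
      (TopCat.toSSet.map (TopCat.ofHom (circleCover Z))).app _ s') :
    ∃ k : ℤ, s = (simpShift Z n ^ k) s' := by
  rw [← s.mk_toMap, ← s'.mk_toMap, Simp.map_mk, Simp.map_mk] at h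
  have h1 := congrArg Simp.toMap h
  rw [Simp.toMap_mk, Simp.toMap_mk] at h1
  have h2 : ∀ x, circleCover Z (s.toMap x) = circleCover Z (s'.toMap x) := fun x =>
    DFunLike.congr_fun h1 x
  obtain ⟨k, hk⟩ := exists_int_of_lifts (ContinuousMap.fst.comp s.toMap)
    (ContinuousMap.fst.comp s'.toMap) fun x => congrArg Prod.fst (h2 x)
  refine ⟨k, ?_⟩
  rw [← s.mk_toMap, ← ((simpShift Z n ^ k) s').mk_toMap]
  congr 1
  ext x
  · rw [simpShift_zpow]
    exact hk x
  · rw [simpShift_zpow]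
    exact (Prod.ext_iff.1 (h2 x)).2

/-- A simplex of `ℝ/ℤ × Z` lifts to `ℝ × Z`, uniquely up to deck shifts. So pullback of cochains is
injective and its image consists of the shift-invariant cochains. The integer part of the line
coordinate at a fixed point of the simplex is the counter needed in `exists_sub_eq_of_shift`. -/
lemma coverShortComplex_shortExact (Z : Type) [TopologicalSpace Z] :
    (coverShortComplex Z).ShortExact := by
  refine HomologicalComplex.shortExact_of_degreewise_shortExact _ fun n => ?_
  have hg : ∀ (φ : Cochain (TopCat.of (ℝ × Z)) n) (s : Simp (TopCat.of (ℝ × Z)) n),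
      cochainEval ((((coverShortComplex Z).g.f n).hom φ : Cochain (TopCat.of (ℝ × Z)) n)) s =
        cochainEval φ (simpShift Z n s) - cochainEval φ s := by
    intro φ s
    rw [← simpShift_eq, ← cochainEval_map]
    rfl
  have hf : ∀ (φ : Cochain (TopCat.of (RModZ × Z)) n) (s : Simp (TopCat.of (ℝ × Z)) n),
      cochainEval ((((coverShortComplex Z).f.f n).hom φ : Cochain (TopCat.of (ℝ × Z)) n)) s =
        cochainEval φ ((TopCat.toSSet.map (TopCat.ofHom (circleCover Z))).app _ s) :=
    fun φ s => cochainEval_map _ _ _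
  refine ShortComplex.ShortExact.mk' ?_ ?_ ?_
  · rw [ShortComplex.moduleCat_exact_iff]
    intro (φ : Cochain (TopCat.of (ℝ × Z)) n) hφ
    replace hφ : ((coverShortComplex Z).g.f n).hom φ = 0 := hφ
    have h1 : ∀ s, cochainEval φ (simpShift Z n s) = cochainEval φ s := fun s =>
      sub_eq_zero.1 ((hg φ s).symm.trans (congrArg (fun ψ : Cochain _ n => cochainEval ψ s) hφ))
    have h2 : ∀ (k : ℤ) s, cochainEval φ ((simpShift Z n ^ k) s) = cochainEval φ s := by
      intro k
      induction k with
      | zero => simp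
      | succ k ih =>
        intro s
        rw [zpow_add_one, Equiv.Perm.mul_apply, ih, h1]
      | pred k ih =>
        intro s
        rw [zpow_sub_one, Equiv.Perm.mul_apply, ih, ← h1]
        simp
    choose lift hlift using fun s : Simp (TopCat.of (RModZ × Z)) n => exists_simp_lift s
    obtain ⟨ψ, hψ⟩ := exists_cochain fun s => cochainEval φ (lift s)
    refine ⟨ψ, cochain_ext fun s => ?_⟩
    refine (hf ψ s).trans ?_
    rw [hψ]
    obtain ⟨k, hk⟩ := exists_zpow_of_simp_lifts _ s (hlift _)
    rw [hk, h2]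
  · rw [ModuleCat.mono_iff_injective]
    intro φ ψ h
    refine cochain_ext fun s => ?_
    obtain ⟨s', rfl⟩ := exists_simp_lift s
    exact (hf φ s').symm.trans
      ((congrArg (fun ψ : Cochain _ n => cochainEval ψ s') h).trans (hf ψ s'))
  · rw [ModuleCat.epi_iff_surjective]
    intro (φ : Cochain (TopCat.of (ℝ × Z)) n)
    obtain ⟨x₀⟩ : Nonempty (stdSimplex ℝ (Fin (n + 1))) := inferInstance
    obtain ⟨v, hv⟩ := exists_sub_eq_of_shift (simpShift Z n) (fun s => ⌊(s.toMap x₀).1⌋)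
      (fun s => by
        have := simpShift_zpow Z n 1 s x₀
        rw [zpow_one] at this
        rw [this]
        simp) (cochainEval φ)
    obtain ⟨ψ, hψ⟩ := exists_cochain v
    refine ⟨ψ, cochain_ext fun s => ?_⟩
    refine (hg ψ s).trans ?_
    rw [hψ, hψ, hv]

lemma rel_succ (n : ℕ) : (ComplexShape.down ℕ).symm.Rel n (n + 1) := rfl

/-- The connecting homomorphism of `ℝ × Z → ℝ/ℤ × Z`. -/
def coverDelta (Z : Type) [TopologicalSpace Z] (n : ℕ) :
    SingularCohomology n (ℝ × Z) →ₗ[ZMod 2] SingularCohomology (n + 1) (RModZ × Z) :=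
  ((coverShortComplex_shortExact Z).δ n (n + 1) (rel_succ n)).hom

/-- The deck shift is homotopic to the identity by sliding along the line. The long exact sequence
therefore breaks into short ones from `Hⁿ(ℝ × Z)` through `Hⁿ⁺¹(ℝ/ℤ × Z)` to `Hⁿ⁺¹(ℝ × Z)`. -/
lemma homologyMap_coverShortComplex_g (Z : Type) [TopologicalSpace Z] (n : ℕ) :
    HomologicalComplex.homologyMap (coverShortComplex Z).g n = 0 := by
  have h : (deckShift Z).Homotopic (ContinuousMap.id (ℝ × Z)) := by
    refine ⟨⟨⟨fun p => (p.2.1 + (1 - (p.1 : ℝ)), p.2.2), by fun_prop⟩, fun p => ?_, fun p => ?_⟩⟩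
    · simp [deckShift]
    · simp
  have h1 := SingularCohomology.map_eq_of_homotopic n h
  have h2 : HomologicalComplex.homologyMap
      (singularCochainFunctor.map (TopCat.ofHom (deckShift Z)).op) n =
      HomologicalComplex.homologyMap (𝟙 (coverShortComplex Z).X₃) n := by
    refine ModuleCat.hom_ext (h1.trans ?_)
    rw [SingularCohomology.map_id, HomologicalComplex.homologyMap_id]
    rfl
  exact (HomologicalComplex.homologyMap_sub _ _ n).trans (sub_eq_zero.2 h2)

lemma coverDelta_injective (Z : Type) [TopologicalSpace Z] (n : ℕ) :
    Function.Injective (coverDelta Z n) := by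
  rw [injective_iff_map_eq_zero]
  intro x hx
  have h := (coverShortComplex_shortExact Z).homology_exact₃ n (n + 1) (rel_succ n)
  rw [ShortComplex.moduleCat_exact_iff] at h
  obtain ⟨y, rfl⟩ := h x hx
  change (HomologicalComplex.homologyMap (coverShortComplex Z).g n).hom y = 0
  rw [homologyMap_coverShortComplex_g]
  rfl

lemma exists_coverDelta_eq (Z : Type) [TopologicalSpace Z] (n : ℕ)
    (x : SingularCohomology (n + 1) (RModZ × Z))
    (hx : SingularCohomology.map (n + 1) (circleCover Z) x = 0) : ∃ y, coverDelta Z n y = x := by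
  have h := (coverShortComplex_shortExact Z).homology_exact₁ n (n + 1) (rel_succ n)
  rw [ShortComplex.moduleCat_exact_iff] at h
  exact h x hx

lemma coverDelta_naturality {Z W : Type} [TopologicalSpace Z] [TopologicalSpace W] (f : C(Z, W))
    (n : ℕ) (y : SingularCohomology n (ℝ × W)) :
    SingularCohomology.map (n + 1) ((ContinuousMap.id RModZ).prodMap f) (coverDelta W n y) =
      coverDelta Z n (SingularCohomology.map n ((ContinuousMap.id ℝ).prodMap f) y) := by
  let φ : coverShortComplex W ⟶ coverShortComplex Z :=
    { τ₁ := singularCochainFunctor.map (TopCat.ofHom ((ContinuousMap.id RModZ).prodMap f)).op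
      τ₂ := singularCochainFunctor.map (TopCat.ofHom ((ContinuousMap.id ℝ).prodMap f)).op
      τ₃ := singularCochainFunctor.map (TopCat.ofHom ((ContinuousMap.id ℝ).prodMap f)).op
      comm₁₂ := by
        dsimp only [coverShortComplex]
        rw [← Functor.map_comp, ← Functor.map_comp]
        rfl
      comm₂₃ := by
        dsimp only [coverShortComplex]
        rw [Preadditive.comp_sub, Preadditive.sub_comp, ← Functor.map_comp, ← Functor.map_comp,
          Category.comp_id, Category.id_comp]
        rfl }
  exact congrArg (fun f => f.hom y) (HomologicalComplex.HomologySequence.δ_naturality φ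
    (coverShortComplex_shortExact W) (coverShortComplex_shortExact Z) n (n + 1) (rel_succ n))

/-- In degree 0 there are no coboundaries, so injectivity on cochains passes to cohomology. -/
lemma map_circleCover_zero_injective (Z : Type) [TopologicalSpace Z] :
    Function.Injective (SingularCohomology.map 0 (circleCover Z)) := by
  have := (coverShortComplex_shortExact Z).mono_f
  have h0 : ∀ K : HomologicalComplex (ModuleCat.{0} (ZMod 2)) (ComplexShape.down ℕ).symm,
      IsIso (K.homologyπ 0) := fun K => K.isIso_homologyπ _ 0 rfl (K.shape _ _ (by
        intro h
        exact absurd (show _ + 1 = 0 from h) (by omega)))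
  have h1 := h0 (coverShortComplex Z).X₁
  have h2 := h0 (coverShortComplex Z).X₂
  have h3 := HomologicalComplex.homologyπ_naturality (coverShortComplex Z).f 0
  have h4 : Mono ((coverShortComplex Z).X₁.homologyπ 0 ≫
    HomologicalComplex.homologyMap (coverShortComplex Z).f 0) := by
    rw [h3]
    infer_instance
  have h5 : Mono (HomologicalComplex.homologyMap (coverShortComplex Z).f 0) := by
    rw [← IsIso.inv_hom_id_assoc ((coverShortComplex Z).X₁.homologyπ 0)
      (HomologicalComplex.homologyMap (coverShortComplex Z).f 0)]
    infer_instance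
  exact (ModuleCat.mono_iff_injective _).1 h5

/-! ### Cohomology of the point, the circle and the torus -/

instance subsingleton_simp_unit (n : ℕ) : Subsingleton (Simp (TopCat.of Unit) n) :=
  ⟨fun s s' => by
    rw [← s.mk_toMap, ← s'.mk_toMap]
    congr 1⟩

/-- A point has one simplex in each degree, so the `n + 2` faces contribute equally, and `n + 2 = n`
modulo 2. -/
lemma cochainEval_d_unit {n : ℕ} (φ : Cochain (TopCat.of Unit) n) (s : Simp (TopCat.of Unit) (n + 1))
    (s' : Simp (TopCat.of Unit) n) :
    cochainEval ((((singularCochainFunctor.obj (Opposite.op (TopCat.of Unit))).d n (n + 1)).hom φ :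
      Cochain (TopCat.of Unit) (n + 1))) s = (n : ZMod 2) * cochainEval φ s' := by
  rw [cochainEval_d]
  have : ∀ i : Fin (n + 2), cochainEval φ ((TopCat.toSSet.obj (TopCat.of Unit)).δ i s) =
      cochainEval φ s' := fun i => congrArg _ (Subsingleton.elim _ _)
  simp only [this, Finset.sum_const, Finset.card_univ, Fintype.card_fin, nsmul_eq_mul]
  push_cast
  rw [show (2 : ZMod 2) = 0 from rfl, add_zero]

/-- The simplex of a point. -/
def unitSimp (n : ℕ) : Simp (TopCat.of Unit) n := Simp.mk (ContinuousMap.const _ ())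

instance subsingleton_cohomology_unit (n : ℕ) : Subsingleton (SingularCohomology (n + 1) Unit) := by
  set K := singularCochainFunctor.obj (Opposite.op (TopCat.of Unit)) with hK
  have : K.ExactAt (n + 1) := by
    rw [K.exactAt_iff' n (n + 1) (n + 2) (ComplexShape.prev_eq' _ (rel_succ n))
      (ComplexShape.next_eq' _ (rel_succ (n + 1)))]
    rw [ShortComplex.moduleCat_exact_iff]
    intro (φ : Cochain (TopCat.of Unit) (n + 1)) hφ
    replace hφ : (K.d (n + 1) (n + 2)).hom φ = 0 := hφ
    have h1 := cochainEval_d_unit φ (unitSimp (n + 2)) (unitSimp (n + 1))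
    have h2 : (0 : ZMod 2) = ((n + 1 : ℕ) : ZMod 2) * cochainEval φ (unitSimp (n + 1)) :=
      (congrArg (fun ψ : Cochain (TopCat.of Unit) (n + 2) => cochainEval ψ (unitSimp (n + 2)))
        hφ).symm.trans h1
    -- The differentials out of degrees `n` and `n + 1` are multiplication by `n` and `n + 1`: for
    -- even `n` the outgoing one is injective, for odd `n` the incoming one is onto.
    rcases Nat.even_or_odd n with h | h
    · refine ⟨0, ?_⟩
      rw [map_zero]
      symm
      refine cochain_ext fun s => ?_
      have h3 : ((n + 1 : ℕ) : ZMod 2) = 1 := ZMod.natCast_eq_one_iff_odd.2 h.add_one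
      rw [h3, one_mul] at h2
      rw [Subsingleton.elim s (unitSimp (n + 1)), ← h2]
      rfl
    · obtain ⟨ψ, hψ⟩ := exists_cochain fun _ : Simp (TopCat.of Unit) n =>
        cochainEval φ (unitSimp (n + 1))
      refine ⟨ψ, cochain_ext fun s => ?_⟩
      refine (cochainEval_d_unit ψ s (unitSimp n)).trans ?_
      rw [ZMod.natCast_eq_one_iff_odd.2 h, one_mul, hψ, Subsingleton.elim s]
  exact ModuleCat.subsingleton_of_isZero this.isZero_homology

lemma nonempty_cohomology_zero_unit :
    Nonempty (SingularCohomology 0 Unit ≃ₗ[ZMod 2] ZMod 2) := by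
  set K := singularCochainFunctor.obj (Opposite.op (TopCat.of Unit)) with hK
  have hd : K.d 0 1 = 0 := by
    ext (φ : Cochain (TopCat.of Unit) 0)
    refine cochain_ext fun s => ?_
    refine (cochainEval_d_unit φ s (unitSimp 0)).trans ?_
    rw [Nat.cast_zero, zero_mul]
    rfl
  have h1 : IsIso (K.homologyπ 0) := K.isIso_homologyπ _ 0 rfl (K.shape _ _ (by
    intro h
    exact absurd (show _ + 1 = 0 from h) (by omega)))
  have h2 : IsIso (K.iCycles 0) := K.isIso_iCycles 0 1 (ComplexShape.next_eq' _ (rel_succ 0)) hd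
  let e : K.homology 0 ≅ K.X 0 := (asIso (K.homologyπ 0)).symm ≪≫ asIso (K.iCycles 0)
  let ev : Cochain (TopCat.of Unit) 0 →ₗ[ZMod 2] ZMod 2 :=
    { toFun := fun φ => cochainEval φ (unitSimp 0)
      map_add' := fun φ ψ => cochainEval_add φ ψ _
      map_smul' := fun a φ => cochainEval_smul a φ _ }
  have hev : Function.Bijective ev := by
    refine ⟨fun φ ψ h => cochain_ext fun s => ?_, fun a => ?_⟩
    · rw [Subsingleton.elim s (unitSimp 0)]
      exact h
    · obtain ⟨φ, hφ⟩ := exists_cochain fun _ : Simp (TopCat.of Unit) 0 => a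
      exact ⟨φ, hφ _⟩
  exact ⟨e.toLinearEquiv.trans (LinearEquiv.ofBijective ev hev)⟩

lemma SingularCohomology.map_comp_apply (n : ℕ) {Y Z W : Type} [TopologicalSpace Y]
    [TopologicalSpace Z] [TopologicalSpace W] (f : C(Y, Z)) (g : C(Z, W))
    (x : SingularCohomology n W) :
    SingularCohomology.map n f (SingularCohomology.map n g x) =
      SingularCohomology.map n (g.comp f) x := by
  rw [SingularCohomology.map_comp]
  rfl

lemma SingularCohomology.map_bijective_of_homotopic (n : ℕ) {Y Z : Type} [TopologicalSpace Y]
    [TopologicalSpace Z] (f : C(Y, Z)) (g : C(Z, Y)) (hgf : (g.comp f).Homotopic (.id Y))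
    (hfg : (f.comp g).Homotopic (.id Z)) : Function.Bijective (SingularCohomology.map n f) := by
  have h1 : ∀ y, SingularCohomology.map n f (SingularCohomology.map n g y) = y := fun y => by
    rw [map_comp_apply, map_eq_of_homotopic n hgf, map_id, LinearMap.id_apply]
  have h2 : ∀ z, SingularCohomology.map n g (SingularCohomology.map n f z) = z := fun z => by
    rw [map_comp_apply, map_eq_of_homotopic n hfg, map_id, LinearMap.id_apply]
  exact ⟨Function.LeftInverse.injective h2, Function.RightInverse.surjective h1⟩

/-- The inclusion of a fibre of a product. -/
def constLeft {Y : Type} (Z : Type) [TopologicalSpace Y] [TopologicalSpace Z] (y : Y) :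
    C(Z, Y × Z) := (ContinuousMap.const Z y).prodMk (.id Z)

lemma map_snd_injective (n : ℕ) {Y Z : Type} [TopologicalSpace Y] [TopologicalSpace Z]
    [Nonempty Y] : Function.Injective (SingularCohomology.map n (ContinuousMap.snd : C(Y × Z, Z))) := by
  obtain ⟨y⟩ := ‹Nonempty Y›
  refine Function.LeftInverse.injective (g := SingularCohomology.map n (constLeft Z y)) fun x => ?_
  rw [SingularCohomology.map_comp_apply]
  change SingularCohomology.map n (ContinuousMap.id Z) x = x
  rw [SingularCohomology.map_id, LinearMap.id_apply]

lemma map_fst_injective (n : ℕ) {Y Z : Type} [TopologicalSpace Y] [TopologicalSpace Z]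
    [Nonempty Z] : Function.Injective (SingularCohomology.map n (ContinuousMap.fst : C(Y × Z, Y))) := by
  obtain ⟨z⟩ := ‹Nonempty Z›
  refine Function.LeftInverse.injective
    (g := SingularCohomology.map n ((ContinuousMap.id Y).prodMk (.const Y z))) fun x => ?_
  rw [SingularCohomology.map_comp_apply]
  change SingularCohomology.map n (ContinuousMap.id Y) x = x
  rw [SingularCohomology.map_id, LinearMap.id_apply]

lemma map_snd_line_bijective (n : ℕ) (Z : Type) [TopologicalSpace Z] :
    Function.Bijective (SingularCohomology.map n (ContinuousMap.snd : C(ℝ × Z, Z))) := by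
  refine SingularCohomology.map_bijective_of_homotopic n _ (constLeft Z 0) ?_
    (ContinuousMap.Homotopic.refl _)
  refine ⟨⟨⟨fun p => ((p.1 : ℝ) * p.2.1, p.2.2), by fun_prop⟩, fun p => ?_, fun p => ?_⟩⟩
  · simp [constLeft]
  · simp

lemma snd_comp_circleCover (Z : Type) [TopologicalSpace Z] :
    (ContinuousMap.snd : C(RModZ × Z, Z)).comp (circleCover Z) = ContinuousMap.snd := rfl

/-- Pullback to `ℝ × Z` is injective in degree 0, and there every class already comes from `Z`. -/
lemma map_snd_circle_zero_bijective (Z : Type) [TopologicalSpace Z] :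
    Function.Bijective (SingularCohomology.map 0 (ContinuousMap.snd : C(RModZ × Z, Z))) := by
  refine ⟨map_snd_injective 0, fun x => ?_⟩
  obtain ⟨y, hy⟩ := (map_snd_line_bijective 0 Z).2 (SingularCohomology.map 0 (circleCover Z) x)
  refine ⟨y, map_circleCover_zero_injective Z ?_⟩
  rw [SingularCohomology.map_comp_apply, snd_comp_circleCover, hy]

/-- Adding a point as a second factor. -/
def prodUnitMap (Y : Type) [TopologicalSpace Y] : C(Y, Y × Unit) :=
  (ContinuousMap.id Y).prodMk (.const Y ())

lemma map_prodUnitMap_bijective (n : ℕ) (Y : Type) [TopologicalSpace Y] :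
    Function.Bijective (SingularCohomology.map n (prodUnitMap Y)) :=
  SingularCohomology.map_bijective_of_homotopic n _ ContinuousMap.fst
    (ContinuousMap.Homotopic.refl _) (ContinuousMap.Homotopic.refl _)

lemma subsingleton_cohomology_line_prod (n : ℕ) (Z : Type) [TopologicalSpace Z]
    [Subsingleton (SingularCohomology n Z)] : Subsingleton (SingularCohomology n (ℝ × Z)) :=
  (map_snd_line_bijective n Z).2.subsingleton

lemma subsingleton_cohomology_circle_prod (n : ℕ) (Z : Type) [TopologicalSpace Z]
    [Subsingleton (SingularCohomology n Z)] [Subsingleton (SingularCohomology (n + 1) Z)] :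
    Subsingleton (SingularCohomology (n + 1) (RModZ × Z)) := by
  have h0 := subsingleton_cohomology_line_prod n Z
  have h1 := subsingleton_cohomology_line_prod (n + 1) Z
  refine subsingleton_of_forall_eq 0 fun x => ?_
  obtain ⟨y, rfl⟩ := exists_coverDelta_eq Z n x (Subsingleton.elim _ _)
  rw [Subsingleton.elim y 0, map_zero]

instance subsingleton_cohomology_circle (n : ℕ) :
    Subsingleton (SingularCohomology (n + 2) RModZ) :=
  have := subsingleton_cohomology_circle_prod (n + 1) Unit
  (map_prodUnitMap_bijective (n + 2) RModZ).2.subsingleton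

instance subsingleton_cohomology_torus (n : ℕ) :
    Subsingleton (SingularCohomology (n + 3) (RModZ × RModZ)) :=
  subsingleton_cohomology_circle_prod (n + 2) RModZ

lemma coverDelta_bijective (n : ℕ) (Z : Type) [TopologicalSpace Z]
    [Subsingleton (SingularCohomology (n + 1) Z)] : Function.Bijective (coverDelta Z n) := by
  have := subsingleton_cohomology_line_prod (n + 1) Z
  exact ⟨coverDelta_injective Z n, fun x => exists_coverDelta_eq Z n x (Subsingleton.elim _ _)⟩

lemma nonempty_cohomology_zero_circle :
    Nonempty (SingularCohomology 0 RModZ ≃ₗ[ZMod 2] ZMod 2) := by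
  obtain ⟨e⟩ := nonempty_cohomology_zero_unit
  exact ⟨(LinearEquiv.ofBijective _ (map_prodUnitMap_bijective 0 RModZ)).symm ≪≫ₗ
    (LinearEquiv.ofBijective _ (map_snd_circle_zero_bijective Unit)).symm ≪≫ₗ e⟩

lemma nonempty_cohomology_one_circle :
    Nonempty (SingularCohomology 1 RModZ ≃ₗ[ZMod 2] ZMod 2) := by
  obtain ⟨e⟩ := nonempty_cohomology_zero_unit
  exact ⟨(LinearEquiv.ofBijective _ (map_prodUnitMap_bijective 1 RModZ)).symm ≪≫ₗ
    (LinearEquiv.ofBijective _ (coverDelta_bijective 0 Unit)).symm ≪≫ₗ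
    (LinearEquiv.ofBijective _ (map_snd_line_bijective 0 Unit)).symm ≪≫ₗ e⟩

lemma nonempty_cohomology_two_torus :
    Nonempty (SingularCohomology 2 (RModZ × RModZ) ≃ₗ[ZMod 2] ZMod 2) := by
  obtain ⟨e⟩ := nonempty_cohomology_one_circle
  exact ⟨(LinearEquiv.ofBijective _ (coverDelta_bijective 1 RModZ)).symm ≪≫ₗ
    (LinearEquiv.ofBijective _ (map_snd_line_bijective 1 RModZ)).symm ≪≫ₗ e⟩

/-- The projections of the torus onto its factors, on cohomology: `(x, y) ↦ pr₂^* x + pr₁^* y`. -/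
def torusProj (n : ℕ) : SingularCohomology n RModZ × SingularCohomology n RModZ →ₗ[ZMod 2]
    SingularCohomology n (RModZ × RModZ) :=
  (SingularCohomology.map n ContinuousMap.snd).coprod (SingularCohomology.map n ContinuousMap.fst)

lemma torusProj_apply (n : ℕ) (x y : SingularCohomology n RModZ) :
    torusProj n (x, y) = SingularCohomology.map n ContinuousMap.snd x +
      SingularCohomology.map n ContinuousMap.fst y := rfl

/-- Pulled back to `ℝ × Z`, the projection to the circle factors through the line, which has no
cohomology in positive degrees. -/
lemma map_circleCover_map_fst (n : ℕ) (Z : Type) [TopologicalSpace Z]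
    (x : SingularCohomology (n + 1) RModZ) :
    SingularCohomology.map (n + 1) (circleCover Z)
      (SingularCohomology.map (n + 1) ContinuousMap.fst x) = 0 := by
  let c : C(ℝ, RModZ) := ⟨fun t => (t : RModZ), AddCircle.continuous_mk' 1⟩
  have h := (map_prodUnitMap_bijective (n + 1) ℝ).2
  have hs := subsingleton_cohomology_line_prod (n + 1) Unit
  have hs' : Subsingleton (SingularCohomology (n + 1) ℝ) := h.subsingleton
  rw [SingularCohomology.map_comp_apply]
  change SingularCohomology.map (n + 1) (c.comp ContinuousMap.fst) x = 0
  rw [← SingularCohomology.map_comp_apply, Subsingleton.elim (SingularCohomology.map _ c x) 0,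
    map_zero]

lemma torusProj_one_injective : Function.Injective (torusProj 1) := by
  rw [injective_iff_map_eq_zero]
  rintro ⟨x, y⟩ h
  rw [torusProj_apply] at h
  have h1 := congrArg (SingularCohomology.map 1 (circleCover RModZ)) h
  rw [map_add, map_circleCover_map_fst 0, add_zero, SingularCohomology.map_comp_apply,
    snd_comp_circleCover, map_zero] at h1
  have hx : x = 0 := (map_snd_line_bijective 1 RModZ).1 (by rw [h1, map_zero])
  rw [hx, map_zero, zero_add] at h
  have hy : y = 0 := map_fst_injective 1 (by rw [h, map_zero])
  rw [hx, hy]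
  rfl

/-- Subtract the part of `z` seen on the cover, which is a pullback along the second projection. The
rest is a connecting image of a degree 0 class. Such a class is constant along the fibre circle, so
by naturality the rest is pulled back from the first factor. -/
lemma torusProj_one_surjective : Function.Surjective (torusProj 1) := by
  intro z
  obtain ⟨x, hx⟩ := (map_snd_line_bijective 1 RModZ).2
    (SingularCohomology.map 1 (circleCover RModZ) z)
  obtain ⟨w, hw⟩ := exists_coverDelta_eq RModZ 0 (z - SingularCohomology.map 1 ContinuousMap.snd x)
    (by rw [map_sub, SingularCohomology.map_comp_apply, snd_comp_circleCover, hx, sub_self])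
  let u : C(RModZ, Unit) := ContinuousMap.const _ ()
  -- All degree 0 classes of `ℝ × ℝ/ℤ` come from `ℝ × Unit`, because both spaces have the degree 0
  -- cohomology of a point.
  have hu : ∃ w' : SingularCohomology 0 (ℝ × Unit),
      SingularCohomology.map 0 ((ContinuousMap.id ℝ).prodMap u) w' = w := by
    obtain ⟨a, rfl⟩ := (map_snd_line_bijective 0 RModZ).2 w
    obtain ⟨b, rfl⟩ := (map_prodUnitMap_bijective 0 RModZ).2 a
    obtain ⟨c, rfl⟩ := (map_snd_circle_zero_bijective Unit).2 b
    refine ⟨SingularCohomology.map 0 ContinuousMap.snd c, ?_⟩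
    simp only [SingularCohomology.map_comp_apply]
    rfl
  obtain ⟨w', rfl⟩ := hu
  rw [← coverDelta_naturality] at hw
  refine ⟨(x, SingularCohomology.map 1 (prodUnitMap RModZ) (coverDelta Unit 0 w')), ?_⟩
  rw [torusProj_apply, SingularCohomology.map_comp_apply]
  exact add_eq_of_eq_sub' hw

lemma map_fst_torus_zero_bijective :
    Function.Bijective (SingularCohomology.map 0 (ContinuousMap.fst : C(RModZ × RModZ, RModZ))) := by
  have h : Function.Bijective (SingularCohomology.map 0
      (ContinuousMap.prodSwap : C(RModZ × RModZ, RModZ × RModZ))) :=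
    SingularCohomology.map_bijective_of_homotopic 0 _ ContinuousMap.prodSwap
      (ContinuousMap.Homotopic.refl _) (ContinuousMap.Homotopic.refl _)
  have := h.comp (map_snd_circle_zero_bijective RModZ)
  rwa [← LinearMap.coe_comp, ← SingularCohomology.map_comp] at this

lemma torusProj_injective (n : ℕ) (hn : n ≠ 0) : Function.Injective (torusProj n) := by
  match n, hn with
  | 1, _ => exact torusProj_one_injective
  | n + 2, _ => exact Function.injective_of_subsingleton _

lemma torusProj_surjective (n : ℕ) (hn : n ≠ 2) : Function.Surjective (torusProj n) := by
  match n, hn with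
  | 0, _ =>
    intro z
    obtain ⟨y, rfl⟩ := map_fst_torus_zero_bijective.2 z
    exact ⟨(0, y), by rw [torusProj_apply, map_zero, zero_add]⟩
  | 1, _ => exact torusProj_one_surjective
  | n + 3, _ => exact Function.surjective_to_subsingleton _

lemma nonempty_ker_torusProj_zero :
    Nonempty (LinearMap.ker (torusProj 0) ≃ₗ[ZMod 2] ZMod 2) := by
  obtain ⟨e⟩ := nonempty_cohomology_zero_circle
  let f : LinearMap.ker (torusProj 0) →ₗ[ZMod 2] SingularCohomology 0 RModZ :=
    LinearMap.fst _ _ _ ∘ₗ (LinearMap.ker (torusProj 0)).subtype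
  have hf : Function.Bijective f := by
    constructor
    · rw [injective_iff_map_eq_zero]
      rintro ⟨⟨x, y⟩, h⟩ (hx : x = 0)
      subst hx
      rw [LinearMap.mem_ker, torusProj_apply, map_zero, zero_add] at h
      have hy : y = 0 := map_fst_torus_zero_bijective.1 (by rw [h, map_zero])
      subst hy
      rfl
    · intro x
      obtain ⟨y, hy⟩ := map_fst_torus_zero_bijective.2 (-SingularCohomology.map 0 ContinuousMap.snd x)
      exact ⟨⟨(x, y), by rw [LinearMap.mem_ker, torusProj_apply, hy, add_neg_cancel]⟩, rfl⟩
  exact ⟨LinearEquiv.ofBijective f hf ≪≫ₗ e⟩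

/-- The circle has no second cohomology, so the map is zero and the cokernel is all of `H²` of the
torus. -/
lemma nonempty_coker_torusProj_two :
    Nonempty ((SingularCohomology 2 (RModZ × RModZ) ⧸ LinearMap.range (torusProj 2)) ≃ₗ[ZMod 2]
      ZMod 2) := by
  obtain ⟨e⟩ := nonempty_cohomology_two_torus
  have h : LinearMap.range (torusProj 2) = ⊥ := by
    rw [LinearMap.range_eq_bot]
    refine LinearMap.ext fun x => ?_
    rw [Subsingleton.elim x 0, map_zero, map_zero]
  exact ⟨Submodule.quotEquivOfEqBot _ h ≪≫ₗ e⟩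

/-! ### Coordinates on the upper half-space -/

namespace UpperHalfSpace

/-- The first coordinate of `z = x + v√-2`. -/
def px (p : UpperHalfSpace) : ℝ := p.z.re

/-- The second coordinate of `z = x + v√-2`. -/
def pv (p : UpperHalfSpace) : ℝ := p.z.im / Real.sqrt 2

lemma im_eq (p : UpperHalfSpace) : p.z.im = Real.sqrt 2 * p.pv := by
  unfold pv
  field_simp

lemma ext_coord {p q : UpperHalfSpace} (hx : p.px = q.px) (hv : p.pv = q.pv) (ht : p.ht = q.ht) :
    p = q :=
  ext' (Complex.ext hx (by rw [im_eq, im_eq, hv])) ht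

/-- The point with coordinates `(x, v)` and height `t`. -/
def mkPt (x v t : ℝ) (ht : 0 < t) : UpperHalfSpace := ⟨(⟨x, Real.sqrt 2 * v⟩, t), ht⟩

@[simp] lemma px_mkPt (x v t : ℝ) (ht : 0 < t) : (mkPt x v t ht).px = x := rfl

@[simp] lemma pv_mkPt (x v t : ℝ) (ht : 0 < t) : (mkPt x v t ht).pv = v :=
  mul_div_cancel_left₀ v (by positivity : Real.sqrt 2 ≠ 0)

lemma continuous_z : Continuous z := continuous_fst.comp continuous_subtype_val

lemma continuous_ht : Continuous ht := continuous_snd.comp continuous_subtype_val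

lemma continuous_px : Continuous px := Complex.continuous_re.comp continuous_z

lemma continuous_pv : Continuous pv := (Complex.continuous_im.comp continuous_z).div_const _

lemma continuous_num (g : Matrix.SpecialLinearGroup (Fin 2) ℂ) : Continuous (num g) := by
  unfold num
  have := continuous_z
  have := continuous_ht
  fun_prop

lemma continuous_den (g : Matrix.SpecialLinearGroup (Fin 2) ℂ) : Continuous (den g) := by
  unfold den
  have := continuous_z
  have := continuous_ht
  have := Complex.continuous_normSq
  fun_prop

lemma continuous_smul_complex (g : Matrix.SpecialLinearGroup (Fin 2) ℂ) :
    Continuous fun p : UpperHalfSpace => g • p := by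
  have h1 := continuous_num g
  have h2 := continuous_den g
  have h3 := continuous_ht
  refine Continuous.subtype_mk (Continuous.prodMk ?_ ?_) _
  · exact h1.div (Complex.continuous_ofReal.comp h2)
      fun p => Complex.ofReal_ne_zero.2 (den_pos g p).ne'
  · exact h3.div h2 fun p => (den_pos g p).ne'

instance : ContinuousConstSMul Bianchi UpperHalfSpace :=
  ⟨fun _ => continuous_smul_complex _⟩

lemma toComplex_re (c : ℤ√(-2)) : (toComplex c).re = c.re := by
  simp [toComplex, Zsqrtd.lift]

lemma toComplex_im (c : ℤ√(-2)) : (toComplex c).im = Real.sqrt 2 * c.im := by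
  simp [toComplex, Zsqrtd.lift, mul_comm]

/-- The norm `a² + 2b²` of `a + b√-2`. -/
def nrm (c : ℤ√(-2)) : ℤ := c.re ^ 2 + 2 * c.im ^ 2

lemma normSq_toComplex (c : ℤ√(-2)) : Complex.normSq (toComplex c) = nrm c := by
  have h : Real.sqrt 2 * Real.sqrt 2 = 2 := Real.mul_self_sqrt (by norm_num)
  rw [Complex.normSq_apply, toComplex_re, toComplex_im, nrm]
  push_cast
  linear_combination (c.im : ℝ) ^ 2 * h

/-- `|cz + d|² + |c|²ζ²`. -/
def quad (c d : ℤ√(-2)) (p : UpperHalfSpace) : ℝ :=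
  Complex.normSq (toComplex c * p.z + toComplex d) + p.ht ^ 2 * Complex.normSq (toComplex c)

lemma quad_eq (c d : ℤ√(-2)) (p : UpperHalfSpace) :
    quad c d p = (c.re * p.px - 2 * c.im * p.pv + d.re) ^ 2 +
      2 * (c.re * p.pv + c.im * p.px + d.im) ^ 2 + nrm c * p.ht ^ 2 := by
  have h : Real.sqrt 2 * Real.sqrt 2 = 2 := Real.mul_self_sqrt (by norm_num)
  have hr : p.z.re = p.px := rfl
  rw [quad, normSq_toComplex, Complex.normSq_apply]
  simp only [Complex.add_re, Complex.mul_re, Complex.add_im, Complex.mul_im, toComplex_re,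
    toComplex_im, im_eq, hr]
  have e : (c.re : ℝ) * p.px - Real.sqrt 2 * c.im * (Real.sqrt 2 * p.pv) + d.re =
      c.re * p.px - 2 * c.im * p.pv + d.re := by linear_combination (-c.im * p.pv : ℝ) * h
  rw [e]
  linear_combination (c.re * p.pv + c.im * p.px + d.im : ℝ) ^ 2 * h

lemma continuous_quad (c d : ℤ√(-2)) : Continuous (quad c d) := by
  simp only [funext (quad_eq c d)]
  have := continuous_px
  have := continuous_pv
  have := continuous_ht
  fun_prop

lemma quad_zero_one (p : UpperHalfSpace) : quad 0 1 p = 1 := by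
  simp [quad]

lemma quad_neg (c d : ℤ√(-2)) (p : UpperHalfSpace) : quad (-c) (-d) p = quad c d p := by
  rw [quad_eq, quad_eq]
  simp only [nrm, Zsqrtd.re_neg, Zsqrtd.im_neg]
  push_cast
  ring

lemma cuspDist_eq (l m : ℤ√(-2)) (p : UpperHalfSpace) :
    cuspDist l m p = quad m (-l) p / p.ht := by
  rw [cuspDist, quad, map_neg, ← sub_eq_add_neg, mul_comm (p.ht ^ 2)]

lemma quad_smul (g : Bianchi) (c d : ℤ√(-2)) (p : UpperHalfSpace) :
    quad c d (g • p) * quad (g 1 0) (g 1 1) p =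
      quad (c * g 0 0 + d * g 1 0) (c * g 0 1 + d * g 1 1) p := by
  have := form_smul (Matrix.SpecialLinearGroup.map (n := Fin 2) toComplex g) p
    (toComplex c) (toComplex d)
  simp only [← Complex.normSq_eq_conj_mul_self] at this
  norm_cast at this
  rw [mul_comm]
  simp only [quad, map_add, map_mul]
  exact this

lemma ht_smul (g : Bianchi) (p : UpperHalfSpace) :
    (g • p).ht = p.ht / quad (g 1 0) (g 1 1) p := rfl

lemma quad_row_pos (g : Bianchi) (p : UpperHalfSpace) : 0 < quad (g 1 0) (g 1 1) p :=
  den_pos (Matrix.SpecialLinearGroup.map (n := Fin 2) toComplex g) p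

end UpperHalfSpace

namespace UpperHalfSpace

/-! ### Nearest cusps -/

/-- The cusp `-d/c` is nearest to `p`. -/
def Near (c d : ℤ√(-2)) (p : UpperHalfSpace) : Prop :=
  ∀ a b : ℤ√(-2), IsCoprime a b → quad c d p ≤ quad a b p

/-- The cusp `∞` is nearest to `p`. -/
abbrev IsTop (p : UpperHalfSpace) : Prop := Near 0 1 p

lemma isCoprime_row (g : Bianchi) : IsCoprime (g 1 0) (g 1 1) :=
  ⟨-g 0 1, g 0 0, by linear_combination bianchi_det g⟩

lemma isTop_iff (p : UpperHalfSpace) :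
    IsTop p ↔ ∀ c d : ℤ√(-2), IsCoprime c d → 1 ≤ quad c d p := by
  simp only [IsTop, Near, quad_zero_one]

lemma isTop_smul_iff (g : Bianchi) (p : UpperHalfSpace) :
    IsTop (g • p) ↔ Near (g 1 0) (g 1 1) p := by
  have hd := bianchi_det g
  have hpos := quad_row_pos g p
  rw [isTop_iff]
  constructor
  · rintro h c d ⟨u, v, huv⟩
    have h1 := h (c * g 1 1 - d * g 1 0) (d * g 0 0 - c * g 0 1)
      ⟨u * g 0 0 + v * g 0 1, u * g 1 0 + v * g 1 1, by
        linear_combination (u * c + v * d) * hd + huv⟩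
    have h2 := quad_smul g (c * g 1 1 - d * g 1 0) (d * g 0 0 - c * g 0 1) p
    rw [show (c * g 1 1 - d * g 1 0) * g 0 0 + (d * g 0 0 - c * g 0 1) * g 1 0 = c by
      linear_combination c * hd, show (c * g 1 1 - d * g 1 0) * g 0 1 +
      (d * g 0 0 - c * g 0 1) * g 1 1 = d by linear_combination d * hd] at h2
    rw [← h2]
    nlinarith
  · rintro h c d ⟨u, v, huv⟩
    have h1 := h (c * g 0 0 + d * g 1 0) (c * g 0 1 + d * g 1 1)
      ⟨u * g 1 1 - v * g 0 1, v * g 0 0 - u * g 1 0, by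
        linear_combination (u * c + v * d) * hd + huv⟩
    rw [← quad_smul] at h1
    exact (le_mul_iff_one_le_left hpos).1 h1

lemma isClosed_near (c d : ℤ√(-2)) : IsClosed {p | Near c d p} := by
  have : {p | Near c d p} = ⋂ (c') (d') (_ : IsCoprime c' d'), {p | quad c d p ≤ quad c' d' p} := by
    ext p
    simp [Near]
  rw [this]
  exact isClosed_iInter fun c' => isClosed_iInter fun d' => isClosed_iInter fun _ =>
    isClosed_le (continuous_quad c d) (continuous_quad c' d')

lemma finite_nrm_le (M : ℝ) : {c : ℤ√(-2) | (nrm c : ℝ) ≤ M}.Finite := by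
  have hf : ((Set.Icc (-⌈M⌉) ⌈M⌉) ×ˢ (Set.Icc (-⌈M⌉) ⌈M⌉)).Finite :=
    (Set.finite_Icc _ _).prod (Set.finite_Icc _ _)
  refine Set.Finite.of_injOn (f := fun c : ℤ√(-2) => (c.re, c.im)) (fun c hc => ?_)
    (fun c _ d _ h => ?_) hf
  · have h1 : nrm c ≤ ⌈M⌉ := by
      have := (show (nrm c : ℝ) ≤ M from hc).trans (Int.le_ceil M)
      exact_mod_cast this
    unfold nrm at h1
    refine ⟨⟨?_, ?_⟩, ⟨?_, ?_⟩⟩ <;> nlinarith [Int.le_self_sq c.re, Int.le_self_sq c.im,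
      Int.le_self_sq (-c.re), Int.le_self_sq (-c.im)]
  · simp only [Prod.mk.injEq] at h
    exact Zsqrtd.ext h.1 h.2

/-- The height bounds `c`; then `|d|² ≤ 2|cz + d|² + 2|cz|²` bounds `d`. Near any point only
finitely many cusps can compete with `∞`. -/
lemma quad_le_one_bounds {c d : ℤ√(-2)} {p : UpperHalfSpace} (h : quad c d p ≤ 1) {ε B : ℝ}
    (hε : 0 < ε) (hp : ε ≤ p.ht) (hB : Complex.normSq p.z ≤ B) :
    (nrm c : ℝ) ≤ 1 / ε ^ 2 ∧ (nrm d : ℝ) ≤ 2 + 2 * (1 / ε ^ 2) * B := by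
  rw [quad, normSq_toComplex] at h
  have h0 := Complex.normSq_nonneg (toComplex c * p.z + toComplex d)
  have hc0 : (0 : ℝ) ≤ nrm c := by rw [← normSq_toComplex]; exact Complex.normSq_nonneg _
  have h1 : (nrm c : ℝ) ≤ 1 / ε ^ 2 := by
    rw [le_div_iff₀ (by positivity)]
    have : ε ^ 2 ≤ p.ht ^ 2 := by gcongr
    nlinarith
  refine ⟨h1, ?_⟩
  have h2 : Complex.normSq (toComplex c * p.z + toComplex d) ≤ 1 := by
    have : 0 ≤ p.ht ^ 2 * (nrm c : ℝ) := by positivity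
    linarith
  have h3 : Complex.normSq (toComplex c * p.z) ≤ 1 / ε ^ 2 * B := by
    rw [map_mul, normSq_toComplex]
    have := Complex.normSq_nonneg p.z
    gcongr
  rw [← normSq_toComplex d]
  rw [Complex.normSq_apply] at *
  generalize toComplex c * p.z = w at *
  simp only [Complex.add_re, Complex.add_im] at *
  nlinarith [sq_nonneg ((toComplex d).re + 2 * w.re), sq_nonneg ((toComplex d).im + 2 * w.im)]

lemma finite_quad_le_one {ε B : ℝ} (hε : 0 < ε) :
    {r : ℤ√(-2) × ℤ√(-2) | ∃ p : UpperHalfSpace, ε ≤ p.ht ∧ Complex.normSq p.z ≤ B ∧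
      quad r.1 r.2 p ≤ 1}.Finite := by
  refine ((finite_nrm_le (1 / ε ^ 2)).prod (finite_nrm_le (2 + 2 * (1 / ε ^ 2) * B))).subset ?_
  rintro ⟨c, d⟩ ⟨p, h1, h2, h3⟩
  exact quad_le_one_bounds h3 hε h1 h2

lemma exists_near (p : UpperHalfSpace) : ∃ c d, IsCoprime c d ∧ Near c d p := by
  have hfin : {r : ℤ√(-2) × ℤ√(-2) | IsCoprime r.1 r.2 ∧ quad r.1 r.2 p ≤ 1}.Finite :=
    (finite_quad_le_one (ε := p.ht) (B := Complex.normSq p.z) p.ht_pos).subset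
      fun r hr => ⟨p, le_rfl, le_rfl, hr.2⟩
  obtain ⟨⟨c, d⟩, ⟨h1, h2⟩, h3⟩ := hfin.exists_minimalFor (fun r => quad r.1 r.2 p) _
    ⟨(0, 1), isCoprime_zero_left.2 isUnit_one, (quad_zero_one p).le⟩
  refine ⟨c, d, h1, fun c' d' h' => ?_⟩
  by_cases h : quad c' d' p ≤ 1
  · rcases le_total (quad c d p) (quad c' d' p) with h4 | h4
    · exact h4
    · exact h3 (j := (c', d')) ⟨h', h⟩ h4
  · exact h2.trans (not_le.1 h).le

/-- A nearest cusp has `quad` at most the value `1` of `∞`, so the finiteness bound applies on a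
neighbourhood where the height stays above half its value and `|z|²` stays bounded. -/
lemma locallyFinite_near :
    LocallyFinite fun r : ℤ√(-2) × ℤ√(-2) => {p | Near r.1 r.2 p} := by
  intro p
  refine ⟨{q | p.ht / 2 < q.ht ∧ Complex.normSq q.z < Complex.normSq p.z + 1}, ?_, ?_⟩
  · refine IsOpen.mem_nhds ?_ ⟨half_lt_self p.ht_pos, lt_add_one _⟩
    exact (isOpen_lt continuous_const continuous_ht).inter
      (isOpen_lt (Complex.continuous_normSq.comp continuous_z) continuous_const)
  · refine (finite_quad_le_one (ε := p.ht / 2) (B := Complex.normSq p.z + 1)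
      (half_pos p.ht_pos)).subset ?_
    rintro ⟨c, d⟩ ⟨q, h1, h2, h3⟩
    refine ⟨q, h2.le, h3.le, ?_⟩
    exact (h1 0 1 (isCoprime_zero_left.2 isUnit_one)).trans (quad_zero_one q).le

/-- A matrix with the given bottom row. -/
lemma exists_row {c d : ℤ√(-2)} (h : IsCoprime c d) : ∃ g : Bianchi, g 1 0 = c ∧ g 1 1 = d := by
  obtain ⟨u, v, huv⟩ := h
  refine ⟨⟨!![v, -u; c, d], ?_⟩, rfl, rfl⟩
  rw [Matrix.det_fin_two_of]
  linear_combination huv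

lemma exists_isTop_smul (p : UpperHalfSpace) : ∃ g : Bianchi, IsTop (g • p) := by
  obtain ⟨c, d, h, hn⟩ := exists_near p
  obtain ⟨g, rfl, rfl⟩ := exists_row h
  exact ⟨g, (isTop_smul_iff g p).2 hn⟩

/-- Maps on the upper half-space may be glued from maps on the regions of points with a given
nearest cusp. -/
theorem exists_glue {Y : Type} [TopologicalSpace Y] (ψ : Bianchi → UpperHalfSpace → Y)
    (hc : ∀ g, Continuous (ψ g))
    (h : ∀ (g k : Bianchi) (p : UpperHalfSpace), IsTop p → IsTop (k • p) →
      ψ (k * g) (k • p) = ψ g p) :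
    ∃ Φ : C(UpperHalfSpace, Y), ∀ (g : Bianchi) (p : UpperHalfSpace), IsTop (g • p) →
      Φ p = ψ g (g • p) := by
  choose rep hrep using exists_isTop_smul
  have key : ∀ (g : Bianchi) (p : UpperHalfSpace), IsTop (g • p) →
      ψ (rep p) (rep p • p) = ψ g (g • p) := by
    intro g p hg
    have h1 := h g (rep p * g⁻¹) (g • p) hg (by
      rw [mul_smul, inv_smul_smul]
      exact hrep p)
    rwa [mul_smul, inv_smul_smul, inv_mul_cancel_right] at h1
  refine ⟨⟨fun p => ψ (rep p) (rep p • p), ?_⟩, key⟩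
  -- Continuity is tested on the locally finite closed cover by the regions of the single cusps; on
  -- each of them one fixed `g` may replace the chosen `rep p`.
  have hlf := locallyFinite_near.comp_injective
    (Subtype.val_injective (p := fun r : ℤ√(-2) × ℤ√(-2) => IsCoprime r.1 r.2))
  refine hlf.continuous ?_ (fun r => isClosed_near _ _) (fun r => ?_)
  · refine Set.eq_univ_of_forall fun p => ?_
    obtain ⟨c, d, h1, h2⟩ := exists_near p
    exact Set.mem_iUnion.2 ⟨⟨(c, d), h1⟩, h2⟩
  · obtain ⟨g, h1, h2⟩ := exists_row r.2
    refine ContinuousOn.congr (f := fun p => ψ g (g • p))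
      ((hc g).comp (continuous_const_smul g)).continuousOn fun p hp => ?_
    refine key g p ((isTop_smul_iff g p).2 ?_)
    rw [h1, h2]
    exact hp

end UpperHalfSpace

namespace UpperHalfSpace

/-! ### The action in coordinates -/

lemma num_coord (g : Bianchi) (p : UpperHalfSpace) :
    num (Matrix.SpecialLinearGroup.map (n := Fin 2) toComplex g) p =
    ⟨((g 1 0).re * p.px - 2 * (g 1 0).im * p.pv + (g 1 1).re) *
        ((g 0 0).re * p.px - 2 * (g 0 0).im * p.pv + (g 0 1).re) +
      2 * ((g 1 0).re * p.pv + (g 1 0).im * p.px + (g 1 1).im) *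
        ((g 0 0).re * p.pv + (g 0 0).im * p.px + (g 0 1).im) +
      p.ht ^ 2 * ((g 1 0).re * (g 0 0).re + 2 * (g 1 0).im * (g 0 0).im),
    Real.sqrt 2 * (((g 1 0).re * p.px - 2 * (g 1 0).im * p.pv + (g 1 1).re) *
        ((g 0 0).re * p.pv + (g 0 0).im * p.px + (g 0 1).im) -
      ((g 1 0).re * p.pv + (g 1 0).im * p.px + (g 1 1).im) *
        ((g 0 0).re * p.px - 2 * (g 0 0).im * p.pv + (g 0 1).re) +
      p.ht ^ 2 * ((g 1 0).re * (g 0 0).im - (g 1 0).im * (g 0 0).re))⟩ := by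
  have h : Real.sqrt 2 * Real.sqrt 2 = 2 := Real.mul_self_sqrt (by norm_num)
  have hE : ∀ i j, (Matrix.SpecialLinearGroup.map (n := Fin 2) toComplex g) i j =
    toComplex (g i j) := fun _ _ => rfl
  have hr : p.z.re = p.px := rfl
  have e : ∀ c d : ℤ√(-2), toComplex c * p.z + toComplex d =
      ⟨c.re * p.px - 2 * c.im * p.pv + d.re,
        Real.sqrt 2 * (c.re * p.pv + c.im * p.px + d.im)⟩ := by
    intro c d
    apply Complex.ext
    · simp only [Complex.add_re, Complex.mul_re, toComplex_re, toComplex_im, im_eq, hr]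
      linear_combination (-c.im * p.pv : ℝ) * h
    · simp only [Complex.add_im, Complex.mul_im, toComplex_re, toComplex_im, im_eq, hr]
      ring
  have ez : ∀ c : ℤ√(-2), toComplex c = ⟨c.re, Real.sqrt 2 * c.im⟩ := fun c =>
    Complex.ext (toComplex_re c) (toComplex_im c)
  rw [num, hE, hE, hE, hE, e, e, ez, ez, ← Complex.ofReal_pow]
  apply Complex.ext
  · simp only [Complex.add_re, Complex.mul_re, Complex.mul_im, Complex.conj_re, Complex.conj_im,
      Complex.ofReal_re, Complex.ofReal_im]
    linear_combination (((g 1 0).re * p.pv + (g 1 0).im * p.px + (g 1 1).im) *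
        ((g 0 0).re * p.pv + (g 0 0).im * p.px + (g 0 1).im) +
        p.ht ^ 2 * (g 1 0).im * (g 0 0).im) * h
  · simp only [Complex.add_im, Complex.mul_re, Complex.mul_im, Complex.conj_re, Complex.conj_im,
      Complex.ofReal_re, Complex.ofReal_im]
    ring

lemma px_smul (g : Bianchi) (p : UpperHalfSpace) :
    (g • p).px = (((g 1 0).re * p.px - 2 * (g 1 0).im * p.pv + (g 1 1).re) *
        ((g 0 0).re * p.px - 2 * (g 0 0).im * p.pv + (g 0 1).re) +
      2 * ((g 1 0).re * p.pv + (g 1 0).im * p.px + (g 1 1).im) *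
        ((g 0 0).re * p.pv + (g 0 0).im * p.px + (g 0 1).im) +
      p.ht ^ 2 * ((g 1 0).re * (g 0 0).re + 2 * (g 1 0).im * (g 0 0).im)) /
        quad (g 1 0) (g 1 1) p := by
  change (num (Matrix.SpecialLinearGroup.map (n := Fin 2) toComplex g) p /
    ((quad (g 1 0) (g 1 1) p : ℝ) : ℂ)).re = _
  rw [Complex.div_ofReal_re, num_coord]

lemma pv_smul (g : Bianchi) (p : UpperHalfSpace) :
    (g • p).pv = (((g 1 0).re * p.px - 2 * (g 1 0).im * p.pv + (g 1 1).re) *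
        ((g 0 0).re * p.pv + (g 0 0).im * p.px + (g 0 1).im) -
      ((g 1 0).re * p.pv + (g 1 0).im * p.px + (g 1 1).im) *
        ((g 0 0).re * p.px - 2 * (g 0 0).im * p.pv + (g 0 1).re) +
      p.ht ^ 2 * ((g 1 0).re * (g 0 0).im - (g 1 0).im * (g 0 0).re)) /
        quad (g 1 0) (g 1 1) p := by
  change (num (Matrix.SpecialLinearGroup.map (n := Fin 2) toComplex g) p /
    ((quad (g 1 0) (g 1 1) p : ℝ) : ℂ)).im / Real.sqrt 2 = _
  rw [Complex.div_ofReal_im, num_coord]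
  field_simp

/-- The translation `z ↦ z + u`. -/
def trans (u : ℤ√(-2)) : Bianchi := ⟨!![1, u; 0, 1], by simp [Matrix.det_fin_two_of]⟩

/-- The inversion `z ↦ -1/z`. -/
def matS : Bianchi := ⟨!![0, -1; 1, 0], by simp [Matrix.det_fin_two_of]⟩

/-- The rotation about the geodesic `{x + √-2/2 : |z - √-2/2|² + ζ² = 1/2}`. -/
def matG : Bianchi := ⟨!![1, -Zsqrtd.sqrtd; -Zsqrtd.sqrtd, -1], by
  rw [Matrix.det_fin_two_of]
  ext <;> simp⟩

@[simp] lemma trans_00 (u : ℤ√(-2)) : trans u 0 0 = 1 := rfl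
@[simp] lemma trans_01 (u : ℤ√(-2)) : trans u 0 1 = u := rfl
@[simp] lemma trans_10 (u : ℤ√(-2)) : trans u 1 0 = 0 := rfl
@[simp] lemma trans_11 (u : ℤ√(-2)) : trans u 1 1 = 1 := rfl
@[simp] lemma matS_00 : matS 0 0 = 0 := rfl
@[simp] lemma matS_01 : matS 0 1 = -1 := rfl
@[simp] lemma matS_10 : matS 1 0 = 1 := rfl
@[simp] lemma matS_11 : matS 1 1 = 0 := rfl
@[simp] lemma matG_00 : matG 0 0 = 1 := rfl
@[simp] lemma matG_01 : matG 0 1 = -Zsqrtd.sqrtd := rfl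
@[simp] lemma matG_10 : matG 1 0 = -Zsqrtd.sqrtd := rfl
@[simp] lemma matG_11 : matG 1 1 = -1 := rfl

lemma bianchi_ext {g k : Bianchi} (h00 : g 0 0 = k 0 0) (h01 : g 0 1 = k 0 1)
    (h10 : g 1 0 = k 1 0) (h11 : g 1 1 = k 1 1) : g = k := by
  apply Subtype.ext
  refine Matrix.ext fun i j => ?_
  fin_cases i <;> fin_cases j
  exacts [h00, h01, h10, h11]

@[simp] lemma px_trans_smul (u : ℤ√(-2)) (p : UpperHalfSpace) :
    (trans u • p).px = p.px + u.re := by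
  simp [px_smul, quad_zero_one]

@[simp] lemma pv_trans_smul (u : ℤ√(-2)) (p : UpperHalfSpace) :
    (trans u • p).pv = p.pv + u.im := by
  simp [pv_smul, quad_zero_one]

@[simp] lemma ht_trans_smul (u : ℤ√(-2)) (p : UpperHalfSpace) :
    (trans u • p).ht = p.ht := by
  simp [ht_smul, quad_zero_one]

lemma smul_eq_of_neg {g k : Bianchi} (h : ∀ i j, k i j = -g i j) (p : UpperHalfSpace) :
    k • p = g • p := by
  apply ext_coord
  · rw [px_smul, px_smul]
    simp only [h, quad_neg, Zsqrtd.re_neg, Zsqrtd.im_neg, Int.cast_neg]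
    congr 1
    ring
  · rw [pv_smul, pv_smul]
    simp only [h, quad_neg, Zsqrtd.re_neg, Zsqrtd.im_neg, Int.cast_neg]
    congr 1
    ring
  · rw [ht_smul, ht_smul]
    simp only [h, quad_neg]

lemma quad_one_zero (p : UpperHalfSpace) :
    quad 1 0 p = p.px ^ 2 + 2 * p.pv ^ 2 + p.ht ^ 2 := by
  simp [quad_eq, nrm]

lemma matS_smul_of_quad {p : UpperHalfSpace} (h : quad 1 0 p = 1) :
    (matS • p).px = -p.px ∧ (matS • p).pv = p.pv ∧ (matS • p).ht = p.ht := by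
  refine ⟨?_, ?_, ?_⟩
  · rw [px_smul, matS_10, matS_11, h]
    simp
  · rw [pv_smul, matS_10, matS_11, h]
    simp
  · rw [ht_smul, matS_10, matS_11, h, div_one]

/-- On the floor of the region of `∞` the hemisphere of `√-2/2` is the fixed axis of `matG`. -/
lemma matG_smul_of_isTop {p : UpperHalfSpace} (hp : IsTop p)
    (h : quad (-Zsqrtd.sqrtd) (-1) p = 1) : matG • p = p := by
  rw [isTop_iff] at hp
  have h1 := hp 1 0 isCoprime_one_left
  have h2 := hp 1 (-Zsqrtd.sqrtd) isCoprime_one_left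
  -- The hemisphere about `√-2/2` lies strictly below the unit hemisphere about `0` for `v < 1/2`
  -- and strictly below the one about `√-2` for `v > 1/2`.
  have hx : p.pv = 1 / 2 := by
    rw [quad_eq] at h h1 h2
    simp [nrm] at h h1 h2
    nlinarith
  apply ext_coord
  · rw [px_smul, matG_10, matG_11, h]
    rw [quad_eq] at h
    simp [nrm, hx] at h ⊢
    nlinarith
  · rw [pv_smul, matG_10, matG_11, h]
    rw [quad_eq] at h
    simp [nrm, hx] at h ⊢
    nlinarith
  · rw [ht_smul, matG_10, matG_11, h, div_one]

end UpperHalfSpace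

/-! ### The floor of the region of the cusp `∞` -/

/-- The distance to the nearest integer. -/
def intDist (x : ℝ) : ℝ := ‖(x : UnitAddCircle)‖

lemma intDist_eq (x : ℝ) : intDist x = |x - round x| := UnitAddCircle.norm_eq

lemma continuous_intDist : Continuous intDist :=
  continuous_norm.comp (AddCircle.continuous_mk' 1)

lemma intDist_add_int (x : ℝ) (n : ℤ) : intDist (x + n) = intDist x := by
  rw [intDist_eq, intDist_eq, round_add_intCast]
  push_cast
  congr 1
  ring

lemma intDist_neg (x : ℝ) : intDist (-x) = intDist x := by
  unfold intDist
  rw [AddCircle.coe_neg, norm_neg]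

lemma intDist_nonneg (x : ℝ) : 0 ≤ intDist x := norm_nonneg _

lemma intDist_le_half (x : ℝ) : intDist x ≤ 1 / 2 := by
  rw [intDist_eq]
  exact abs_sub_round x

lemma intDist_of_abs_le {x : ℝ} (h : |x| ≤ 1 / 2) : intDist x = |x| := by
  have := (AddCircle.norm_coe_eq_abs_iff (p := (1 : ℝ)) one_ne_zero (x := x)).2 (by simpa using h)
  exact this

/-- The square of the height of the floor of the region of the cusp `∞`. -/
def floorSq (x v : ℝ) : ℝ := 1 - intDist x ^ 2 - 2 * intDist v ^ 2

lemma floorSq_ge (x v : ℝ) : 1 / 4 ≤ floorSq x v := by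
  have h1 := intDist_nonneg x
  have h2 := intDist_nonneg v
  have h3 := intDist_le_half x
  have h4 := intDist_le_half v
  unfold floorSq
  nlinarith

lemma floorSq_pos (x v : ℝ) : 0 < floorSq x v := lt_of_lt_of_le (by norm_num) (floorSq_ge x v)

lemma continuous_floorSq : Continuous fun q : ℝ × ℝ => floorSq q.1 q.2 := by
  unfold floorSq
  have := continuous_intDist
  fun_prop

lemma floorSq_add_int (x v : ℝ) (n m : ℤ) : floorSq (x + n) (v + m) = floorSq x v := by
  rw [floorSq, floorSq, intDist_add_int, intDist_add_int]

lemma floorSq_neg (x v : ℝ) : floorSq (-x) v = floorSq x v := by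
  rw [floorSq, floorSq, intDist_neg]

lemma floorSq_of_abs_le {x v : ℝ} (hx : |x| ≤ 1 / 2) (hv : |v| ≤ 1 / 2) :
    floorSq x v = 1 - x ^ 2 - 2 * v ^ 2 := by
  rw [floorSq, intDist_of_abs_le hx, intDist_of_abs_le hv, sq_abs, sq_abs]

namespace UpperHalfSpace

/-- The integral inequality behind the shape of the floor. -/
lemma nrm_add_nrm_ge {c d : ℤ√(-2)} (h : c ≠ 0 ∨ d ≠ 0) :
    |c.re * d.re + 2 * c.im * d.im| + 2 * |c.re * d.im - c.im * d.re| + 1 ≤ nrm c + nrm d := by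
  -- The signs `e`, `f` correspond to the four corners of the rectangle: there, on the unit
  -- hemisphere, `quad c d` is `nrm c + nrm d` minus these two terms.
  have key : ∀ e f : ℤ, e ^ 2 = 1 → f ^ 2 = 1 →
      e * (c.re * d.re + 2 * c.im * d.im) + 2 * f * (c.re * d.im - c.im * d.re) + 1 ≤
        nrm c + nrm d := by
    intro e f he hf
    by_contra hlt
    have h1 : nrm c + nrm d - e * (c.re * d.re + 2 * c.im * d.im) -
      2 * f * (c.re * d.im - c.im * d.re) ≤ 0 := by omega
    unfold nrm at h1
    -- Completing the square in `d` leaves a remainder `nrm c`. The form is thus positive definite,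
    -- and an integral value other than zero is at least `1`.
    have h2 : (2 * d.re - e * c.re + 2 * f * c.im) ^ 2 + 2 * (2 * d.im - e * c.im - f * c.re) ^ 2 +
      c.re ^ 2 + 2 * c.im ^ 2 ≤ 0 := by
      linear_combination 4 * h1 + (c.re ^ 2 + 2 * c.im ^ 2) * he +
        (2 * c.re ^ 2 + 4 * c.im ^ 2) * hf
    have hc1 : c.re = 0 := by
      by_contra hne
      have := sq_pos_of_ne_zero hne
      nlinarith [sq_nonneg (2 * d.re - e * c.re + 2 * f * c.im), sq_nonneg c.im,
        sq_nonneg (2 * d.im - e * c.im - f * c.re)]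
    have hc2 : c.im = 0 := by
      by_contra hne
      have := sq_pos_of_ne_zero hne
      nlinarith [sq_nonneg (2 * d.re - e * c.re + 2 * f * c.im), sq_nonneg c.re,
        sq_nonneg (2 * d.im - e * c.im - f * c.re)]
    rw [hc1, hc2] at h2
    have hd1 : d.re = 0 := by
      by_contra hne
      have := sq_pos_of_ne_zero hne
      nlinarith [sq_nonneg d.im]
    have hd2 : d.im = 0 := by
      by_contra hne
      have := sq_pos_of_ne_zero hne
      nlinarith [sq_nonneg d.re]
    rcases h with h | h
    · exact h (Zsqrtd.ext hc1 hc2)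
    · exact h (Zsqrtd.ext hd1 hd2)
  have h1 := key 1 1 (by norm_num) (by norm_num)
  have h2 := key 1 (-1) (by norm_num) (by norm_num)
  have h3 := key (-1) 1 (by norm_num) (by norm_num)
  have h4 := key (-1) (-1) (by norm_num) (by norm_num)
  rcases abs_cases (c.re * d.re + 2 * c.im * d.im) with ⟨ha, -⟩ | ⟨ha, -⟩ <;>
  rcases abs_cases (c.re * d.im - c.im * d.re) with ⟨hb, -⟩ | ⟨hb, -⟩ <;>
  rw [ha, hb] <;> linarith

lemma quad_expand (c d : ℤ√(-2)) (p : UpperHalfSpace) :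
    quad c d p = nrm c * (p.px ^ 2 + 2 * p.pv ^ 2 + p.ht ^ 2) + nrm d +
      2 * p.px * (c.re * d.re + 2 * c.im * d.im : ℤ) +
      4 * p.pv * (c.re * d.im - c.im * d.re : ℤ) := by
  rw [quad_eq]
  unfold nrm
  push_cast
  ring

lemma ne_zero_or_of_isCoprime {c d : ℤ√(-2)} (h : IsCoprime c d) : c ≠ 0 ∨ d ≠ 0 := by
  by_contra! h'
  obtain ⟨u, v, huv⟩ := h
  rw [h'.1, h'.2] at huv
  simp at huv

lemma nrm_nonneg (c : ℤ√(-2)) : 0 ≤ nrm c := by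
  unfold nrm
  positivity

lemma nrm_pos {c : ℤ√(-2)} (h : c ≠ 0) : 0 < nrm c := by
  refine lt_of_le_of_ne (nrm_nonneg c) fun h0 => h ?_
  unfold nrm at h0
  have h1 : c.re ^ 2 = 0 := by nlinarith [sq_nonneg c.re, sq_nonneg c.im]
  have h2 : c.im ^ 2 = 0 := by nlinarith [sq_nonneg c.re, sq_nonneg c.im]
  exact Zsqrtd.ext (pow_eq_zero_iff two_ne_zero |>.1 h1) (pow_eq_zero_iff two_ne_zero |>.1 h2)

/-- On or above the unit hemisphere, `quad c d` is at least an expression affine in `x` and in `v`.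
Its minimum over the rectangle is taken at a corner, where `nrm_add_nrm_ge` bounds it. -/
lemma one_le_quad_of_abs_le {c d : ℤ√(-2)} (h : IsCoprime c d) {p : UpperHalfSpace}
    (hx : |p.px| ≤ 1 / 2) (hv : |p.pv| ≤ 1 / 2)
    (ht : 1 - p.px ^ 2 - 2 * p.pv ^ 2 ≤ p.ht ^ 2) : 1 ≤ quad c d p := by
  have h1 : ((|c.re * d.re + 2 * c.im * d.im| + 2 * |c.re * d.im - c.im * d.re| + 1 : ℤ) : ℝ) ≤
    ((nrm c + nrm d : ℤ) : ℝ) := Int.cast_le.2 (nrm_add_nrm_ge (ne_zero_or_of_isCoprime h))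
  have hn : (0 : ℝ) ≤ nrm c := Int.cast_nonneg (nrm_nonneg c)
  rw [quad_expand]
  generalize (c.re * d.re + 2 * c.im * d.im : ℤ) = A at *
  generalize (c.re * d.im - c.im * d.re : ℤ) = B at *
  push_cast at h1
  have hA : -(|(A : ℝ)|) ≤ 2 * p.px * A := by
    have : |p.px * A| ≤ 1 / 2 * |(A : ℝ)| := by
      rw [abs_mul]
      gcongr
    have := (abs_le.1 this).1
    linarith
  have hB : -(2 * |(B : ℝ)|) ≤ 4 * p.pv * B := by
    have : |p.pv * B| ≤ 1 / 2 * |(B : ℝ)| := by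
      rw [abs_mul]
      gcongr
    have := (abs_le.1 this).1
    linarith
  nlinarith

lemma isTop_trans_smul_iff (u : ℤ√(-2)) (p : UpperHalfSpace) : IsTop (trans u • p) ↔ IsTop p := by
  rw [isTop_smul_iff, trans_10, trans_11]

/-- A translation moves `z` into the central rectangle. There the cusp `0` is the only rival of `∞`
that has to be checked. -/
lemma isTop_iff_floorSq_le (p : UpperHalfSpace) : IsTop p ↔ floorSq p.px p.pv ≤ p.ht ^ 2 := by
  set u : ℤ√(-2) := ⟨-round p.px, -round p.pv⟩ with hu
  have hx : |(trans u • p).px| ≤ 1 / 2 := by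
    rw [px_trans_smul]
    simpa [hu, ← sub_eq_add_neg] using abs_sub_round p.px
  have hv : |(trans u • p).pv| ≤ 1 / 2 := by
    rw [pv_trans_smul]
    simpa [hu, ← sub_eq_add_neg] using abs_sub_round p.pv
  have e : floorSq p.px p.pv = floorSq (trans u • p).px (trans u • p).pv := by
    rw [px_trans_smul, pv_trans_smul, floorSq_add_int]
  rw [← isTop_trans_smul_iff u, e, ← ht_trans_smul u p, floorSq_of_abs_le hx hv]
  generalize trans u • p = q at *
  constructor
  · intro h
    have := (isTop_iff q).1 h 1 0 isCoprime_one_left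
    rw [quad_one_zero] at this
    linarith
  · intro h
    rw [isTop_iff]
    exact fun c d hcd => one_le_quad_of_abs_le hcd hx hv h

/-- The point of the floor above `x + v√-2`. -/
def floorPt (x v : ℝ) : UpperHalfSpace :=
  mkPt x v (Real.sqrt (floorSq x v)) (Real.sqrt_pos.2 (floorSq_pos x v))

@[simp] lemma px_floorPt (x v : ℝ) : (floorPt x v).px = x := px_mkPt _ _ _ _
@[simp] lemma pv_floorPt (x v : ℝ) : (floorPt x v).pv = v := pv_mkPt _ _ _ _

lemma ht_floorPt (x v : ℝ) : (floorPt x v).ht = Real.sqrt (floorSq x v) := rfl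

lemma ht_floorPt_sq (x v : ℝ) : (floorPt x v).ht ^ 2 = floorSq x v :=
  Real.sq_sqrt (floorSq_pos x v).le

lemma continuous_floorPt : Continuous fun q : ℝ × ℝ => floorPt q.1 q.2 := by
  have h1 := continuous_floorSq
  refine Continuous.subtype_mk (Continuous.prodMk ?_ (Real.continuous_sqrt.comp h1)) _
  exact Complex.equivRealProdCLM.symm.continuous.comp
    (continuous_fst.prodMk (continuous_const.mul continuous_snd))

lemma isTop_floorPt (x v : ℝ) : IsTop (floorPt x v) := by
  rw [isTop_iff_floorSq_le, ht_floorPt_sq, px_floorPt, pv_floorPt]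

lemma eq_floorPt {p : UpperHalfSpace} (h : p.ht ^ 2 = floorSq p.px p.pv) :
    floorPt p.px p.pv = p := by
  refine ext_coord (px_floorPt _ _) (pv_floorPt _ _) ?_
  rw [ht_floorPt, ← h, Real.sqrt_sq p.ht_pos.le]

/-- A point with `∞` and another cusp nearest lies on the floor. -/
lemma ht_sq_eq_of_quad_eq_one {p : UpperHalfSpace} (hp : IsTop p) {c d : ℤ√(-2)}
    (hcd : IsCoprime c d) (hc : c ≠ 0) (h : quad c d p = 1) : p.ht ^ 2 = floorSq p.px p.pv := by
  refine le_antisymm ?_ ((isTop_iff_floorSq_le p).1 hp)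
  have h1 := (isTop_iff _).1 (isTop_floorPt p.px p.pv) c d hcd
  rw [← h, quad_eq, quad_eq, px_floorPt, pv_floorPt, ht_floorPt_sq] at h1
  have hn : (0 : ℝ) < nrm c := Int.cast_pos.2 (nrm_pos hc)
  nlinarith

lemma trans_smul_floorPt (u : ℤ√(-2)) (x v : ℝ) :
    trans u • floorPt x v = floorPt (x + u.re) (v + u.im) := by
  apply ext_coord
  · simp
  · simp
  · rw [ht_trans_smul, ht_floorPt, ht_floorPt, floorSq_add_int]

lemma matS_smul_floorPt {x v : ℝ} (hx : |x| ≤ 1 / 2) (hv : |v| ≤ 1 / 2) :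
    matS • floorPt x v = floorPt (-x) v := by
  have h : quad 1 0 (floorPt x v) = 1 := by
    rw [quad_one_zero, ht_floorPt_sq, px_floorPt, pv_floorPt, floorSq_of_abs_le hx hv]
    ring
  obtain ⟨h1, h2, h3⟩ := matS_smul_of_quad h
  apply ext_coord
  · rw [h1, px_floorPt, px_floorPt]
  · rw [h2, pv_floorPt, pv_floorPt]
  · rw [h3, ht_floorPt, ht_floorPt, floorSq_neg]

end UpperHalfSpace

namespace UpperHalfSpace

/-! ### Compatible families on the floor -/

/-- Reduction modulo `√-2`. -/
def red : ℤ√(-2) →+* ZMod 2 := Zsqrtd.lift ⟨0, rfl⟩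

lemma red_apply (c : ℤ√(-2)) : red c = (c.re : ZMod 2) := by
  simp [red, Zsqrtd.lift]

/-- Families of functions of the floor coordinates, labelled by columns over `𝔽₂`, that are
compatible with the translations and with the inversion. -/
structure LabelCompat {Y : Type} (φ : ZMod 2 → ZMod 2 → ℝ → ℝ → Y) : Prop where
  shift_one : ∀ a c x v, φ (a + c) c (x + 1) v = φ a c x v
  shift_sqrt : ∀ a c x v, φ a c x (v + 1) = φ a c x v
  flip : ∀ a c x v, |x| ≤ 1 / 2 → |v| ≤ 1 / 2 → φ c a (-x) v = φ a c x v

/-- `k` respects the family `φ` at the point `p`. -/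
def Respects {Y : Type} (φ : ZMod 2 → ZMod 2 → ℝ → ℝ → Y) (k : Bianchi) (p : UpperHalfSpace) :
    Prop :=
  ∀ a c, φ (red (k 0 0) * a + red (k 0 1) * c) (red (k 1 0) * a + red (k 1 1) * c)
    (k • p).px (k • p).pv = φ a c p.px p.pv

variable {Y : Type} {φ : ZMod 2 → ZMod 2 → ℝ → ℝ → Y}

/-- This cocycle property reduces the check for a matrix to its factors, each at the point where it
acts. -/
lemma Respects.mul {k l : Bianchi} {p : UpperHalfSpace} (hl : Respects φ l (k • p))
    (hk : Respects φ k p) : Respects φ (l * k) p := by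
  intro a c
  rw [← hk a c, ← hl, mul_smul]
  simp only [mul_entry, map_add, map_mul]
  congr 1 <;> ring

lemma Respects.of_neg {k l : Bianchi} {p : UpperHalfSpace} (h : ∀ i j, l i j = -k i j)
    (hk : Respects φ k p) : Respects φ l p := by
  intro a c
  rw [← hk a c, smul_eq_of_neg h]
  simp only [h, map_neg, ZMod.neg_eq_self_mod_two]

lemma LabelCompat.shift (hφ : LabelCompat φ) (a c : ZMod 2) (x v : ℝ) (n m : ℤ) :
    φ (a + n * c) c (x + n) (v + m) = φ a c x v := by
  have h1 : ∀ (n : ℤ) a x v, φ (a + n * c) c (x + n) v = φ a c x v := by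
    intro n
    induction n with
    | zero => simp
    | succ n ih =>
      intro a x v
      rw [← ih a x v, ← hφ.shift_one (a + ((n : ℤ) : ZMod 2) * c) c (x + ((n : ℤ) : ℝ)) v]
      push_cast
      congr 1 <;> ring
    | pred n ih =>
      intro a x v
      rw [← ih a x v, ← hφ.shift_one]
      push_cast
      congr 1 <;> ring
  have h2 : ∀ (m : ℤ) v, φ a c x (v + m) = φ a c x v := by
    intro m
    induction m with
    | zero => simp
    | succ m ih =>
      intro v
      rw [← ih v, ← hφ.shift_sqrt a c x (v + ((m : ℤ) : ℝ))]
      push_cast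
      congr 1
      ring
    | pred m ih =>
      intro v
      rw [← ih v, ← hφ.shift_sqrt]
      push_cast
      congr 1
      ring
  rw [h1, h2]

lemma respects_trans (hφ : LabelCompat φ) (u : ℤ√(-2)) (p : UpperHalfSpace) :
    Respects φ (trans u) p := by
  intro a c
  rw [px_trans_smul, pv_trans_smul, ← hφ.shift a c p.px p.pv u.re u.im]
  simp [red_apply]

lemma respects_matS (hφ : LabelCompat φ) {p : UpperHalfSpace} (hp : IsTop p)
    (h : quad 1 0 p = 1) : Respects φ matS p := by
  intro a c
  obtain ⟨h1, h2, -⟩ := matS_smul_of_quad h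
  rw [h1, h2]
  -- Comparison with the cusps `±1` and `±√-2` confines a point of the unit hemisphere to the
  -- rectangle in which the `flip` law holds.
  have key : ∀ d : ℤ√(-2), 1 ≤ quad 1 d p := fun d => (isTop_iff p).1 hp 1 d isCoprime_one_left
  have k1 := key 1
  have k2 := key (-1)
  have k3 := key Zsqrtd.sqrtd
  have k4 := key (-Zsqrtd.sqrtd)
  rw [quad_expand] at h k1 k2 k3 k4
  simp [nrm] at h k1 k2 k3 k4
  have hx : |p.px| ≤ 1 / 2 := abs_le.2 ⟨by linarith, by linarith⟩
  have hv : |p.pv| ≤ 1 / 2 := abs_le.2 ⟨by linarith, by linarith⟩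
  rw [← hφ.flip a c _ _ hx hv]
  simp

/-- The matrix is the identity modulo `√-2`, so it moves neither the label nor the point. -/
lemma respects_matG {p : UpperHalfSpace} (h : matG • p = p) : Respects φ matG p := by
  intro a c
  rw [h]
  simp [red_apply]

/-- If `p` and `k • p` both have `∞` as a nearest cusp then `k` preserves the height of `p`. -/
lemma quad_row_eq_one {k : Bianchi} {p : UpperHalfSpace} (hp : IsTop p) (hk : IsTop (k • p)) :
    quad (k 1 0) (k 1 1) p = 1 := by
  refine le_antisymm ?_ ((isTop_iff p).1 hp _ _ (isCoprime_row k))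
  have := (isTop_smul_iff k p).1 hk 0 1 (isCoprime_zero_left.2 isUnit_one)
  rwa [quad_zero_one] at this

lemma mul_trans_row (k : Bianchi) (u : ℤ√(-2)) :
    (k * trans u) 1 0 = k 1 0 ∧ (k * trans u) 1 1 = k 1 0 * u + k 1 1 := by
  constructor <;> rw [mul_entry] <;> simp

/-- If the lower left entry of `k` has norm at least `3`, only corners of the floor stay on the
floor. -/
lemma exists_corner {k : Bianchi} {p : UpperHalfSpace} (hp : IsTop p) (hk : IsTop (k • p))
    (h3 : 3 ≤ nrm (k 1 0)) : ∃ n m : ℤ, p.px = 1 / 2 + n ∧ p.pv = 1 / 2 + m := by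
  set u : ℤ√(-2) := ⟨-round p.px, -round p.pv⟩ with hu
  have hx : |(trans u • p).px| ≤ 1 / 2 := by
    rw [px_trans_smul]
    simpa [hu, ← sub_eq_add_neg] using abs_sub_round p.px
  have hv : |(trans u • p).pv| ≤ 1 / 2 := by
    rw [pv_trans_smul]
    simpa [hu, ← sub_eq_add_neg] using abs_sub_round p.pv
  have hc0 : k 1 0 ≠ 0 := by
    intro h
    rw [h] at h3
    simp [nrm] at h3
  have h1 := quad_row_eq_one hp hk
  have hfl := ht_sq_eq_of_quad_eq_one hp (isCoprime_row k) hc0 h1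
  obtain ⟨q, hq⟩ : ∃ q, q = trans u • p := ⟨_, rfl⟩
  obtain ⟨l, hl⟩ : ∃ l, l = k * trans (-u) := ⟨_, rfl⟩
  have hlq : l • q = k • p := by
    rw [hl, hq, ← mul_smul, mul_assoc]
    congr 1
    have : trans (-u) * trans u = 1 := by
      apply bianchi_ext <;> rw [mul_entry] <;> simp
    rw [this, mul_one]
  have hl0 : l 1 0 = k 1 0 := by rw [hl, (mul_trans_row k (-u)).1]
  have hqt : IsTop q := by rw [hq, isTop_trans_smul_iff]; exact hp
  have h2 := quad_row_eq_one (k := l) hqt (by rw [hlq]; exact hk)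
  have hge := nrm_add_nrm_ge (ne_zero_or_of_isCoprime (isCoprime_row l))
  rw [quad_expand] at h2
  have hfl' : q.px ^ 2 + 2 * q.pv ^ 2 + q.ht ^ 2 = 1 := by
    rw [hq, ht_trans_smul, hfl, ← floorSq_add_int _ _ u.re u.im, ← px_trans_smul, ← pv_trans_smul,
      floorSq_of_abs_le hx hv]
    ring
  rw [hfl', mul_one] at h2
  rw [← hq] at hx hv
  rw [← hl0] at h3
  -- Multiplicativity of the norm, in the form `A² + 2B² = N N'`.
  have hprod : ((l 1 0).re * (l 1 1).re + 2 * (l 1 0).im * (l 1 1).im) ^ 2 +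
      2 * ((l 1 0).re * (l 1 1).im - (l 1 0).im * (l 1 1).re) ^ 2 =
      nrm (l 1 0) * nrm (l 1 1) := by
    unfold nrm
    ring
  generalize (l 1 0).re * (l 1 1).re + 2 * (l 1 0).im * (l 1 1).im = A at *
  generalize (l 1 0).re * (l 1 1).im - (l 1 0).im * (l 1 1).re = B at *
  have hN := nrm_nonneg (l 1 1)
  generalize nrm (l 1 0) = N at *
  generalize nrm (l 1 1) = N' at *
  have hgeR : (|(A : ℝ)| + 2 * |(B : ℝ)| + 1 : ℝ) ≤ N + N' := by exact_mod_cast hge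
  have hA : |2 * q.px * A| ≤ |(A : ℝ)| := by
    rw [abs_mul, abs_mul, abs_two]
    nlinarith [abs_nonneg (A : ℝ)]
  have hB : |4 * q.pv * B| ≤ 2 * |(B : ℝ)| := by
    rw [abs_mul, abs_mul, abs_of_pos (by norm_num : (0 : ℝ) < 4)]
    nlinarith [abs_nonneg (B : ℝ)]
  have hA' := (abs_le.1 hA).1
  have hB' := (abs_le.1 hB).1
  -- Since `quad` equals exactly `1`, each estimate used to bound it below is an equality. Hence `x
  -- = ±1/2` if `A ≠ 0` and `v = ±1/2` if `B ≠ 0`.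
  have eN : (N + N' : ℝ) = |(A : ℝ)| + 2 * |(B : ℝ)| + 1 := by linarith
  have eA : 2 * q.px * A = -|(A : ℝ)| := by linarith
  have eB : 4 * q.pv * B = -(2 * |(B : ℝ)|) := by linarith
  have eNZ : N + N' = |A| + 2 * |B| + 1 := by exact_mod_cast eN
  -- If `A = 0`, then `(N - 1)² + (N' - 1)² = 1`; if `B = 0`, then `(2N' + N - 2)² + 3N² = 4N`. Both
  -- contradict `N ≥ 3`.
  have hA0 : A ≠ 0 := by
    rintro rfl
    have h5 : (N + N' - 1) ^ 2 = 4 * B ^ 2 := by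
      rw [eNZ, ← sq_abs B, abs_zero]
      ring
    nlinarith [sq_nonneg (N' - 1)]
  have hB0 : B ≠ 0 := by
    rintro rfl
    have h5 : (N + N' - 1) ^ 2 = A ^ 2 := by
      rw [eNZ, ← sq_abs A, abs_zero]
      ring
    nlinarith [sq_nonneg (2 * N' + N - 2)]
  have hx2 : q.px = 1 / 2 ∨ q.px = -(1 / 2) := by
    rcases abs_cases (A : ℝ) with ⟨h6, -⟩ | ⟨h6, -⟩ <;> rw [h6] at eA
    · right
      have : (A : ℝ) ≠ 0 := Int.cast_ne_zero.2 hA0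
      field_simp
      apply mul_right_cancel₀ this
      linarith
    · left
      have : (A : ℝ) ≠ 0 := Int.cast_ne_zero.2 hA0
      field_simp
      apply mul_right_cancel₀ this
      linarith
  have hv2 : q.pv = 1 / 2 ∨ q.pv = -(1 / 2) := by
    rcases abs_cases (B : ℝ) with ⟨h6, -⟩ | ⟨h6, -⟩ <;> rw [h6] at eB
    · right
      have : (B : ℝ) ≠ 0 := Int.cast_ne_zero.2 hB0
      field_simp
      apply mul_right_cancel₀ this
      linarith
    · left
      have : (B : ℝ) ≠ 0 := Int.cast_ne_zero.2 hB0
      field_simp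
      apply mul_right_cancel₀ this
      linarith
  have ex : p.px = q.px + round p.px := by rw [hq, px_trans_smul, hu]; push_cast; ring
  have ev : p.pv = q.pv + round p.pv := by rw [hq, pv_trans_smul, hu]; push_cast; ring
  have hx3 : ∃ n : ℤ, p.px = 1 / 2 + n := by
    rcases hx2 with h | h
    · exact ⟨round p.px, by linarith⟩
    · exact ⟨round p.px - 1, by push_cast; linarith⟩
  have hv3 : ∃ n : ℤ, p.pv = 1 / 2 + n := by
    rcases hv2 with h | h
    · exact ⟨round p.pv, by linarith⟩
    · exact ⟨round p.pv - 1, by push_cast; linarith⟩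
  obtain ⟨n, hn⟩ := hx3
  obtain ⟨m, hm⟩ := hv3
  exact ⟨n, m, hn, hm⟩

lemma sq_one_cases {n : ℤ} (h : n ^ 2 = 1) : n = 1 ∨ n = -1 := by
  have : (n - 1) * (n + 1) = 0 := by linear_combination h
  rcases mul_eq_zero.1 this with h | h <;> omega

lemma eq_of_nrm_one {c : ℤ√(-2)} (h : nrm c = 1) : c = 1 ∨ c = -1 := by
  unfold nrm at h
  have h1 : c.im = 0 := by
    by_contra hne
    have := sq_pos_of_ne_zero hne
    nlinarith [sq_nonneg c.re]
  rw [h1] at h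
  rcases sq_one_cases (show c.re ^ 2 = 1 by linarith) with h2 | h2
  · exact Or.inl (Zsqrtd.ext h2 h1)
  · exact Or.inr (Zsqrtd.ext h2 (by simpa using h1))

lemma eq_of_nrm_two {c : ℤ√(-2)} (h : nrm c = 2) :
    c = Zsqrtd.sqrtd ∨ c = -Zsqrtd.sqrtd := by
  unfold nrm at h
  have h0 : c.im ≠ 0 := by
    intro h0
    rw [h0] at h
    have h1 : c.re ≤ 1 := by nlinarith
    have h2 : -1 ≤ c.re := by nlinarith
    interval_cases c.re <;> omega
  have h1 := sq_pos_of_ne_zero h0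
  have h2 : c.re = 0 := by
    by_contra hne
    have := sq_pos_of_ne_zero hne
    nlinarith
  rw [h2] at h
  rcases sq_one_cases (show c.im ^ 2 = 1 by linarith) with h3 | h3
  · exact Or.inl (Zsqrtd.ext h2 h3)
  · exact Or.inr (Zsqrtd.ext (by simpa using h2) (by simpa using h3))

/-- The negative of a matrix. -/
def negMat (k : Bianchi) : Bianchi :=
  ⟨-k.1, by rw [Matrix.det_neg, k.2]; simp⟩

lemma negMat_apply (k : Bianchi) (i j : Fin 2) : negMat k i j = -k i j := rfl

lemma isTop_negMat_smul {k : Bianchi} {p : UpperHalfSpace} (h : IsTop (k • p)) :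
    IsTop (negMat k • p) := by
  rwa [smul_eq_of_neg (negMat_apply k)]

lemma respects_of_neg {k : Bianchi} {p : UpperHalfSpace} (h : Respects φ (negMat k) p) :
    Respects φ k p :=
  h.of_neg fun i j => by rw [negMat_apply, neg_neg]

lemma eq_trans_of_row {k : Bianchi} (h0 : k 1 0 = 0) (h1 : k 1 1 = 1) : k = trans (k 0 1) := by
  have hd := bianchi_det k
  rw [h0, h1] at hd
  apply bianchi_ext
  · rw [trans_00]
    linear_combination hd
  · rfl
  · rw [h0, trans_10]
  · rw [h1, trans_11]

lemma quad_trans_smul (c d u : ℤ√(-2)) (p : UpperHalfSpace) :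
    quad c d (trans u • p) = quad c (c * u + d) p := by
  have := quad_smul (trans u) c d p
  simpa [quad_zero_one] using this

/-- Such a matrix is a translation, the inversion and a translation, and the first translation
brings the point onto the unit hemisphere. -/
lemma respects_of_row_one (hφ : LabelCompat φ) {k : Bianchi} {p : UpperHalfSpace} (hp : IsTop p)
    (hk : IsTop (k • p)) (h : k 1 0 = 1) : Respects φ k p := by
  have h1 := quad_row_eq_one hp hk
  have hd := bianchi_det k
  have e : k = trans (k 0 0) * (matS * trans (k 1 1)) := by
    rw [h] at hd
    apply bianchi_ext <;> simp only [mul_entry] <;> simp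
    · linear_combination -hd
    · exact h
  rw [e]
  refine (respects_trans hφ _ _).mul (Respects.mul ?_ (respects_trans hφ _ _))
  refine respects_matS hφ ((isTop_trans_smul_iff _ _).2 hp) ?_
  rw [quad_trans_smul, one_mul, add_zero]
  rw [h] at h1
  exact h1

/-- Modulo `√-2` the determinant forces both diagonal entries to be `1`, so translations on either
side reduce the matrix to `matG`, and the translated point lies on its axis. -/
lemma respects_of_row_neg_sqrt (hφ : LabelCompat φ) {k : Bianchi} {p : UpperHalfSpace}
    (hp : IsTop p) (hk : IsTop (k • p)) (h : k 1 0 = -Zsqrtd.sqrtd) : Respects φ k p := by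
  have h1 := quad_row_eq_one hp hk
  have hd := bianchi_det k
  rw [h] at hd
  have hodd : ∀ a b : ZMod 2, a * b = 1 → a = 1 ∧ b = 1 := by decide
  have hr := congrArg red hd
  have hs : red Zsqrtd.sqrtd = 0 := by simp [red_apply]
  simp only [map_sub, map_mul, map_neg, hs, map_one, neg_zero, mul_zero, sub_zero] at hr
  obtain ⟨h00, h11⟩ := hodd _ _ hr
  have hdiv : ∀ c : ℤ√(-2), red c = 0 → Zsqrtd.sqrtd * divSqrt c = c := by
    intro c hc
    rw [red_apply, ZMod.intCast_zmod_eq_zero_iff_dvd] at hc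
    ext <;> simp [divSqrt]
    omega
  obtain ⟨v, hv⟩ : ∃ v : ℤ√(-2), Zsqrtd.sqrtd * v = -(k 1 1 + 1) :=
    ⟨_, hdiv _ (by rw [map_neg, map_add, h11, map_one]; rfl)⟩
  obtain ⟨u, hu⟩ : ∃ u : ℤ√(-2), Zsqrtd.sqrtd * u = 1 - k 0 0 :=
    ⟨_, hdiv _ (by rw [map_sub, h00, map_one]; rfl)⟩
  have hss : (Zsqrtd.sqrtd * Zsqrtd.sqrtd : ℤ√(-2)) = -2 := by ext <;> simp
  have e : k = trans u * (matG * trans v) := by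
    apply bianchi_ext <;> simp only [mul_entry] <;> simp
    · linear_combination hu
    · apply sqrtd_cancel
      linear_combination hd - k 0 0 * hv + (1 + Zsqrtd.sqrtd * v) * hu + hss
    · exact h
    · linear_combination hv
  rw [e]
  refine (respects_trans hφ _ _).mul (Respects.mul ?_ (respects_trans hφ _ _))
  refine respects_matG (matG_smul_of_isTop ((isTop_trans_smul_iff _ _).2 hp) ?_)
  rw [quad_trans_smul, ← h1, h]
  congr 1
  linear_combination -hv

/-- Flipping `x = 1/2` to `-1/2` and shifting back returns to the same point, but acts on labels by
a matrix of order 3. So the three nonzero labels agree on this edge. -/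
lemma LabelCompat.corner (hφ : LabelCompat φ) (v : ℝ) (hv : |v| ≤ 1 / 2) (a c : ZMod 2) :
    φ (a + c) a (1 / 2) v = φ a c (1 / 2) v := by
  have h1 := hφ.flip a c (1 / 2) v (by norm_num) hv
  have h2 := hφ.shift_one c a (-(1 / 2)) v
  rw [← h1, ← h2]
  norm_num [add_comm]

/-- A compatible family is respected by all matrices that keep a point in the region of `∞`. -/
theorem respects_of_isTop (hφ : LabelCompat φ) {k : Bianchi} {p : UpperHalfSpace} (hp : IsTop p)
    (hk : IsTop (k • p)) : Respects φ k p := by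
  have hn := nrm_nonneg (k 1 0)
  have hd := bianchi_det k
  -- Lower left entries of norm `0`, `1`, `2` are, up to sign, `0`, `1`, `√-2` and lead to
  -- translations, the inversion and `matG`.
  rcases lt_or_ge (nrm (k 1 0)) 3 with h | h
  · interval_cases hN : nrm (k 1 0)
    · have h0 : k 1 0 = 0 := by
        by_contra hne
        exact (nrm_pos hne).ne' hN
      rw [h0] at hd
      have hm : nrm (k 0 0) * nrm (k 1 1) = 1 := by
        have h1 := congrArg Zsqrtd.re hd
        have h2 := congrArg Zsqrtd.im hd
        simp at h1 h2
        unfold nrm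
        linear_combination (1 + (k 0 0).re * (k 1 1).re - 2 * (k 0 0).im * (k 1 1).im) * h1 +
          2 * ((k 0 0).re * (k 1 1).im + (k 0 0).im * (k 1 1).re) * h2
      have hm1 : nrm (k 1 1) = 1 := by
        rcases Int.mul_eq_one_iff_eq_one_or_neg_one.1 hm with h | h
        · exact h.2
        · have := nrm_nonneg (k 1 1)
          omega
      rcases eq_of_nrm_one hm1 with h1 | h1
      · rw [eq_trans_of_row h0 h1]
        exact respects_trans hφ _ _
      · refine respects_of_neg ?_
        rw [eq_trans_of_row (k := negMat k) (by rw [negMat_apply, h0, neg_zero])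
          (by rw [negMat_apply, h1, neg_neg])]
        exact respects_trans hφ _ _
    · rcases eq_of_nrm_one hN with h1 | h1
      · exact respects_of_row_one hφ hp hk h1
      · exact respects_of_neg (respects_of_row_one hφ hp (isTop_negMat_smul hk)
          (by rw [negMat_apply, h1, neg_neg]))
    · rcases eq_of_nrm_two hN with h1 | h1
      · exact respects_of_neg (respects_of_row_neg_sqrt hφ hp (isTop_negMat_smul hk)
          (by rw [negMat_apply, h1]))
      · exact respects_of_row_neg_sqrt hφ hp hk h1
  -- Here `p` and `k • p` are both corners. At a corner the family only sees whether the label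
  -- vanishes, and an invertible matrix preserves that.
  · obtain ⟨n, m, hx, hv⟩ := exists_corner hp hk h
    obtain ⟨n', m', hx', hv'⟩ := exists_corner (k := k⁻¹) hk (by rwa [inv_smul_smul]) (by
      rw [Matrix.SpecialLinearGroup.SL2_inv_expl]
      simpa [nrm] using h)
    intro a c
    rw [hx, hv, hx', hv']
    have e : ∀ (a c : ZMod 2) (n m : ℤ), φ a c (1 / 2 + n) (1 / 2 + m) =
        φ (a - n * c) c (1 / 2) (1 / 2) := by
      intro a c n m
      rw [← hφ.shift (a - n * c) c (1 / 2) (1 / 2) n m, sub_add_cancel]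
    rw [e, e]
    have hcor := hφ.corner (1 / 2) (by norm_num)
    have h1 : φ 1 1 (1 / 2) (1 / 2) = φ 1 0 (1 / 2) (1 / 2) := hcor 1 0
    have h2 : φ 0 1 (1 / 2) (1 / 2) = φ 1 0 (1 / 2) (1 / 2) := (hcor 1 1).trans h1
    have key : ∀ a c : ZMod 2, φ a c (1 / 2) (1 / 2) =
        if a = 0 ∧ c = 0 then φ 0 0 (1 / 2) (1 / 2) else φ 1 0 (1 / 2) (1 / 2) := by
      intro a c
      have h01 : ∀ b : ZMod 2, b = 0 ∨ b = 1 := by decide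
      rcases h01 a with rfl | rfl <;> rcases h01 c with rfl | rfl
      · rw [if_pos ⟨rfl, rfl⟩]
      · rw [if_neg (by decide), h2]
      · rw [if_neg (by decide)]
      · rw [if_neg (by decide), h1]
    rw [key, key (a - n * c)]
    have hr := congrArg red hd
    simp only [map_sub, map_mul, map_one] at hr
    refine if_congr ?_ rfl rfl
    generalize red (k 0 0) = α at *
    generalize red (k 0 1) = β at *
    generalize red (k 1 0) = γ at *
    generalize red (k 1 1) = δ at *
    generalize (n : ZMod 2) = ν at *
    generalize (n' : ZMod 2) = ν' at *
    revert α β γ δ ν ν' a c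
    decide

end UpperHalfSpace

namespace UpperHalfSpace

/-- A continuous compatible family on the floor defines a map on the upper half-space. -/
theorem exists_glue_family {Y : Type} [TopologicalSpace Y] {φ : ZMod 2 → ZMod 2 → ℝ → ℝ → Y}
    (hφ : LabelCompat φ) (hc : ∀ a c, Continuous fun q : ℝ × ℝ => φ a c q.1 q.2) :
    ∃ Φ : C(UpperHalfSpace, Y), ∀ (g : Bianchi) (p : UpperHalfSpace), IsTop (g • p) →
      Φ p = φ (red (g 0 0)) (red (g 1 0)) (g • p).px (g • p).pv := by
  refine exists_glue (fun g p => φ (red (g 0 0)) (red (g 1 0)) p.px p.pv) (fun g => ?_)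
    (fun g k p hp hk => ?_)
  · exact (hc _ _).comp (continuous_px.prodMk continuous_pv)
  · rw [← respects_of_isTop hφ hp hk]
    simp only [mul_entry, map_add, map_mul]

/-! ### The retract -/

lemma isNearestCusp_iff (l m : ℤ√(-2)) (p : UpperHalfSpace) :
    IsNearestCusp l m p ↔ IsCoprime l m ∧ Near m (-l) p := by
  have hp := p.ht_pos
  refine and_congr_right fun _ => ?_
  constructor
  · intro h c d hcd
    have h1 := h (-d) c (hcd.symm.neg_left)
    rw [cuspDist_eq, cuspDist_eq, neg_neg, div_le_div_iff_of_pos_right hp] at h1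
    exact h1
  · intro h l' m' h'
    rw [cuspDist_eq, cuspDist_eq, div_le_div_iff_of_pos_right hp]
    exact h m' (-l') h'.symm.neg_right

/-- Besides `∞`, the element of `R` obtained by rounding both coordinates is a nearest cusp. -/
lemma floorPt_mem_retractX (x v : ℝ) : floorPt x v ∈ retractX := by
  have h1 : IsTop (floorPt x v) := isTop_floorPt x v
  set d : ℤ√(-2) := ⟨-round x, -round v⟩ with hd
  have h2 : quad 1 d (floorPt x v) = 1 := by
    have e := quad_trans_smul 1 0 d (floorPt x v)
    rw [one_mul, add_zero] at e
    have hx : |x + d.re| ≤ 1 / 2 := by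
      simpa [hd, ← sub_eq_add_neg] using abs_sub_round x
    have hv : |v + d.im| ≤ 1 / 2 := by
      simpa [hd, ← sub_eq_add_neg] using abs_sub_round v
    rw [← e, trans_smul_floorPt, quad_one_zero, ht_floorPt_sq, px_floorPt, pv_floorPt,
      floorSq_of_abs_le hx hv]
    ring
  refine ⟨-1, 0, -d, 1, (isNearestCusp_iff _ _ _).2 ⟨isCoprime_one_left.neg_left, ?_⟩,
    (isNearestCusp_iff _ _ _).2 ⟨isCoprime_one_right, ?_⟩, ?_⟩
  · rwa [neg_neg]
  · rw [neg_neg]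
    intro c' d' h'
    rw [h2]
    exact (isTop_iff _).1 h1 c' d' h'
  · simp

/-- The floor as part of the retract. -/
def floorX (x v : ℝ) : retractX := ⟨floorPt x v, floorPt_mem_retractX x v⟩

lemma continuous_floorX : Continuous fun q : ℝ × ℝ => floorX q.1 q.2 :=
  continuous_floorPt.subtype_mk _

instance : ContinuousConstSMul Bianchi retractX :=
  ⟨fun g => ((continuous_const_smul g).comp continuous_subtype_val).subtype_mk _⟩

/-- A point of the retract with `∞` nearest lies on the floor. -/
lemma ht_sq_eq_of_mem_retractX {p : UpperHalfSpace} (hp : p ∈ retractX) (ht : IsTop p) :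
    p.ht ^ 2 = floorSq p.px p.pv := by
  obtain ⟨l, m, l', m', h, h', hne⟩ := hp
  rw [isNearestCusp_iff] at h h'
  have key : ∀ l m : ℤ√(-2), IsCoprime l m → Near m (-l) p → m ≠ 0 →
      p.ht ^ 2 = floorSq p.px p.pv := by
    intro l m hlm hn hm
    have hco : IsCoprime m (-l) := hlm.symm.neg_right
    refine ht_sq_eq_of_quad_eq_one ht hco hm (le_antisymm ?_ ((isTop_iff p).1 ht _ _ hco))
    exact (hn 0 1 (isCoprime_zero_left.2 isUnit_one)).trans (quad_zero_one p).le
  by_cases hm : m = 0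
  · by_cases hm' : m' = 0
    · exact absurd (by rw [hm, hm', mul_zero, mul_zero]) hne
    · exact key l' m' h'.1 h'.2 hm'
  · exact key l m h.1 h.2 hm

lemma smul_eq_floorX {g : Bianchi} {p : retractX} (h : IsTop (g • p.1)) :
    g • p = floorX (g • p.1).px (g • p.1).pv :=
  Subtype.ext (eq_floorPt (ht_sq_eq_of_mem_retractX (retractX.smul_mem g p.2) h)).symm

/-- There is an equivariant map from the upper half-space to the retract. -/
lemma exists_retraction :
    ∃ r : C(UpperHalfSpace, retractX), ∀ (g : Bianchi) (p : UpperHalfSpace),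
      r (g • p) = g • r p := by
  obtain ⟨r, hr⟩ := exists_glue (Y := retractX)
    (fun g p => g⁻¹ • floorX p.px p.pv)
    (fun g => (continuous_const_smul g⁻¹).comp
      (continuous_floorX.comp (continuous_px.prodMk continuous_pv))) (by
    intro g k p hp hk
    have key : k • floorX p.px p.pv = floorX (k • p).px (k • p).pv := by
      -- If `k` fixes `∞`, it moves `z` independently of the height. Otherwise `p` has two nearest
      -- cusps and is already its own floor point.
      by_cases hc : k 1 0 = 0
      -- The floor height, with labels ignored, is itself a compatible family, so `k` preserves it.
      · have hfam : LabelCompat (Y := ℝ) fun _ _ x v => floorSq x v :=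
          ⟨fun _ _ x v => by simpa using floorSq_add_int x v 1 0,
            fun _ _ x v => by simpa using floorSq_add_int x v 0 1,
            fun _ _ x v _ _ => floorSq_neg x v⟩
        have h1 := quad_row_eq_one hp hk
        have h2 := respects_of_isTop hfam hp hk 0 0
        have h3 : quad (k 1 0) (k 1 1) (floorPt p.px p.pv) = 1 := by
          rw [quad_eq] at h1 ⊢
          simp only [hc] at h1 ⊢
          simpa [nrm] using h1
        refine Subtype.ext (ext_coord ?_ ?_ ?_)
        · change (k • floorPt p.px p.pv).px = (floorPt _ _).px
          rw [px_smul, px_floorPt, px_smul, h3, h1]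
          simp [hc]
        · change (k • floorPt p.px p.pv).pv = (floorPt _ _).pv
          rw [pv_smul, pv_floorPt, pv_smul, h3, h1]
          simp [hc]
        · change (k • floorPt p.px p.pv).ht = (floorPt _ _).ht
          rw [ht_smul, h3, div_one, ht_floorPt, ht_floorPt]
          exact congrArg Real.sqrt h2.symm
      · have h1 := quad_row_eq_one hp hk
        have h2 := ht_sq_eq_of_quad_eq_one hp (isCoprime_row k) hc h1
        have h3 : p ∈ retractX := eq_floorPt h2 ▸ floorPt_mem_retractX _ _
        have h4 : floorX p.px p.pv = ⟨p, h3⟩ := Subtype.ext (eq_floorPt h2)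
        rw [h4]
        exact smul_eq_floorX (p := ⟨p, h3⟩) hk
    rw [← key, mul_inv_rev, mul_smul, inv_smul_smul])
  refine ⟨r, fun g p => ?_⟩
  obtain ⟨k, hk⟩ := exists_isTop_smul p
  have e : (k * g⁻¹) • g • p = k • p := by rw [mul_smul, inv_smul_smul]
  rw [hr k p hk, hr (k * g⁻¹) (g • p) (by rwa [e]), e, mul_inv_rev, inv_inv, mul_smul]

end UpperHalfSpace

open UpperHalfSpace

/-! ### The map `J` -/

/-- The matrix `(0, 1; √-2, 0)`, scaled to determinant `1`, followed by the retraction, is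
equivariant along `j`. -/
lemma exists_equivariantAlong_jHom : ∃ J : C(retractX, retractX), EquivariantAlong jHom J := by
  obtain ⟨r, hr⟩ := exists_retraction
  -- The square of `s` is the determinant of `(0, 1; √-2, 0)`, so dividing by `s` lands in `SL₂(ℂ)`.
  obtain ⟨s, hs⟩ : ∃ s : ℂ, s ^ 2 = -toComplex Zsqrtd.sqrtd :=
    IsAlgClosed.exists_pow_nat_eq _ two_pos
  have hs0 : s ≠ 0 := by
    intro h
    have h1 : toComplex Zsqrtd.sqrtd = 0 := by
      rw [h] at hs
      linear_combination hs
    have h2 := congrArg Complex.im h1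
    rw [toComplex_im] at h2
    simp at h2
  let A : Matrix.SpecialLinearGroup (Fin 2) ℂ :=
    ⟨!![0, s⁻¹; toComplex Zsqrtd.sqrtd * s⁻¹, 0], by
      rw [Matrix.det_fin_two_of]
      field_simp
      linear_combination -hs⟩
  have hA : ∀ g : Gamma0, A * Matrix.SpecialLinearGroup.map (n := Fin 2) toComplex g.1 =
      Matrix.SpecialLinearGroup.map (n := Fin 2) toComplex (jHom g) * A := by
    intro g
    have hE : ∀ (g : Bianchi) i j, (Matrix.SpecialLinearGroup.map (n := Fin 2) toComplex g) i j =
      toComplex (g i j) := fun _ _ _ => rfl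
    have hg := congrArg toComplex (sqrtd_mul_divSqrt g.2)
    rw [map_mul] at hg
    have h00 : jHom g 0 0 = g.1 1 1 := rfl
    have h01 : jHom g 0 1 = divSqrt (g.1 1 0) := rfl
    have h10 : jHom g 1 0 = g.1 0 1 * Zsqrtd.sqrtd := rfl
    have h11 : jHom g 1 1 = g.1 0 0 := rfl
    have a00 : A 0 0 = 0 := rfl
    have a01 : A 0 1 = s⁻¹ := rfl
    have a10 : A 1 0 = toComplex Zsqrtd.sqrtd * s⁻¹ := rfl
    have a11 : A 1 1 = 0 := rfl
    apply Subtype.ext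
    refine Matrix.ext fun i j => ?_
    refine (mul_entry _ _ i j).trans (Eq.trans ?_ (mul_entry _ _ i j).symm)
    fin_cases i <;> fin_cases j <;>
      simp [hE, h00, h01, h10, h11, a00, a01, a10, a11]
    · linear_combination -s⁻¹ * hg
    · ring
    · ring
    · ring
  refine ⟨⟨fun p => r (A • p.1), r.continuous.comp
    ((continuous_smul_complex A).comp continuous_subtype_val)⟩, fun g p => ?_⟩
  change r (A • (Matrix.SpecialLinearGroup.map (n := Fin 2) toComplex g.1) • p.1) = _
  rw [← mul_smul, hA, mul_smul]
  exact hr (jHom g) (A • p.1)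

/-! ### The map of the quotient to the circle -/

lemma continuous_coe_circle : Continuous fun t : ℝ => (t : RModZ) := AddCircle.continuous_mk' 1

lemma coe_circle_add_one (x : ℝ) : ((x + 1 : ℝ) : RModZ) = (x : RModZ) :=
  AddCircle.coe_add_period 1 x

lemma exists_circleHeight : ∃ q : C(UpperHalfSpace, RModZ), ∀ (g : Bianchi) (p : UpperHalfSpace),
    IsTop (g • p) → q p = ((g • p).pv : RModZ) :=
  exists_glue_family (φ := fun _ _ _ v => (v : RModZ))
    ⟨fun _ _ _ _ => rfl, fun _ _ _ v => coe_circle_add_one v, fun _ _ _ _ _ _ => rfl⟩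
    fun _ _ => continuous_coe_circle.comp continuous_snd

/-- The invariant map to the circle: the imaginary coordinate of a representative on the floor. -/
def circleHeight : C(UpperHalfSpace, RModZ) := exists_circleHeight.choose

lemma circleHeight_eq {g : Bianchi} {p : UpperHalfSpace} (h : IsTop (g • p)) :
    circleHeight p = ((g • p).pv : RModZ) := exists_circleHeight.choose_spec g p h

lemma circleHeight_smul (g : Bianchi) (p : UpperHalfSpace) :
    circleHeight (g • p) = circleHeight p := by
  obtain ⟨k, hk⟩ := exists_isTop_smul p
  have e : (k * g⁻¹) • g • p = k • p := by rw [mul_smul, inv_smul_smul]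
  rw [circleHeight_eq hk, circleHeight_eq (g := k * g⁻¹) (by rwa [e]), e]

lemma circleHeight_floorPt (x v : ℝ) : circleHeight (floorPt x v) = (v : RModZ) := by
  rw [circleHeight_eq (g := 1) (by rw [one_smul]; exact isTop_floorPt x v), one_smul, pv_floorPt]

lemma convex_upperHalfSpace : Convex ℝ {p : ℂ × ℝ | 0 < p.2} :=
  (convex_Ioi (0 : ℝ)).linear_preimage (LinearMap.snd ℝ ℂ ℝ)

instance : SimplyConnectedSpace UpperHalfSpace := by
  have : ContractibleSpace {p : ℂ × ℝ // 0 < p.2} :=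
    convex_upperHalfSpace.contractibleSpace ⟨(0, 1), show (0 : ℝ) < 1 from one_pos⟩
  exact inferInstanceAs (SimplyConnectedSpace {p : ℂ × ℝ // 0 < p.2})

instance : LocallyPathConnectedSpace UpperHalfSpace :=
  convex_upperHalfSpace.locallyPathConnectedSpace

/-- A lift of `circleHeight` to the line. -/
def lineHeight : C(UpperHalfSpace, ℝ) := (exists_lift_to_line circleHeight).choose

lemma coe_lineHeight (p : UpperHalfSpace) : ((lineHeight p : ℝ) : RModZ) = circleHeight p :=
  (exists_lift_to_line circleHeight).choose_spec p

/-- Both sides lift the same invariant map to the circle and the half-space is connected, so the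
difference is one integer. It can then be computed at a single floor point. -/
lemma exists_lineHeight_smul (g : Bianchi) :
    ∃ k : ℤ, ∀ p, lineHeight (g • p) = lineHeight p + k :=
  exists_int_of_lifts (lineHeight.comp ⟨fun p => g • p, continuous_const_smul g⟩) lineHeight
    fun p => by
      rw [coe_lineHeight]
      change ((lineHeight (g • p) : ℝ) : RModZ) = _
      rw [coe_lineHeight, circleHeight_smul]

lemma exists_lineHeight_floorPt : ∃ k : ℤ, ∀ x v, lineHeight (floorPt x v) = v + k := by
  obtain ⟨k, hk⟩ := exists_int_of_lifts (A := ℝ × ℝ)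
    (lineHeight.comp ⟨_, continuous_floorPt⟩) ContinuousMap.snd fun q => by
      change ((lineHeight (floorPt q.1 q.2) : ℝ) : RModZ) = _
      rw [coe_lineHeight, circleHeight_floorPt]
      rfl
  exact ⟨k, fun x v => hk (x, v)⟩

lemma lineHeight_trans_smul (u : ℤ√(-2)) (p : UpperHalfSpace) :
    lineHeight (trans u • p) = lineHeight p + u.im := by
  obtain ⟨k, hk⟩ := exists_lineHeight_smul (trans u)
  obtain ⟨l, hl⟩ := exists_lineHeight_floorPt
  have h := hk (floorPt 0 0)
  rw [trans_smul_floorPt, hl, hl] at h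
  rw [hk]
  linarith

lemma lineHeight_matS_smul (p : UpperHalfSpace) : lineHeight (matS • p) = lineHeight p := by
  obtain ⟨k, hk⟩ := exists_lineHeight_smul matS
  have h := hk (floorPt 0 0)
  rw [matS_smul_floorPt (by norm_num) (by norm_num), neg_zero] at h
  rw [hk]
  linarith

lemma lineHeight_matS_inv_smul (p : UpperHalfSpace) : lineHeight (matS⁻¹ • p) = lineHeight p := by
  rw [← lineHeight_matS_smul (matS⁻¹ • p), smul_inv_smul]

lemma trans_mem_Gamma0 (u : ℤ√(-2)) : trans u ∈ Gamma0 :=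
  show trans u 1 0 ∈ Ideal.span {(Zsqrtd.sqrtd : ℤ√(-2))} by simp

/-- Translations as elements of `Γ₀(√-2)`. -/
def transG (u : ℤ√(-2)) : Gamma0 := ⟨trans u, trans_mem_Gamma0 u⟩

lemma jHom_transG (u : ℤ√(-2)) :
    jHom (transG u) = matS * trans (-(u * Zsqrtd.sqrtd)) * matS⁻¹ := by
  rw [eq_mul_inv_iff_mul_eq]
  have h00 : jHom (transG u) 0 0 = 1 := rfl
  have h01 : jHom (transG u) 0 1 = 0 := by
    change divSqrt 0 = 0
    rfl
  have h10 : jHom (transG u) 1 0 = u * Zsqrtd.sqrtd := rfl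
  have h11 : jHom (transG u) 1 1 = 1 := rfl
  apply bianchi_ext <;> simp only [mul_entry, h00, h01, h10, h11] <;> simp

/-- Conjugation does not affect the shift, and `-u√-2` has `√-2`-part `-u.re`. Thus `j` turns
horizontal translation by `1` into a loop of degree `-1` in the circle. -/
lemma lineHeight_jHom_transG_smul (u : ℤ√(-2)) (p : UpperHalfSpace) :
    lineHeight (jHom (transG u) • p) = lineHeight p - u.re := by
  rw [jHom_transG, mul_smul, mul_smul, lineHeight_matS_smul, lineHeight_trans_smul,
    lineHeight_matS_inv_smul]
  simp [sub_eq_add_neg]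

/-- The map of the quotient by the Bianchi group to the circle. -/
def quotToCircle : C(BianchiOrbitSpace, RModZ) where
  toFun := Quotient.lift (fun p : retractX => circleHeight p.1) (by
    rintro _ p ⟨g, rfl⟩
    exact circleHeight_smul g p.1)
  continuous_toFun := (circleHeight.continuous.comp continuous_subtype_val).quotient_lift _

/-- The class of a point of the retract modulo the Bianchi group. -/
def clsB (p : retractX) : BianchiOrbitSpace := Quotient.mk _ p

lemma continuous_clsB : Continuous clsB := continuous_quotient_mk'

lemma clsB_smul (g : Bianchi) (p : retractX) : clsB (g • p) = clsB p :=
  Quotient.sound ⟨g, rfl⟩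

lemma quotToCircle_clsB (p : retractX) : quotToCircle (clsB p) = circleHeight p.1 := rfl

lemma trans_smul_floorX (u : ℤ√(-2)) (x v : ℝ) :
    trans u • floorX x v = floorX (x + u.re) (v + u.im) := Subtype.ext (trans_smul_floorPt u x v)

lemma matS_smul_floorX {x v : ℝ} (hx : |x| ≤ 1 / 2) (hv : |v| ≤ 1 / 2) :
    matS • floorX x v = floorX (-x) v := Subtype.ext (matS_smul_floorPt hx hv)

lemma clsB_floorX_shift (x v : ℝ) (n m : ℤ) :
    clsB (floorX (x + n) (v + m)) = clsB (floorX x v) := by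
  rw [← clsB_smul (trans ⟨n, m⟩) (floorX x v), trans_smul_floorX]

lemma clsB_floorX_neg {x v : ℝ} (hx : |x| ≤ 1 / 2) :
    clsB (floorX (-x) v) = clsB (floorX x v) := by
  have e1 := clsB_floorX_shift (-x) v 0 (-round v)
  have e2 := clsB_floorX_shift x v 0 (-round v)
  have hv : |v + (-round v : ℤ)| ≤ 1 / 2 := by
    simpa [← sub_eq_add_neg] using abs_sub_round v
  rw [← e1, ← e2]
  simp only [Int.cast_zero, add_zero]
  rw [← matS_smul_floorX hx hv, clsB_smul]

/-- Translation and inversion bring `x` into `[0, 1/2]`; this is the cylinder coordinate of the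
quotient. -/
lemma clsB_floorX_intDist (x v : ℝ) : clsB (floorX (intDist x) v) = clsB (floorX x v) := by
  have e := clsB_floorX_shift x v (-round x) 0
  simp only [Int.cast_zero, add_zero, Int.cast_neg, ← sub_eq_add_neg] at e
  rw [← e, intDist_eq]
  rcases abs_cases (x - round x) with ⟨h, -⟩ | ⟨h, -⟩
  · rw [h]
  · rw [h, clsB_floorX_neg (abs_sub_round x)]

/-- The circle in the quotient by the Bianchi group. -/
def circleToQuot : C(RModZ, BianchiOrbitSpace) where
  toFun := Quotient.lift (fun v : ℝ => clsB (floorX 0 v)) (by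
    intro v w h
    obtain ⟨k, hk⟩ := AddSubgroup.mem_zmultiples_iff.1 (QuotientAddGroup.leftRel_apply.1 h)
    have := clsB_floorX_shift 0 v 0 k
    rw [← this]
    congr 2
    · simp
    · simp at hk
      rw [hk]
      ring)
  continuous_toFun := (continuous_clsB.comp (continuous_floorX.comp
    (continuous_const.prodMk continuous_id))).quotient_lift _

lemma circleToQuot_coe (v : ℝ) : circleToQuot (v : RModZ) = clsB (floorX 0 v) := rfl

lemma quotToCircle_comp_circleToQuot : quotToCircle.comp circleToQuot = .id _ := by
  ext v
  obtain ⟨v, rfl⟩ := QuotientAddGroup.mk_surjective v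
  exact circleHeight_floorPt 0 v

open unitInterval in
-- The homotopy contracts the interval factor of the cylinder by scaling `intDist x` with `t`.
lemma circleToQuot_comp_quotToCircle :
    (circleToQuot.comp quotToCircle).Homotopic (.id BianchiOrbitSpace) := by
  have hcont : Continuous fun q : (ℝ × ℝ) × I => ((q.2 : ℝ) * intDist q.1.1, q.1.2) := by
    have := continuous_intDist
    fun_prop
  let H : C((ℝ × ℝ) × I, BianchiOrbitSpace) :=
    ⟨fun q => clsB (floorX (q.2 * intDist q.1.1) q.1.2),
      continuous_clsB.comp (continuous_floorX.comp hcont)⟩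
  have hH : ∀ (x v : ℝ) (t : I), H.curry (x, v) t = clsB (floorX (t * intDist x) v) :=
    fun _ _ _ => rfl
  -- The homotopy is glued as a map into the path space `C(I, -)`, so that it descends to the
  -- quotient without considering the product of a quotient with `I`.
  obtain ⟨Φ, hΦ⟩ := exists_glue_family (φ := fun _ _ x v => H.curry (x, v))
    ⟨fun _ _ x v => by
        ext t
        have := intDist_add_int x 1
        rw [Int.cast_one] at this
        rw [hH, hH, this],
      fun _ _ x v => by
        ext t
        have := clsB_floorX_shift (t * intDist x) v 0 1
        simp only [Int.cast_one, Int.cast_zero, add_zero] at this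
        rw [hH, hH, this],
      fun _ _ x v _ _ => by
        ext t
        rw [hH, hH, intDist_neg]⟩
    fun _ _ => H.curry.continuous
  have hinv : ∀ (g : Bianchi) (p : UpperHalfSpace), Φ (g • p) = Φ p := by
    intro g p
    obtain ⟨k, hk⟩ := exists_isTop_smul p
    have e : (k * g⁻¹) • g • p = k • p := by rw [mul_smul, inv_smul_smul]
    rw [hΦ k p hk, hΦ (k * g⁻¹) (g • p) (by rwa [e]), e]
  let Ψ : C(BianchiOrbitSpace, C(I, BianchiOrbitSpace)) :=
    ⟨Quotient.lift (fun p : retractX => Φ p.1) (by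
      rintro _ p ⟨g, rfl⟩
      exact hinv g p.1), (Φ.continuous.comp continuous_subtype_val).quotient_lift _⟩
  have hΨ : ∀ p : retractX, Ψ (clsB p) = Φ p.1 := fun _ => rfl
  refine ⟨⟨Ψ.uncurry.comp ContinuousMap.prodSwap, fun P => ?_, fun P => ?_⟩⟩
  · obtain ⟨p, rfl⟩ := Quotient.exists_rep P
    obtain ⟨k, hk⟩ := exists_isTop_smul p.1
    change Ψ (clsB p) 0 = circleToQuot (quotToCircle (clsB p))
    rw [hΨ, hΦ k p.1 hk, hH, quotToCircle_clsB, circleHeight_eq hk, circleToQuot_coe]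
    simp
  · obtain ⟨p, rfl⟩ := Quotient.exists_rep P
    obtain ⟨k, hk⟩ := exists_isTop_smul p.1
    change Ψ (clsB p) 1 = clsB p
    rw [hΨ, hΦ k p.1 hk, hH, ← clsB_smul k p, smul_eq_floorX hk]
    simp [clsB_floorX_intDist]

lemma map_quotToCircle_bijective (n : ℕ) :
    Function.Bijective (SingularCohomology.map n quotToCircle) :=
  SingularCohomology.map_bijective_of_homotopic n _ circleToQuot circleToQuot_comp_quotToCircle
    (by rw [quotToCircle_comp_circleToQuot])

/-! ### The quotient by `Γ₀(√-2)` is homotopy equivalent to a torus -/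

lemma exists_torus_descend {Y : Type} [TopologicalSpace Y] (f : C(ℝ × ℝ, Y))
    (h1 : ∀ x v, f (x + 1, v) = f (x, v)) (h2 : ∀ x v, f (x, v + 1) = f (x, v)) :
    ∃ F : C(RModZ × RModZ, Y), ∀ x v : ℝ, F ((x : RModZ), (v : RModZ)) = f (x, v) := by
  have hq : IsOpenQuotientMap (Prod.map (QuotientAddGroup.mk : ℝ → RModZ)
      (QuotientAddGroup.mk : ℝ → RModZ)) :=
    QuotientAddGroup.isOpenQuotientMap_mk.prodMap QuotientAddGroup.isOpenQuotientMap_mk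
  have p1 : ∀ v, Function.Periodic (fun x => f (x, v)) 1 := fun v x => h1 x v
  have p2 : ∀ x, Function.Periodic (fun v => f (x, v)) 1 := fun x v => h2 x v
  have key : ∀ x y : ℝ, (x : RModZ) = (y : RModZ) → ∃ n : ℤ, y = x + n := by
    intro x y h
    obtain ⟨k, hk⟩ := AddSubgroup.mem_zmultiples_iff.1 (QuotientAddGroup.eq.1 h)
    refine ⟨k, ?_⟩
    simp at hk
    rw [hk]
    ring
  let q : C(ℝ × ℝ, RModZ × RModZ) := ⟨_, hq.continuous⟩
  have hf : Function.FactorsThrough f q := by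
    rintro ⟨x, v⟩ ⟨y, w⟩ h
    obtain ⟨n, rfl⟩ := key x y (congrArg Prod.fst h)
    obtain ⟨m, rfl⟩ := key v w (congrArg Prod.snd h)
    have e1 := (p1 (v + m)).int_mul n x
    have e2 := (p2 x).int_mul m v
    simp only [mul_one] at e1 e2
    exact (e1.trans e2).symm
  exact ⟨hq.isQuotientMap.lift (f := q) f hf, fun x v =>
    congrArg (fun F : C(ℝ × ℝ, Y) => F (x, v)) (hq.isQuotientMap.lift_comp (f := q) f hf)⟩

lemma mem_Gamma0_iff (g : Bianchi) : g ∈ Gamma0 ↔ red (g 1 0) = 0 := by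
  change g 1 0 ∈ Ideal.span {(Zsqrtd.sqrtd : ℤ√(-2))} ↔ _
  rw [Ideal.mem_span_singleton]
  constructor
  · rintro ⟨t, ht⟩
    rw [ht, map_mul]
    simp [red_apply]
  · intro hc
    refine ⟨divSqrt (g 1 0), ?_⟩
    rw [red_apply, ZMod.intCast_zmod_eq_zero_iff_dvd] at hc
    ext <;> simp [divSqrt]
    omega

/-- The class of a point of the retract modulo `Γ₀(√-2)`. -/
def clsG (p : retractX) : Gamma0OrbitSpace := Quotient.mk _ p

lemma continuous_clsG : Continuous clsG := continuous_quotient_mk'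

lemma clsG_smul {g : Bianchi} (hg : g ∈ Gamma0) (p : retractX) : clsG (g • p) = clsG p :=
  Quotient.sound ⟨(⟨g, hg⟩ : Gamma0), rfl⟩

/-- The translate of the floor by `g⁻¹`, modulo `Γ₀(√-2)`. -/
def sheet (g : Bianchi) (x v : ℝ) : Gamma0OrbitSpace := clsG (g⁻¹ • floorX x v)

lemma continuous_sheet (g : Bianchi) : Continuous fun q : ℝ × ℝ => sheet g q.1 q.2 :=
  continuous_clsG.comp ((continuous_const_smul g⁻¹).comp continuous_floorX)

/-- The lower left entry of `h⁻¹ * g` is the determinant of the two first columns, so columns equal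
modulo `√-2` give the same coset `gΓ₀(√-2)`. -/
lemma sheet_congr {g h : Bianchi} (h0 : red (g 0 0) = red (h 0 0)) (h1 : red (g 1 0) = red (h 1 0))
    (x v : ℝ) : sheet g x v = sheet h x v := by
  have hm : h⁻¹ * g ∈ Gamma0 := by
    rw [mem_Gamma0_iff, mul_entry, Matrix.SpecialLinearGroup.SL2_inv_expl]
    simp [h0, h1]
    rw [mul_comm, CharTwo.add_self_eq_zero]
  unfold sheet
  rw [← clsG_smul hm, smul_smul, mul_assoc, mul_inv_cancel, mul_one]

lemma sheet_shift {g h : Bianchi} (n m : ℤ) (h0 : red (g 0 0) = red (h 0 0) + n * red (h 1 0))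
    (h1 : red (g 1 0) = red (h 1 0)) (x v : ℝ) :
    sheet g (x + n) (v + m) = sheet h x v := by
  rw [sheet_congr (h := UpperHalfSpace.trans ⟨n, m⟩ * h)]
  · have := trans_smul_floorX ⟨n, m⟩ x v
    unfold sheet
    rw [← this, mul_inv_rev, mul_smul, inv_smul_smul]
  · have hr : red (⟨n, m⟩ : ℤ√(-2)) = n := red_apply _
    simp [mul_entry, h0, hr]
  · simp [mul_entry, h1]

lemma sheet_add_one (g : Bianchi) (x v : ℝ) : sheet g x (v + 1) = sheet g x v := by
  simpa using sheet_shift (g := g) (h := g) 0 1 (by simp) rfl x v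

lemma sheet_flip {g h : Bianchi} (h0 : red (g 0 0) = red (h 1 0)) (h1 : red (g 1 0) = red (h 0 0))
    {x : ℝ} (hx : |x| ≤ 1 / 2) (v : ℝ) : sheet g (-x) v = sheet h x v := by
  have key : ∀ v : ℝ, |v| ≤ 1 / 2 → sheet g (-x) v = sheet h x v := by
    intro v hv
    rw [sheet_congr (h := matS * h)]
    · unfold sheet
      rw [← matS_smul_floorX hx hv, mul_inv_rev, mul_smul, inv_smul_smul]
    · simp [mul_entry, h0, ZMod.neg_eq_self_mod_two]
    · simp [mul_entry, h1]
  -- The inversion is only available for `|v| ≤ 1/2`; vertical translation, which fixes the label,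
  -- removes this restriction.
  have e1 := sheet_shift (g := g) (h := g) 0 (-round v) (by simp) rfl (-x) v
  have e2 := sheet_shift (g := h) (h := h) 0 (-round v) (by simp) rfl x v
  have hv : |v + (-round v : ℤ)| ≤ 1 / 2 := by
    simpa [← sub_eq_add_neg] using abs_sub_round v
  rw [← e1, ← e2]
  simp only [Int.cast_zero, add_zero]
  exact key _ hv

lemma clsG_eq_sheet {g : Bianchi} {p : retractX} (h : IsTop (g • p.1)) :
    clsG p = sheet g (g • p.1).px (g • p.1).pv := by
  unfold sheet
  rw [← smul_eq_floorX h, inv_smul_smul]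

lemma exists_torusToQuot : ∃ F : C(RModZ × RModZ, Gamma0OrbitSpace),
    ∀ x v : ℝ, F ((x : RModZ), (v : RModZ)) = sheet 1 x v :=
  exists_torus_descend ⟨fun q : ℝ × ℝ => sheet 1 q.1 q.2, continuous_sheet 1⟩
    (fun x v => by simpa using sheet_shift (g := 1) (h := 1) 1 0 (by simp) rfl x v)
    (fun x v => sheet_add_one 1 x v)

/-- The torus in the quotient by `Γ₀(√-2)`, formed by the floor. -/
def torusToQuot : C(RModZ × RModZ, Gamma0OrbitSpace) := exists_torusToQuot.choose

lemma torusToQuot_coe (x v : ℝ) : torusToQuot ((x : RModZ), (v : RModZ)) = sheet 1 x v :=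
  exists_torusToQuot.choose_spec x v

lemma torusToQuot_eq_clsG (x v : ℝ) :
    torusToQuot ((x : RModZ), (v : RModZ)) = clsG (floorX x v) := by
  rw [torusToQuot_coe, sheet, inv_one, one_smul]

/-- The piecewise linear function that is the identity on `[-1/2, 1/2]`, constant on
`[1/2, 3/2]`, and grows by `1` under the shift by `2`. -/
def stair (x : ℝ) : ℝ := x / 2 + Real.arcsin (Real.sin (Real.pi * x)) / (2 * Real.pi)

/-- The distance to the nearest even integer. -/
def evenDist (x : ℝ) : ℝ := 2 * intDist (x / 2)

lemma continuous_stair : Continuous stair := by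
  unfold stair
  fun_prop

lemma continuous_evenDist : Continuous evenDist :=
  continuous_const.mul (continuous_intDist.comp (continuous_id.div_const 2))

lemma stair_neg (x : ℝ) : stair (-x) = -stair x := by
  unfold stair
  rw [mul_neg, Real.sin_neg, Real.arcsin_neg]
  ring

lemma evenDist_neg (x : ℝ) : evenDist (-x) = evenDist x := by
  rw [evenDist, neg_div, intDist_neg, evenDist]

lemma stair_add_two_mul (x : ℝ) (k : ℤ) : stair (x + 2 * k) = stair x + k := by
  unfold stair
  have : Real.pi * (x + 2 * k) = Real.pi * x + k * (2 * Real.pi) := by ring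
  rw [this, Real.sin_add_int_mul_two_pi]
  ring

lemma evenDist_add_two_mul (x : ℝ) (k : ℤ) : evenDist (x + 2 * k) = evenDist x := by
  have : (x + 2 * k) / 2 = x / 2 + k := by ring
  rw [evenDist, this, intDist_add_int, evenDist]

lemma stair_of_abs_le {x : ℝ} (hx : |x| ≤ 1 / 2) : stair x = x := by
  have hpi := Real.pi_pos
  have := abs_le.1 hx
  unfold stair
  rw [Real.arcsin_sin (by nlinarith) (by nlinarith)]
  field_simp
  ring

lemma stair_one_add {x : ℝ} (hx : |x| ≤ 1 / 2) : stair (1 + x) = 1 / 2 := by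
  have hpi := Real.pi_pos
  have := abs_le.1 hx
  unfold stair
  have e : Real.sin (Real.pi * (1 + x)) = Real.sin (-(Real.pi * x)) := by
    rw [mul_add, mul_one, add_comm, Real.sin_add_pi, Real.sin_neg]
  rw [e, Real.arcsin_sin (by nlinarith) (by nlinarith)]
  field_simp
  ring

lemma evenDist_of_abs_le {x : ℝ} (hx : |x| ≤ 1 / 2) : evenDist x = |x| := by
  have h2 : |x / 2| = |x| / 2 := by rw [abs_div, abs_two]
  rw [evenDist, intDist_of_abs_le (by rw [h2]; linarith), h2]
  ring

lemma evenDist_one_add {x : ℝ} (hx : |x| ≤ 1 / 2) : evenDist (1 + x) = 1 - |x| := by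
  have h := abs_le.1 hx
  rcases abs_cases x with ⟨h1, h2⟩ | ⟨h1, h2⟩
  · have e := evenDist_add_two_mul (1 + x) (-1)
    rw [← e, evenDist, intDist_of_abs_le]
    · push_cast
      rw [abs_of_nonpos (by linarith), h1]
      ring
    · push_cast
      rw [abs_le]
      constructor <;> linarith
  · rw [evenDist, intDist_of_abs_le]
    · rw [abs_of_nonneg (by linarith), h1]
      ring
    · rw [abs_le]
      constructor <;> linarith

/-- Every real number is within `1/2` of an even or of an odd integer. -/
lemma exists_near_even_or_odd (x : ℝ) :
    (∃ (k : ℤ) (y : ℝ), |y| ≤ 1 / 2 ∧ x = y + 2 * k) ∨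
      ∃ (k : ℤ) (y : ℝ), |y| ≤ 1 / 2 ∧ x = 1 + y + 2 * k := by
  have h := abs_sub_round x
  rcases Int.even_or_odd' (round x) with ⟨k, hk | hk⟩
  · refine .inl ⟨k, x - round x, h, ?_⟩
    rw [hk]
    push_cast
    ring
  · refine .inr ⟨k, x - round x, h, ?_⟩
    rw [hk]
    push_cast
    ring

lemma coe_circle_add_int (x : ℝ) (k : ℤ) : ((x + k : ℝ) : RModZ) = (x : RModZ) := by
  simp

/-- A matrix for each column over `𝔽₂`; the value at `0` is irrelevant. -/
def labelRep (a c : ZMod 2) : Bianchi :=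
  if c = 0 then 1 else if a = 0 then matS else UpperHalfSpace.trans 1 * matS

lemma red_labelRep {a c : ZMod 2} (h : a ≠ 0 ∨ c ≠ 0) :
    red (labelRep a c 0 0) = a ∧ red (labelRep a c 1 0) = c := by
  revert a c
  have h10 : red (labelRep 1 0 0 0) = 1 ∧ red (labelRep 1 0 1 0) = 0 := by
    simp [labelRep]
  have h01 : red (labelRep 0 1 0 0) = 0 ∧ red (labelRep 0 1 1 0) = 1 := by
    simp [labelRep]
  have h11 : red (labelRep 1 1 0 0) = 1 ∧ red (labelRep 1 1 1 0) = 1 := by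
    simp [labelRep, mul_entry]
  intro a c h
  fin_cases a <;> fin_cases c
  · exact absurd rfl (h.elim id id)
  · exact h01
  · exact h10
  · exact h11

lemma red_col_ne_zero (g : Bianchi) : red (g 0 0) ≠ 0 ∨ red (g 1 0) ≠ 0 := by
  by_contra! h
  have := congrArg red (bianchi_det g)
  simp [h.1, h.2] at this

lemma clsG_eq_sheet_labelRep {g : Bianchi} {p : retractX} (h : IsTop (g • p.1)) :
    clsG p = sheet (labelRep (red (g 0 0)) (red (g 1 0))) (g • p.1).px (g • p.1).pv := by
  have hr := red_labelRep (red_col_ne_zero g)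
  rw [clsG_eq_sheet h, sheet_congr hr.1.symm hr.2.symm]

/-- The first column of an element of `Γ₀(√-2)` is `(1, 0)` modulo `√-2`. So labels are invariants
of the orbit. -/
lemma red_mul_inv_of_mem_Gamma0 {g : Bianchi} (hg : g ∈ Gamma0) (k : Bianchi) :
    red ((k * g⁻¹) 0 0) = red (k 0 0) ∧ red ((k * g⁻¹) 1 0) = red (k 1 0) := by
  have h0 := (mem_Gamma0_iff g⁻¹).1 (inv_mem hg)
  have h1 : red (g⁻¹ 0 0) = 1 := by
    have h2 := red_col_ne_zero g⁻¹
    rw [h0] at h2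
    generalize red (g⁻¹ 0 0) = a at h2 ⊢
    revert a
    decide
  simp only [mul_entry, map_add, map_mul, h0, h1, mul_one, mul_zero, add_zero, and_self]

/-- A compatible family on the floor defines a map on the quotient by `Γ₀(√-2)`. -/
lemma exists_quot_map {Y : Type} [TopologicalSpace Y] {φ : ZMod 2 → ZMod 2 → ℝ → ℝ → Y}
    (hφ : LabelCompat φ) (hc : ∀ a c, Continuous fun q : ℝ × ℝ => φ a c q.1 q.2) :
    ∃ Φ : C(Gamma0OrbitSpace, Y), ∀ (g : Bianchi) (p : retractX), IsTop (g • p.1) →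
      Φ (clsG p) = φ (red (g 0 0)) (red (g 1 0)) (g • p.1).px (g • p.1).pv := by
  obtain ⟨Φ, hΦ⟩ := exists_glue_family hφ hc
  have hinv : ∀ g ∈ Gamma0, ∀ p : UpperHalfSpace, Φ (g • p) = Φ p := by
    intro g hg p
    obtain ⟨k, hk⟩ := exists_isTop_smul p
    have e : (k * g⁻¹) • g • p = k • p := by rw [mul_smul, inv_smul_smul]
    have hr := red_mul_inv_of_mem_Gamma0 hg k
    rw [hΦ k p hk, hΦ (k * g⁻¹) (g • p) (by rwa [e]), e, hr.1, hr.2]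
  exact ⟨⟨Quotient.lift (fun p : retractX => Φ p.1) (by
    rintro _ p ⟨g, rfl⟩
    exact hinv g.1 g.2 p.1), (Φ.continuous.comp continuous_subtype_val).quotient_lift _⟩,
    fun g p h => hΦ g p.1 h⟩

/-- The coordinate along the first circle of the torus, on the floor with label `(a, c)`. -/
def stairCoord (a c : ZMod 2) (x : ℝ) : ℝ :=
  -- The label `(0, 0)` never occurs; the constant value `0` makes the compatibility laws hold for
  -- it too.
  if c = 0 then if a = 0 then 0 else x else if a = 0 then -stair x else -stair (x - 1)

lemma continuous_stairCoord (a c : ZMod 2) : Continuous (stairCoord a c) := by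
  have := continuous_stair
  unfold stairCoord
  split_ifs <;> fun_prop

lemma stair_coe_add_two (x : ℝ) : (stair (x + 2) : RModZ) = (stair x : RModZ) := by
  have := stair_add_two_mul x 1
  rw [Int.cast_one, mul_one] at this
  rw [this, coe_circle_add_one]

lemma stair_sub_one_eq {x : ℝ} (hx : |x| ≤ 1 / 2) : (stair (x - 1) : RModZ) = ((1 / 2 : ℝ) : RModZ) := by
  rw [← stair_coe_add_two, ← stair_one_add hx]
  congr 2
  ring

/-- The labels `(0,1)` and `(1,1)` share one strip of period 2. The staircase agrees with the torus
coordinate where the inversion glues them, up to its sign. On the folded half it is constant modulo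
1, hence invariant under the fold. -/
lemma labelCompat_stairCoord :
    LabelCompat fun a c x (_ : ℝ) => (stairCoord a c x : RModZ) := by
  refine ⟨?_, fun _ _ _ _ => rfl, ?_⟩
  · intro a c x v
    fin_cases a <;> fin_cases c
    · rfl
    · change ((-stair (x + 1 - 1) : ℝ) : RModZ) = ((-stair x : ℝ) : RModZ)
      rw [add_sub_cancel_right]
    · exact coe_circle_add_one x
    · change ((-stair (x + 1) : ℝ) : RModZ) = ((-stair (x - 1) : ℝ) : RModZ)
      rw [AddCircle.coe_neg, AddCircle.coe_neg, ← stair_coe_add_two (x - 1)]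
      congr 3
      ring
  · intro a c x v hx hv
    fin_cases a <;> fin_cases c
    · rfl
    · change ((-x : ℝ) : RModZ) = ((-stair x : ℝ) : RModZ)
      rw [stair_of_abs_le hx]
    · change ((-stair (-x) : ℝ) : RModZ) = (x : RModZ)
      rw [stair_of_abs_le (by rwa [abs_neg]), neg_neg]
    · change ((-stair (-x - 1) : ℝ) : RModZ) = ((-stair (x - 1) : ℝ) : RModZ)
      rw [AddCircle.coe_neg, AddCircle.coe_neg, stair_sub_one_eq hx,
        stair_sub_one_eq (by rwa [abs_neg])]

lemma exists_quotToTorus : ∃ Φ : C(Gamma0OrbitSpace, RModZ × RModZ), ∀ (g : Bianchi)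
    (p : retractX), IsTop (g • p.1) → Φ (clsG p) =
      ((stairCoord (red (g 0 0)) (red (g 1 0)) (g • p.1).px : RModZ), ((g • p.1).pv : RModZ)) := by
  have h := labelCompat_stairCoord
  refine exists_quot_map
    (φ := fun a c x v => ((stairCoord a c x : RModZ), (v : RModZ))) ⟨?_, ?_, ?_⟩ ?_
  · exact fun a c x v => Prod.ext (h.shift_one a c x v) rfl
  · exact fun a c x v => Prod.ext rfl (coe_circle_add_one v)
  · exact fun a c x v hx hv => Prod.ext (h.flip a c x v hx hv) rfl
  · exact fun a c => (continuous_coe_circle.comp ((continuous_stairCoord a c).comp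
      continuous_fst)).prodMk (continuous_coe_circle.comp continuous_snd)

/-- The map from the quotient by `Γ₀(√-2)` to the torus. -/
def quotToTorus : C(Gamma0OrbitSpace, RModZ × RModZ) := exists_quotToTorus.choose

lemma quotToTorus_clsG {g : Bianchi} {p : retractX} (h : IsTop (g • p.1)) :
    quotToTorus (clsG p) =
      ((stairCoord (red (g 0 0)) (red (g 1 0)) (g • p.1).px : RModZ), ((g • p.1).pv : RModZ)) :=
  exists_quotToTorus.choose_spec g p h

lemma quotToTorus_comp_torusToQuot : quotToTorus.comp torusToQuot = .id _ := by
  ext1 ⟨x, v⟩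
  obtain ⟨x, rfl⟩ := QuotientAddGroup.mk_surjective x
  obtain ⟨v, rfl⟩ := QuotientAddGroup.mk_surjective v
  change quotToTorus (torusToQuot ((x : RModZ), (v : RModZ))) = _
  rw [torusToQuot_eq_clsG, quotToTorus_clsG (g := 1)
    (by rw [one_smul]; exact isTop_floorPt x v), one_smul]
  change ((stairCoord _ _ (floorPt x v).px : RModZ), ((floorPt x v).pv : RModZ)) = _
  rw [px_floorPt, pv_floorPt]
  have : stairCoord (red ((1 : Bianchi) 0 0)) (red ((1 : Bianchi) 1 0)) x = x := by
    simp [stairCoord]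
  rw [this]
  rfl

/-- This is the seam along which the folded half of the strip is attached to the torus. -/
lemma sheet_half (v : ℝ) :
    sheet (labelRep 1 1) (1 / 2) v = torusToQuot (((1 / 2 : ℝ) : RModZ), (v : RModZ)) := by
  have r11 := red_labelRep (a := 1) (c := 1) (by simp)
  have r01 := red_labelRep (a := 0) (c := 1) (by simp)
  have e1 := sheet_shift (g := labelRep 1 1) (h := labelRep 0 1) 1 0
    (by simp [r11, r01]) (by simp [r11, r01]) (-(1 / 2)) v
  have e2 := sheet_flip (g := labelRep 0 1) (h := 1) (by simp [r01]) (by simp [r01])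
    (x := 1 / 2) (by norm_num) v
  rw [torusToQuot_coe, ← e2, ← e1]
  norm_num

/-- The deformation of the floors that do not belong to the torus: one half of the strips is
part of the torus, the other half is folded and is pushed to its boundary. -/
def stripMap (x v t : ℝ) : Gamma0OrbitSpace :=
  if evenDist x ≤ 1 / 2 then torusToQuot (-(stair x : RModZ), (v : RModZ))
  else sheet (labelRep 1 1) (t * (1 - evenDist x) + (1 - t) * (1 / 2)) v

lemma neg_coe_half : -((1 / 2 : ℝ) : RModZ) = ((1 / 2 : ℝ) : RModZ) := by
  rw [← AddCircle.coe_neg, ← coe_circle_add_one]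
  norm_num

lemma stair_of_half_le {x : ℝ} (h : 1 / 2 ≤ evenDist x) :
    (stair x : RModZ) = ((1 / 2 : ℝ) : RModZ) := by
  rcases exists_near_even_or_odd x with ⟨k, y, hy, rfl⟩ | ⟨k, y, hy, rfl⟩
  · rw [evenDist_add_two_mul, evenDist_of_abs_le hy] at h
    rw [stair_add_two_mul, stair_of_abs_le hy, coe_circle_add_int]
    rcases abs_cases y with ⟨h1, -⟩ | ⟨h1, -⟩
    · rw [show y = 1 / 2 by linarith]
    · rw [show y = -(1 / 2) by linarith, AddCircle.coe_neg, neg_coe_half]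
  · rw [stair_add_two_mul, stair_one_add hy, coe_circle_add_int]

lemma stripMap_of_half_le {x : ℝ} (h : 1 / 2 ≤ evenDist x) (v t : ℝ) :
    stripMap x v t = sheet (labelRep 1 1) (t * (1 - evenDist x) + (1 - t) * (1 / 2)) v := by
  unfold stripMap
  split_ifs with h'
  · have : evenDist x = 1 / 2 := le_antisymm h' h
    rw [stair_of_half_le h, neg_coe_half, ← sheet_half, this]
    congr 1
    ring
  · rfl

lemma continuous_stripMap :
    Continuous fun q : (ℝ × ℝ) × unitInterval => stripMap q.1.1 q.1.2 q.2 := by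
  have hs := continuous_stair
  have he := continuous_evenDist
  have hx : Continuous fun q : (ℝ × ℝ) × unitInterval => q.1.1 := by fun_prop
  have hv : Continuous fun q : (ℝ × ℝ) × unitInterval => q.1.2 := by fun_prop
  have h1 : Continuous fun q : (ℝ × ℝ) × unitInterval =>
      (-(stair q.1.1 : RModZ), (q.1.2 : RModZ)) :=
    (continuous_neg.comp (continuous_coe_circle.comp (hs.comp hx))).prodMk
      (continuous_coe_circle.comp hv)
  have h2 : Continuous fun q : (ℝ × ℝ) × unitInterval =>
      ((q.2 : ℝ) * (1 - evenDist q.1.1) + (1 - (q.2 : ℝ)) * (1 / 2), q.1.2) := by fun_prop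
  have h3 := torusToQuot.continuous.comp h1
  have h4 := (continuous_sheet (labelRep 1 1)).comp h2
  unfold stripMap
  refine Continuous.if_le h3 h4 (he.comp hx) continuous_const ?_
  · intro q hq
    rw [← stripMap_of_half_le hq.ge, stripMap, if_pos hq.le]

lemma stripMap_zero (x v : ℝ) :
    stripMap x v 0 = torusToQuot (-(stair x : RModZ), (v : RModZ)) := by
  by_cases h : evenDist x ≤ 1 / 2
  · rw [stripMap, if_pos h]
  · have h' := (not_le.1 h).le
    rw [stripMap_of_half_le h', stair_of_half_le h', neg_coe_half, ← sheet_half]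
    congr 1
    ring

/-- Near even integers the inversion identifies the strip with the torus. Near odd integers the fold
identifies `y` with `|y|`, which is `1 - evenDist` there. -/
lemma stripMap_one (x v : ℝ) : stripMap x v 1 = sheet (labelRep 0 1) x v := by
  have r11 := red_labelRep (a := 1) (c := 1) (by simp)
  have r01 := red_labelRep (a := 0) (c := 1) (by simp)
  have h2 : ∀ k : ℤ, ((2 * k : ℤ) : ZMod 2) = 0 := fun k =>
    (ZMod.intCast_zmod_eq_zero_iff_dvd _ 2).2 ⟨k, rfl⟩
  rcases exists_near_even_or_odd x with ⟨k, y, hy, rfl⟩ | ⟨k, y, hy, rfl⟩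
  · have e1 := sheet_shift (g := labelRep 0 1) (h := labelRep 0 1) (2 * k) 0
      (by rw [h2]; simp) rfl y v
    have e2 := sheet_flip (g := 1) (h := labelRep 0 1) (by simp [r01]) (by simp [r01]) hy v
    rw [stripMap, if_pos (by rwa [evenDist_add_two_mul, evenDist_of_abs_le hy]),
      stair_add_two_mul, coe_circle_add_int, stair_of_abs_le hy, ← AddCircle.coe_neg,
      torusToQuot_coe, e2, ← e1]
    push_cast
    rw [add_zero]
  · have hd : evenDist (1 + y + 2 * k) = 1 - |y| := by
      rw [evenDist_add_two_mul, evenDist_one_add hy]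
    have e1 := sheet_shift (g := labelRep 0 1) (h := labelRep 1 1) (2 * k + 1) 0
      (by rw [Int.cast_add, h2, r01.1, r11.1, r11.2]; decide) (by rw [r01.2, r11.2]) y v
    have e2 := sheet_flip (g := labelRep 1 1) (h := labelRep 1 1) (by simp [r11]) (by simp [r11])
      hy v
    rw [stripMap_of_half_le (by rw [hd]; linarith), hd]
    have e3 : (1 : ℝ) * (1 - (1 - |y|)) + (1 - 1) * (1 / 2) = |y| := by ring
    have e4 : sheet (labelRep 1 1) |y| v = sheet (labelRep 1 1) y v := by
      rcases abs_cases y with ⟨h, -⟩ | ⟨h, -⟩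
      · rw [h]
      · rw [h, e2]
    rw [e3, e4, ← e1]
    push_cast
    congr 1
    · ring
    · ring

lemma stripMap_congr {x y : ℝ} (h : evenDist x = evenDist y)
    (hs : (stair x : RModZ) = (stair y : RModZ)) {v w : ℝ} (hv : v = w ∨ v = w + 1) (t : ℝ) :
    stripMap x v t = stripMap y w t := by
  unfold stripMap
  rcases hv with rfl | rfl
  · rw [h, hs]
  · rw [h, hs, coe_circle_add_one, sheet_add_one]

open unitInterval in
-- The homotopy rests on the torus sheet and slides the folded collar to its seam by `stripMap` on
-- the other two labels.
lemma torusToQuot_comp_quotToTorus :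
    (torusToQuot.comp quotToTorus).Homotopic (.id Gamma0OrbitSpace) := by
  let H : C((ℝ × ℝ) × I, Gamma0OrbitSpace) := ⟨_, continuous_stripMap⟩
  have hH : ∀ (x v : ℝ) (t : I), H.curry (x, v) t = stripMap x v t := fun _ _ _ => rfl
  let C : C((ℝ × ℝ) × I, Gamma0OrbitSpace) :=
    ⟨fun q => sheet 1 q.1.1 q.1.2, (continuous_sheet 1).comp continuous_fst⟩
  have hC : ∀ (x v : ℝ) (t : I), C.curry (x, v) t = torusToQuot ((x : RModZ), (v : RModZ)) :=
    fun x v _ => (torusToQuot_coe x v).symm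
  -- The labels `(0,1)` and `(1,1)` use the same strip at `x` and `x - 1`. The unused label `(0,0)`
  -- gets a path independent of `x`, as compatibility requires.
  let φ : ZMod 2 → ZMod 2 → ℝ → ℝ → C(I, Gamma0OrbitSpace) := fun a c x v =>
    if c = 0 then C.curry (stairCoord a c x, v) else H.curry (if a = 0 then x else x - 1, v)
  have hφ : LabelCompat φ := by
    refine ⟨?_, ?_, ?_⟩
    · intro a c x v
      ext t
      fin_cases a <;> fin_cases c
      · rfl
      · change H.curry (x + 1 - 1, v) t = H.curry (x, v) t
        rw [add_sub_cancel_right]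
      · change C.curry (x + 1, v) t = C.curry (x, v) t
        rw [hC, hC, coe_circle_add_one]
      · change H.curry (x + 1, v) t = H.curry (x - 1, v) t
        have e : x + 1 = x - 1 + 2 * (1 : ℤ) := by
          push_cast
          ring
        rw [hH, hH, e]
        refine stripMap_congr (evenDist_add_two_mul _ _) ?_ (.inl rfl) _
        rw [stair_add_two_mul, coe_circle_add_int]
    · intro a c x v
      ext t
      by_cases hc : c = 0
      · simp only [φ, if_pos hc]
        rw [hC, hC, coe_circle_add_one]
      · simp only [φ, if_neg hc]
        rw [hH, hH]
        exact stripMap_congr rfl rfl (.inr rfl) _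
    · intro a c x v hx hv
      have hx' : |-x| ≤ 1 / 2 := by rwa [abs_neg]
      have key : ∀ y : ℝ, |y| ≤ 1 / 2 → ∀ t : I,
          H.curry (-y, v) t = C.curry (y, v) t := by
        intro y hy t
        rw [hH, hC, stripMap, if_pos (by rwa [evenDist_neg, evenDist_of_abs_le hy]), stair_neg,
          stair_of_abs_le hy, AddCircle.coe_neg, neg_neg]
      ext t
      fin_cases a <;> fin_cases c
      · rfl
      · change C.curry (-x, v) t = H.curry (x, v) t
        rw [← key (-x) hx' t, neg_neg]
      · exact key x hx t
      · change H.curry (-x - 1, v) t = H.curry (x - 1, v) t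
        rw [hH, hH]
        refine stripMap_congr ?_ ((stair_sub_one_eq hx').trans (stair_sub_one_eq hx).symm)
          (.inl rfl) _
        have := evenDist_add_two_mul (x - 1) 1
        rw [← this, ← evenDist_neg]
        congr 1
        push_cast
        ring
  have hcont : ∀ a c, Continuous fun q : ℝ × ℝ => φ a c q.1 q.2 := by
    intro a c
    by_cases hc : c = 0
    · simp only [φ, if_pos hc]
      exact C.curry.continuous.comp (((continuous_stairCoord a c).comp continuous_fst).prodMk
        continuous_snd)
    · simp only [φ, if_neg hc]
      refine H.curry.continuous.comp (Continuous.prodMk ?_ continuous_snd)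
      split_ifs <;> fun_prop
  obtain ⟨Φ, hΦ⟩ := exists_quot_map hφ hcont
  have hzero : ∀ (a c : ZMod 2) (x v : ℝ), φ a c x v 0 =
      torusToQuot ((stairCoord a c x : RModZ), (v : RModZ)) := by
    intro a c x v
    by_cases hc : c = 0
    · simp only [φ, if_pos hc]
      rw [hC]
    · simp only [φ, if_neg hc]
      rw [hH, Set.Icc.coe_zero, stripMap_zero, stairCoord, if_neg hc]
      split_ifs <;> rw [AddCircle.coe_neg]
  have hone : ∀ (a c : ZMod 2) (x v : ℝ), a ≠ 0 ∨ c ≠ 0 →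
      φ a c x v 1 = sheet (labelRep a c) x v := by
    intro a c x v h
    fin_cases a <;> fin_cases c
    · exact absurd rfl (h.elim id id)
    · exact stripMap_one x v
    · rfl
    · change stripMap (x - 1) v 1 = sheet (labelRep 1 1) x v
      have r11 := red_labelRep (a := 1) (c := 1) (by simp)
      have r01 := red_labelRep (a := 0) (c := 1) (by simp)
      have e := sheet_shift (g := labelRep 1 1) (h := labelRep 0 1) 1 0
        (by simp [r11, r01]) (by simp [r11, r01]) (x - 1) v
      rw [stripMap_one, ← e]
      norm_num
  refine ⟨⟨Φ.uncurry.comp ContinuousMap.prodSwap, fun P => ?_, fun P => ?_⟩⟩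
  · obtain ⟨p, rfl⟩ := Quotient.exists_rep P
    obtain ⟨k, hk⟩ := exists_isTop_smul p.1
    change Φ (clsG p) 0 = torusToQuot (quotToTorus (clsG p))
    rw [hΦ k p hk, hzero, quotToTorus_clsG hk]
  · obtain ⟨p, rfl⟩ := Quotient.exists_rep P
    obtain ⟨k, hk⟩ := exists_isTop_smul p.1
    change Φ (clsG p) 1 = clsG p
    rw [hΦ k p hk, hone _ _ _ _ (red_col_ne_zero k), clsG_eq_sheet_labelRep hk]

lemma map_torusToQuot_bijective (n : ℕ) :
    Function.Bijective (SingularCohomology.map n torusToQuot) :=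
  SingularCohomology.map_bijective_of_homotopic n _ quotToTorus
    (by rw [quotToTorus_comp_torusToQuot]) torusToQuot_comp_quotToTorus

/-! ### The maps on cohomology -/

/-- The inversion of the circle. -/
def circleNeg : C(RModZ, RModZ) := ⟨fun a => -a, continuous_neg⟩

lemma circleNeg_comp_circleNeg : circleNeg.comp circleNeg = .id _ := by
  ext1 a
  exact neg_neg a

lemma map_circleNeg_bijective (n : ℕ) : Function.Bijective (SingularCohomology.map n circleNeg) :=
  SingularCohomology.map_bijective_of_homotopic n _ circleNeg
    (by rw [circleNeg_comp_circleNeg]) (by rw [circleNeg_comp_circleNeg])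

lemma quotToCircle_comp_iMap_comp_torusToQuot :
    (quotToCircle.comp (orbitSpaceMap iHom (ContinuousMap.id retractX)
      id_equivariantAlong_iHom)).comp torusToQuot = ContinuousMap.snd := by
  ext1 ⟨x, v⟩
  obtain ⟨x, rfl⟩ := QuotientAddGroup.mk_surjective x
  obtain ⟨v, rfl⟩ := QuotientAddGroup.mk_surjective v
  change quotToCircle (orbitSpaceMap _ _ _ (torusToQuot ((x : RModZ), (v : RModZ)))) = (v : RModZ)
  rw [torusToQuot_eq_clsG]
  exact circleHeight_floorPt x v

lemma lineHeight_equivariantAlong_jHom {J : C(retractX, retractX)} (hJ : EquivariantAlong jHom J)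
    (u : ℤ√(-2)) (x v : ℝ) : lineHeight (J (floorX (x + u.re) (v + u.im))).1 =
      lineHeight (J (floorX x v)).1 - u.re := by
  rw [← trans_smul_floorX, ← lineHeight_jHom_transG_smul u (J (floorX x v)).1]
  exact congrArg (fun p : retractX => lineHeight p.1) (hJ (transG u) (floorX x v))

/-- Whatever `J` is, its map of orbit spaces restricts to minus the first coordinate on the
torus. -/
lemma quotToCircle_comp_jMap_comp_torusToQuot {J : C(retractX, retractX)}
    (hJ : EquivariantAlong jHom J) :
    ((quotToCircle.comp (orbitSpaceMap jHom J hJ)).comp torusToQuot).Homotopic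
      (circleNeg.comp ContinuousMap.fst) := by
  -- Adding `x` cancels the shift by `-u.re`. What remains is a real function `D` on the torus, with
  -- the map in question equal to `D - x` modulo 1; scaling `D` to `0` is the homotopy.
  have hcont : Continuous fun q : ℝ × ℝ => lineHeight (J (floorX q.1 q.2)).1 + q.1 :=
    (lineHeight.continuous.comp (continuous_subtype_val.comp
      (J.continuous.comp continuous_floorX))).add continuous_fst
  obtain ⟨D, hD⟩ := exists_torus_descend ⟨_, hcont⟩
    (fun x v => by
      have := lineHeight_equivariantAlong_jHom hJ 1 x v
      simp at this
      change lineHeight (J (floorX (x + 1) v)).1 + (x + 1) = lineHeight (J (floorX x v)).1 + x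
      rw [this]
      ring)
    (fun x v => by
      have := lineHeight_equivariantAlong_jHom hJ Zsqrtd.sqrtd x v
      simp at this
      change lineHeight (J (floorX x (v + 1))).1 + x = lineHeight (J (floorX x v)).1 + x
      rw [this])
  have hH : Continuous fun q : unitInterval × (RModZ × RModZ) =>
      (((1 - (q.1 : ℝ)) * D q.2 : ℝ) : RModZ) + -q.2.1 := by
    have h1 : Continuous fun q : unitInterval × (RModZ × RModZ) => (1 - (q.1 : ℝ)) * D q.2 := by
      fun_prop
    exact (continuous_coe_circle.comp h1).add (continuous_neg.comp (by fun_prop))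
  refine ⟨⟨⟨_, hH⟩, ?_, ?_⟩⟩
  · rintro ⟨x, v⟩
    obtain ⟨x, rfl⟩ := QuotientAddGroup.mk_surjective x
    obtain ⟨v, rfl⟩ := QuotientAddGroup.mk_surjective v
    change (((1 - ((0 : unitInterval) : ℝ)) * D ((x : RModZ), (v : RModZ)) : ℝ) : RModZ) +
      -(x : RModZ) =
        quotToCircle (orbitSpaceMap jHom J hJ (torusToQuot ((x : RModZ), (v : RModZ))))
    rw [torusToQuot_eq_clsG, hD]
    change _ = circleHeight (J (floorX x v)).1
    rw [← coe_lineHeight, ← AddCircle.coe_neg, ← AddCircle.coe_add]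
    congr 1
    simp
  · rintro ⟨a, b⟩
    change (((1 - ((1 : unitInterval) : ℝ)) * D (a, b) : ℝ) : RModZ) + -a = -a
    simp

lemma map_torusToQuot_iStar (n : ℕ) (x : SingularCohomology n RModZ) :
    SingularCohomology.map n torusToQuot (iStar n (SingularCohomology.map n quotToCircle x)) =
      SingularCohomology.map n ContinuousMap.snd x := by
  rw [← quotToCircle_comp_iMap_comp_torusToQuot, ← SingularCohomology.map_comp_apply,
    ← SingularCohomology.map_comp_apply]
  rfl

lemma map_torusToQuot_jMap (n : ℕ) {J : C(retractX, retractX)} (hJ : EquivariantAlong jHom J)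
    (x : SingularCohomology n RModZ) :
    SingularCohomology.map n torusToQuot (SingularCohomology.map n (orbitSpaceMap jHom J hJ)
      (SingularCohomology.map n quotToCircle x)) =
      SingularCohomology.map n ContinuousMap.fst (SingularCohomology.map n circleNeg x) := by
  rw [SingularCohomology.map_comp_apply, SingularCohomology.map_comp_apply,
    SingularCohomology.map_comp_apply, ← ContinuousMap.comp_assoc,
    SingularCohomology.map_eq_of_homotopic n (quotToCircle_comp_jMap_comp_torusToQuot hJ)]

/-- All equivariant maps induce the same map on cohomology. -/
lemma map_orbitSpaceMap_jHom_eq (n : ℕ) {J J' : C(retractX, retractX)}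
    (hJ : EquivariantAlong jHom J) (hJ' : EquivariantAlong jHom J') :
    SingularCohomology.map n (orbitSpaceMap jHom J hJ) =
      SingularCohomology.map n (orbitSpaceMap jHom J' hJ') := by
  ext y
  obtain ⟨x, rfl⟩ := (map_quotToCircle_bijective n).2 y
  apply (map_torusToQuot_bijective n).1
  rw [map_torusToQuot_jMap, map_torusToQuot_jMap]

/-- The map `(iⁿ, jⁿ)` is isomorphic to the map given by the projections of the torus. -/
lemma exists_equiv_torusProj (n : ℕ) {J : C(retractX, retractX)} (hJ : EquivariantAlong jHom J) :
    ∃ (e : (SingularCohomology n BianchiOrbitSpace × SingularCohomology n BianchiOrbitSpace)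
        ≃ₗ[ZMod 2] SingularCohomology n RModZ × SingularCohomology n RModZ)
      (f : SingularCohomology n Gamma0OrbitSpace ≃ₗ[ZMod 2]
        SingularCohomology n (RModZ × RModZ)),
      (f : _ →ₗ[ZMod 2] _) ∘ₗ
        (iStar n).coprod (SingularCohomology.map n (orbitSpaceMap jHom J hJ)) =
          torusProj n ∘ₗ (e : _ →ₗ[ZMod 2] _) := by
  let A := LinearEquiv.ofBijective _ (map_quotToCircle_bijective n)
  let N := LinearEquiv.ofBijective _ (map_circleNeg_bijective n)
  refine ⟨A.symm.prodCongr (A.symm.trans N),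
    LinearEquiv.ofBijective _ (map_torusToQuot_bijective n), ?_⟩
  refine LinearMap.ext fun ⟨y, z⟩ => ?_
  obtain ⟨y, rfl⟩ := A.surjective y
  obtain ⟨z, rfl⟩ := A.surjective z
  change SingularCohomology.map n torusToQuot (iStar n (A y) +
    SingularCohomology.map n (orbitSpaceMap jHom J hJ) (A z)) =
      torusProj n (A.symm (A y), N (A.symm (A z)))
  rw [A.symm_apply_apply, A.symm_apply_apply, torusProj_apply, map_add]
  exact congrArg₂ _ (map_torusToQuot_iStar n y) (map_torusToQuot_jMap n hJ z)

/-! ### Kernels and cokernels of isomorphic linear maps -/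

section

variable {k V W V' W' : Type} [Field k] [AddCommGroup V] [AddCommGroup W] [AddCommGroup V']
  [AddCommGroup W'] [Module k V] [Module k W] [Module k V'] [Module k W']
  {g : V →ₗ[k] W} {g' : V' →ₗ[k] W'} {e : V ≃ₗ[k] V'} {f : W ≃ₗ[k] W'}

lemma nonempty_ker_equiv (h : (f : W →ₗ[k] W') ∘ₗ g = g' ∘ₗ (e : V →ₗ[k] V')) :
    Nonempty (LinearMap.ker g ≃ₗ[k] LinearMap.ker g') := by
  refine ⟨e.ofSubmodules _ _ ?_⟩
  ext x
  rw [Submodule.mem_map_equiv, LinearMap.mem_ker, LinearMap.mem_ker]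
  have := LinearMap.congr_fun h (e.symm x)
  simp at this
  rw [← this]
  simp

lemma nonempty_coker_equiv (h : (f : W →ₗ[k] W') ∘ₗ g = g' ∘ₗ (e : V →ₗ[k] V')) :
    Nonempty ((W ⧸ LinearMap.range g) ≃ₗ[k] (W' ⧸ LinearMap.range g')) := by
  refine ⟨Submodule.Quotient.equiv _ _ f ?_⟩
  rw [← LinearMap.range_comp, h, LinearMap.range_comp_of_range_eq_top _ e.range]

end

end

theorem mainTheorem4 :
    ∃ jStar : ∀ n : ℕ, SingularCohomology n BianchiOrbitSpace →ₗ[ZMod 2]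
        SingularCohomology n Gamma0OrbitSpace,
      (∃ J : C(retractX, retractX), EquivariantAlong jHom J) ∧
      (∀ (J : C(retractX, retractX)) (hJ : EquivariantAlong jHom J) (n : ℕ),
        SingularCohomology.map n (orbitSpaceMap jHom J hJ) = jStar n) ∧
      (∀ n : ℕ, n ≠ 0 → Function.Injective ((iStar n).coprod (jStar n))) ∧
      (∀ n : ℕ, n ≠ 2 → Function.Surjective ((iStar n).coprod (jStar n))) ∧
      Nonempty (LinearMap.ker ((iStar 0).coprod (jStar 0)) ≃ₗ[ZMod 2] ZMod 2) ∧
      Nonempty ((SingularCohomology 2 Gamma0OrbitSpace ⧸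
        LinearMap.range ((iStar 2).coprod (jStar 2))) ≃ₗ[ZMod 2] ZMod 2) := by
  obtain ⟨J, hJ⟩ := exists_equivariantAlong_jHom
  refine ⟨fun n => SingularCohomology.map n (orbitSpaceMap jHom J hJ), ⟨J, hJ⟩,
    fun J' hJ' n => map_orbitSpaceMap_jHom_eq n hJ' hJ, fun n hn => ?_, fun n hn => ?_, ?_, ?_⟩
  · obtain ⟨e, f, h⟩ := exists_equiv_torusProj n hJ
    have h1 : Function.Injective (torusProj n ∘ e) :=
      (torusProj_injective n hn).comp e.injective
    have h2 : torusProj n ∘ e = f ∘ _ := (congrArg DFunLike.coe h).symm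
    rw [h2] at h1
    exact h1.of_comp
  · obtain ⟨e, f, h⟩ := exists_equiv_torusProj n hJ
    have h1 : Function.Surjective (torusProj n ∘ e) :=
      (torusProj_surjective n hn).comp e.surjective
    have h2 : torusProj n ∘ e = f ∘ _ := (congrArg DFunLike.coe h).symm
    rw [h2] at h1
    exact h1.of_comp_left f.injective
  · obtain ⟨e, f, h⟩ := exists_equiv_torusProj 0 hJ
    obtain ⟨a⟩ := nonempty_ker_equiv h
    obtain ⟨b⟩ := nonempty_ker_torusProj_zero
    exact ⟨a.trans b⟩
  · obtain ⟨e, f, h⟩ := exists_equiv_torusProj 2 hJ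
    obtain ⟨a⟩ := nonempty_coker_equiv h
    obtain ⟨b⟩ := nonempty_coker_torusProj_two
    exact ⟨a.trans b⟩
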